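/- **Setting.** All matrices are read from left to right: rows are incoming legs, columns are outgoing legs, and the matrix product is composition in reading order. Let $\mathcal C$ be a fusion category over $\mathbb C$ with simple objects $x\in\mathrm{Simp}(\mathcal C)$, $N_{xy}^z=\dim\mathrm{Hom}(x\otimes y,z)$, fixed bases $e^z_{xy,\mu}$ of the spaces $\mathrm{Hom}(x\otimes y,z)$, and F-symbols $(e^u_{xy,\mu}\otimes 1)$ followed by $e^w_{uz,\nu}$ $=\sum_{v,\rho,\sigma}(F^{xyz}_w)_{(u;\mu,\nu),(v;\rho,\sigma)}\,\big(\alpha_{x,y,z}$ followed by $(1\otimes e^v_{yz,\rho})$ followed by $e^w_{xv,\sigma}\big)$. An MPO representation of $\mathcal C$ consists of MPO tensors $\mathcal O_x^{ij}\in M_{\chi_x}(\mathbb C)$ ($x$ simple), injective in the sense that the products of positive length of the $\mathcal O_x^{ij}$ span $M_{\chi_x}(\mathbb C)$, with fusion tensors $(\phi_{xy}^z)_\mu:\mathbb C^{\chi_x}\otimes\mathbb C^{\chi_y}\to\mathbb C^{\chi_z}$ and splitting tensors $(\overline\phi{}_{xy}^z)_\mu:\mathbb C^{\chi_z}\to\mathbb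 C^{\chi_x}\otimes\mathbb C^{\chi_y}$ such that $\mathcal O_{x\otimes y}^{ik}:=\sum_j\mathcal O_x^{ij}\otimes\mathcal O_y^{jk}=\sum_{z,\mu}(\phi_{xy}^z)_\mu\,\mathcal O_z^{ik}\,(\overline\phi{}_{xy}^z)_\mu$, $(\overline\phi{}_{xy}^z)_\mu(\phi_{xy}^{z'})_\nu=\delta_{zz'}\delta_{\mu\nu}1$, and such that the $(\phi_{xy}^z)_\mu$ satisfy the F-symbol relation of the $e^z_{xy,\mu}$ with the same coefficients. Let $A^i\in M_D(\mathbb C)$ be an injective MPS tensor that is left canonical, i.e. $1_D$ is a left fixed point of $T_A=\sum_iA^{i*}\otimes A^i$, and let $\Lambda$ be a right fixed point of $T_A$ with $\operatorname{tr}\Lambda=1$. Suppose that $A$ is $\mathcal C$-symmetric: for each simple $x$ there are $n_x\ge1$ and action tensors $\hat\phi_x:F_x\otimes V\to\mathbb C^{\chi_x}\otimes V$ and $\hat\phi_x^{-1}:\mathbb C^{\chi_x}\otimes V\to F_x\otimes V$, where $F_x=\mathbb C^{n_x}$ and $V=\mathbb C^D$, with $\hat\phi_x\hat\phi_x^{-1}=1$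 and $\sum_j\mathcal O_x^{ij}\otimes A^j=\hat\phi_x^{-1}(1\otimes A^i)\hat\phi_x$. Let $(\phi_x)_i$ be the rows of $\hat\phi_x$ and $(\overline\phi_x)_i$ the columns of $\hat\phi_x^{-1}$. Auxiliary fusion and splitting tensors $(\varphi_{xy}^z)_\mu:F_x\otimes F_y\to F_z$ and $(\overline\varphi{}_{xy}^z)_\mu:F_z\to F_x\otimes F_y$ are required to satisfy the same orthogonality relation and the same F-symbol relation. Given them, put $\hat\phi_{x\otimes y}=\sum_{z,\mu}(\varphi_{xy}^z)_\mu\hat\phi_z(\overline\phi{}_{xy}^z)_\mu$ and $\hat\phi_{x\otimes y}^{-1}=\sum_{z,\mu}(\phi_{xy}^z)_\mu\hat\phi_z^{-1}(\overline\varphi{}_{xy}^z)_\mu$, and define $\hat\phi_{(x\otimes y)\otimes z}$ and $\hat\phi_{x\otimes(y\otimes z)}$ in the same way from iterated fusion and splitting tensors. For an MPO tensor $\mathcal O$ let $T_{\mathcal O}=\sum_{ij}A^{i*}\otimes\mathcal O^{ij}\otimes A^j$. Let $F^{\rm MPS}(x)$ and $F^{\rm MPS}(x\otimes y)$ be the spaces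 of left fixed points of $T_{\mathcal O_x}$ and $T_{\mathcal O_{x\otimes y}}$. Put $\Lambda_x^{L(i)}=(\phi_x)_i$ (i.e. $1_D$ followed by $(\phi_x)_i$) and $\Lambda_x^{R(i)}=(\overline\phi_x)_i\Lambda$, and similarly for $x\otimes y$. The triple inner product $J^{\rm MPS}_{x,y}:F^{\rm MPS}(x)\otimes F^{\rm MPS}(y)\to F^{\rm MPS}(x\otimes y)$ is the linear map whose matrix elements are the limits, for infinitely long wings, of the diagram with three wings built from $T_{\mathcal O_x}$, $T_{\mathcal O_y}$, $T_{\mathcal O_{x\otimes y}}$, glued along the MPS bonds with the identity of $\mathbb C^{\chi_x}\otimes\mathbb C^{\chi_y}$ in the middle, and terminated by left fixed points on the first two wings and by a right fixed point on the third. The L-symbols are defined by $(\phi_x)_i(\phi_y)_j=\sum_{z,k,\mu}L^{xy}_{(i,j),(z;k,\mu)}(\phi_z)_k(\overline\phi{}_{xy}^z)_\mu$. **Statement.** 1. $\{\Lambda_x^{L(i)}\}$ is a basis of $F^{\rm MPS}(x)$, and $\{\Lambda_x^{R(i)}\}$ is the dual basis of the space of right fixed points. Moreover $n_xn_y=\sum_zN_{xy}^zn_z$.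 The map $J^{\rm MPS}$ and the L-symbols exist and are unique, and auxiliary fusion tensors exist. 2. For every choice of auxiliary fusion tensors, $\hat\phi_{x\otimes y},\hat\phi_{x\otimes y}^{-1}$ are action tensors for $\mathcal O_{x\otimes y}$, the fixed points $\Lambda_{x\otimes y}^{L(k)}$ and $\Lambda_{x\otimes y}^{R(k)}$ are dual bases of the fixed-point spaces, and $\hat\phi_{(x\otimes y)\otimes z}=\hat\phi_{x\otimes(y\otimes z)}$. There are unique $\Omega_{x,y}$, $\Omega_{x\otimes y,z}$, $\Omega_{x,y\otimes z}$ with $\hat\phi_x\hat\phi_y=\Omega_{x,y}\hat\phi_{x\otimes y}$, $\hat\phi_{x\otimes y}\hat\phi_z=\Omega_{x\otimes y,z}\hat\phi_{(x\otimes y)\otimes z}$ and $\hat\phi_x\hat\phi_{y\otimes z}=\Omega_{x,y\otimes z}\hat\phi_{x\otimes(y\otimes z)}$. They are invertible and satisfy the non-abelian cocycle condition: $\Omega_{x,y}\otimes1_z$ followed by $\Omega_{x\otimes y,z}$ equals $1_x\otimes\Omega_{y,z}$ followed by $\Omega_{x,y\otimes z}$. 3. $\langle\Lambda_{x\otimes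 y}^{R(k)}|J^{\rm MPS}_{x,y}|\Lambda_x^{L(i)}\otimes\Lambda_y^{L(j)}\rangle=(\Omega_{x,y})_{(i,j),k}$, and the diagram has this value for wings of every finite length. 4. $L^{xy}_{(i,j),(z;k,\mu)}=\frac1D\operatorname{tr}\big((\phi_x)_i(\phi_y)_j(\phi_{xy}^z)_\mu(\overline\phi_z)_k\big)=\big(\Omega_{x,y}(\varphi_{xy}^z)_\mu\big)_{(i,j),k}$. This is also the value of the triple diagram with third wing $T_{\mathcal O_z}$, with $(\phi_{xy}^z)_\mu$ inserted in the middle, terminated by $\Lambda_x^{L(i)},\Lambda_y^{L(j)},\Lambda_z^{R(k)}$. 5. $(F^{\rm MPS},J^{\rm MPS})$ is a fiber functor: there is a $\mathbb C$-linear strong monoidal functor $(F,J)$ from $\mathcal C$ to finite-dimensional vector spaces, with isomorphisms $F(x)\cong F^{\rm MPS}(x)$ and $F(x\otimes y)\cong F^{\rm MPS}(x\otimes y)$ for simple $x,y$, under which $J_{x,y}$ is $J^{\rm MPS}_{x,y}$ and $F(e^z_{xy,\mu})$ is composition with $(\phi_{xy}^z)_\mu$. In particular its matrix elements are the L-symbols: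 $F(e^z_{xy,\mu})\,J_{x,y}(\Lambda_x^{L(i)}\otimes\Lambda_y^{L(j)})=\sum_kL^{xy}_{(i,j),(z;k,\mu)}\Lambda_z^{L(k)}$. -/

import Mathlib

open CategoryTheory MonoidalCategory
open scoped Kronecker TensorProduct Topology

universe v u

noncomputable section

namespace MPSFiber

/-! ### Fusion categories and their F-symbols -/

section Category

variable {C : Type u} [Category.{v} C] [Preadditive C] [Linear ℂ C] [MonoidalCategory C]
variable {ι : Type} [Fintype ι]

/-- `C` is a fusion category over `ℂ` with `S : ι → C` a (finite) set of representatives of the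
isomorphism classes of simple objects: the unit and all `S x` have one-dimensional endomorphism
spaces, there are no nonzero morphisms between different `S x`, and each object is a finite direct
sum of objects `S x`.  (Bilinearity of the tensor product, finite direct sums and duals are the type
classes among the arguments.) -/
structure IsFusionCategory [MonoidalPreadditive C] [MonoidalLinear ℂ C] [RigidCategory C]
    [Limits.HasFiniteBiproducts C] (S : ι → C) : Prop where
  end_unit : Module.finrank ℂ (𝟙_ C ⟶ 𝟙_ C) = 1
  end_simple : ∀ x, Module.finrank ℂ (S x ⟶ S x) = 1
  hom_eq_zero : ∀ x y, x ≠ y → ∀ f : S x ⟶ S y, f = 0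
  semisimple : ∀ c : C, ∃ (m : ℕ) (f : Fin m → ι),
    Nonempty (c ≅ Limits.biproduct fun k => S (f k))

/-- The fusion coefficient `N_{xy}^z = dim Hom(x ⊗ y, z)`. -/
def mult (S : ι → C) (x y z : ι) : ℕ := Module.finrank ℂ (S x ⊗ S y ⟶ S z)

/-- A choice of bases of all the spaces `Hom(x ⊗ y, z)` with `x, y, z` simple. -/
abbrev FusionBasis (S : ι → C) : Type v :=
  ∀ x y z : ι, Module.Basis (Fin (mult S x y z)) ℂ (S x ⊗ S y ⟶ S z)

/-- Families of numbers `(F^{xyz}_w)_{(u; μ, ν), (v; ρ, σ)}`. -/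
abbrev FFamily (S : ι → C) : Type :=
  ∀ x y z w u : ι, Fin (mult S x y u) → Fin (mult S u z w) →
    ∀ v : ι, Fin (mult S y z v) → Fin (mult S x v w) → ℂ

/-- `F` is the family of F-symbols of `C` with respect to the bases `e`. -/
def IsFSymbols {S : ι → C} (e : FusionBasis S) (F : FFamily S) : Prop :=
  ∀ (x y z w u : ι) (μ : Fin (mult S x y u)) (ν : Fin (mult S u z w)),
    (e x y u μ ▷ S z) ≫ e u z w ν =
      ∑ v, ∑ ρ, ∑ σ, F x y z w u μ ν v ρ σ •
        ((α_ (S x) (S y) (S z)).hom ≫ (S x ◁ e y z v ρ) ≫ e x v w σ)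

/-- Fusion tensors `fus = (φ_{xy}^z)_μ` and splitting tensors `spl = (φ̄_{xy}^z)_μ` on bond spaces
`ℂ ^ m x`, with the orthogonality relation and with F-symbols `F`.  All matrices in this file are
read from left to right: the row index is the incoming (left) leg and the column index the outgoing
(right) leg, so that `fus x y z μ` goes from the bonds `x`, `y` to the bond `z`, and the matrix
product is composition in reading order. -/
structure FusionTensors (S : ι → C) (F : FFamily S) (m : ι → ℕ) where
  fus : ∀ x y z, Fin (mult S x y z) → Matrix (Fin (m x) × Fin (m y)) (Fin (m z)) ℂ
  spl : ∀ x y z, Fin (mult S x y z) → Matrix (Fin (m z)) (Fin (m x) × Fin (m y)) ℂ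
  spl_mul_fus : ∀ x y z μ ν, spl x y z μ * fus x y z ν = if μ = ν then 1 else 0
  spl_mul_fus_of_ne : ∀ x y z z', z ≠ z' → ∀ μ ν, spl x y z μ * fus x y z' ν = 0
  fus_assoc : ∀ (x y z w u : ι) (μ : Fin (mult S x y u)) (ν : Fin (mult S u z w)),
    (fus x y u μ ⊗ₖ (1 : Matrix (Fin (m z)) (Fin (m z)) ℂ)) * fus u z w ν =
      (∑ v, ∑ ρ, ∑ σ, F x y z w u μ ν v ρ σ •
        (((1 : Matrix (Fin (m x)) (Fin (m x)) ℂ) ⊗ₖ fus y z v ρ) * fus x v w σ)).submatrix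
          (Equiv.prodAssoc _ _ _) id

/-- A fiber functor of `C`: a `ℂ`-linear (strong) monoidal functor from `C` to the category of
finite-dimensional complex vector spaces. -/
structure FiberFunctor (C : Type u) [Category.{v} C] [Preadditive C] [Linear ℂ C]
    [MonoidalCategory C] where
  F : C ⥤ FGModuleCat.{0} ℂ
  additive : F.Additive
  linear : F.Linear ℂ
  monoidal : F.Monoidal

/-- The tensorator `J_{c,c'} : F(c) ⊗ F(c') → F(c ⊗ c')` evaluated on vectors. -/
def FiberFunctor.tensorator (G : FiberFunctor C) (c c' : C) (s : G.F.obj c) (t : G.F.obj c') :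
    G.F.obj (c ⊗ c') :=
  letI := G.monoidal
  (Functor.LaxMonoidal.μ G.F c c').hom.hom (s ⊗ₜ[ℂ] t)

/-- The linear map `F(f)` evaluated on a vector. -/
def FiberFunctor.mapVec (G : FiberFunctor C) {c c' : C} (f : c ⟶ c') (s : G.F.obj c) :
    G.F.obj c' :=
  (G.F.map f).hom.hom s

end Category

/-! ### Matrix product states and operators, transfer matrices, triple inner product -/

section Tensor

variable {P : Type} [Fintype P] {D : ℕ}

/-- A family of matrices is injective if the products of its members (of positive length) span the
full matrix algebra. -/
def IsInjective {Q : Type} {m : ℕ} (A : Q → Matrix (Fin m) (Fin m) ℂ) : Prop :=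
  NonUnitalAlgebra.adjoin ℂ (Set.range A) = ⊤

/-- The product of two MPO tensors: `(O O')^{ik} = ∑ j, O^{ij} ⊗ O'^{jk}`. -/
def mulMPO {M N : Type} (O : P → P → Matrix M M ℂ) (O' : P → P → Matrix N N ℂ) :
    P → P → Matrix (M × N) (M × N) ℂ :=
  fun i k => ∑ j, O i j ⊗ₖ O' j k

/-- The transfer matrix `T_A = ∑ i, A^{i*} ⊗ A^i`. -/
def transfer (A : P → Matrix (Fin D) (Fin D) ℂ) : Matrix (Fin D × Fin D) (Fin D × Fin D) ℂ :=
  ∑ i, (A i).map star ⊗ₖ A i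

/-- The mixed transfer matrix `T = ∑ i j, A^{i*} ⊗ O^{ij} ⊗ A^j`. -/
def mixedTransfer {M : Type} (A : P → Matrix (Fin D) (Fin D) ℂ) (O : P → P → Matrix M M ℂ) :
    Matrix ((Fin D × M) × Fin D) ((Fin D × M) × Fin D) ℂ :=
  ∑ i, ∑ j, ((A i).map star ⊗ₖ O i j) ⊗ₖ A j

/-- `A` is left canonical: the identity is a left fixed point of the transfer matrix. -/
def IsLeftCanonical (A : P → Matrix (Fin D) (Fin D) ℂ) : Prop :=
  Matrix.vecMul (fun p => (1 : Matrix (Fin D) (Fin D) ℂ) p.1 p.2) (transfer A) =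
    fun p => (1 : Matrix (Fin D) (Fin D) ℂ) p.1 p.2

/-- `Λ` is a right fixed point of the transfer matrix `T_A`, normalized to `tr Λ = 1`. -/
def IsNormalizedRightFixed (A : P → Matrix (Fin D) (Fin D) ℂ) (Λ : Fin D × Fin D → ℂ) : Prop :=
  Matrix.mulVec (transfer A) Λ = Λ ∧ ∑ a, Λ (a, a) = 1

/-- The space of left fixed points of the mixed transfer matrix. -/
def leftFixed {M : Type} [Fintype M] (A : P → Matrix (Fin D) (Fin D) ℂ)
    (O : P → P → Matrix M M ℂ) : Submodule ℂ ((Fin D × M) × Fin D → ℂ) :=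
  LinearMap.ker ((mixedTransfer A O).vecMulLinear - LinearMap.id)

/-- The space of right fixed points of the mixed transfer matrix. -/
def rightFixed {M : Type} [Fintype M] (A : P → Matrix (Fin D) (Fin D) ℂ)
    (O : P → P → Matrix M M ℂ) : Submodule ℂ ((Fin D × M) × Fin D → ℂ) :=
  LinearMap.ker ((mixedTransfer A O).mulVecLin - LinearMap.id)

/-- `φ`, `φinv` are action tensors `φ̂`, `φ̂⁻¹` (with auxiliary index type `K`) for the MPO tensor `O`
on the MPS tensor `A`: `φ̂⁻¹` is a right inverse of `φ̂` and
`∑ j, O^{ij} ⊗ A^j = φ̂⁻¹ (1 ⊗ A^i) φ̂`. The rows of `φ̂` are the tensors `φ_k : V → M ⊗ V` and the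
columns of `φ̂⁻¹` are the tensors `φ̄_k : M ⊗ V → V`, for `k` in `K`. -/
structure IsAction {M K : Type} [Fintype M] [Fintype K] [DecidableEq K]
    (A : P → Matrix (Fin D) (Fin D) ℂ) (O : P → P → Matrix M M ℂ)
    (φ : Matrix (K × Fin D) (M × Fin D) ℂ) (φinv : Matrix (M × Fin D) (K × Fin D) ℂ) : Prop where
  orth : φ * φinv = 1
  symm : ∀ i, ∑ j, O i j ⊗ₖ A j = φinv * ((1 : Matrix K K ℂ) ⊗ₖ A i) * φ

/-- The left fixed points `Λ^{L(k)}`, i.e. `Λ_A^L = 1` followed by `φ_k`. -/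
def leftVec {M K : Type} (φ : Matrix (K × Fin D) (M × Fin D) ℂ) (k : K) :
    (Fin D × M) × Fin D → ℂ :=
  fun s => φ (k, s.1.1) (s.1.2, s.2)

/-- The right fixed points `Λ^{R(k)}`, i.e. `φ̄_k` followed by `Λ = Λ_A^R`. -/
def rightVec {M K : Type} (φinv : Matrix (M × Fin D) (K × Fin D) ℂ) (Λ : Fin D × Fin D → ℂ)
    (k : K) : (Fin D × M) × Fin D → ℂ :=
  fun s => ∑ b, φinv (s.1.2, s.2) (k, b) * Λ (s.1.1, b)

/-- The successive application `(φ_i)(φ'_j)` of two action tensors: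
`V → M ⊗ V → M ⊗ N ⊗ V` in reading order. -/
def mulAction {M N K K' : Type} (φ : Matrix (K × Fin D) (M × Fin D) ℂ)
    (φ' : Matrix (K' × Fin D) (N × Fin D) ℂ) :
    Matrix ((K × K') × Fin D) ((M × N) × Fin D) ℂ :=
  fun s t => ∑ b, φ (s.1.1, s.2) (t.1.1, b) * φ' (s.1.2, b) (t.1.2, t.2)

/-- A matrix on a bond tensored with the identity on the MPS bond space `V`. -/
def onBond (D : ℕ) {M N : Type} (X : Matrix M N ℂ) : Matrix (M × Fin D) (N × Fin D) ℂ :=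
  X ⊗ₖ (1 : Matrix (Fin D) (Fin D) ℂ)

/-- The triple diagram with three wings of lengths `L₁, L₂, L₃`.  The wings carry the mixed transfer
matrices of `O₁`, `O₂`, `O₃`, terminated by the left vectors `s`, `t` and the right vector `w`. In
the middle, the MPO bonds of the wings 1, 2, 3 are joined by the tensor `X`, the `A`-bond of wing 1
is joined to the `A*`-bond of wing 2, the `A*`-bond of wing 1 to the `A*`-bond of wing 3, and the
`A`-bond of wing 2 to the `A`-bond of wing 3. -/
def tripleDiagram {M₁ M₂ M₃ : Type} [Fintype M₁] [Fintype M₂] [Fintype M₃]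
    [DecidableEq M₁] [DecidableEq M₂] [DecidableEq M₃]
    (A : P → Matrix (Fin D) (Fin D) ℂ)
    (O₁ : P → P → Matrix M₁ M₁ ℂ) (O₂ : P → P → Matrix M₂ M₂ ℂ) (O₃ : P → P → Matrix M₃ M₃ ℂ)
    (X : Matrix (M₁ × M₂) M₃ ℂ) (L₁ L₂ L₃ : ℕ)
    (s : (Fin D × M₁) × Fin D → ℂ) (t : (Fin D × M₂) × Fin D → ℂ)
    (w : (Fin D × M₃) × Fin D → ℂ) : ℂ :=
  ∑ a, ∑ b, ∑ c, ∑ p, ∑ q, ∑ r,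
    Matrix.vecMul s (mixedTransfer A O₁ ^ L₁) ((a, p), b) *
      Matrix.vecMul t (mixedTransfer A O₂ ^ L₂) ((b, q), c) * X (p, q) r *
      Matrix.mulVec (mixedTransfer A O₃ ^ L₃) w ((a, r), c)

/-- Composition of a left vector with a tensor `X` on the MPO bond. -/
def actOnBond {M N : Type} [Fintype M] (s : (Fin D × M) × Fin D → ℂ) (X : Matrix M N ℂ) :
    (Fin D × N) × Fin D → ℂ :=
  fun t => ∑ p, s ((t.1.1, p), t.2) * X p t.1.2

end Tensor

/-! ### Symmetric matrix product states -/

section Symmetric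

variable {C : Type u} [Category.{v} C] [Preadditive C] [Linear ℂ C] [MonoidalCategory C]
variable {ι : Type} [Fintype ι]

/-- A matrix product operator representation, on a physical space with basis `P`, of the fusion
category with simple objects `S` and F-symbols `F`: injective MPO tensors `O x` of bond dimension
`χ x`, and fusion and splitting tensors with F-symbols `F` that decompose the products of the
`O x`. -/
structure MPORep (S : ι → C) (F : FFamily S) (P : Type) [Fintype P] where
  χ : ι → ℕ
  O : ∀ x, P → P → Matrix (Fin (χ x)) (Fin (χ x)) ℂ
  injective : ∀ x, IsInjective fun ij : P × P => O x ij.1 ij.2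
  T : FusionTensors S F χ
  fusion : ∀ x y i k, mulMPO (O x) (O y) i k =
    ∑ z, ∑ μ, T.fus x y z μ * O z i k * T.spl x y z μ

variable {S : ι → C} {F : FFamily S} {P : Type} [Fintype P] {D : ℕ}

/-- The data that make the MPS tensor `A` symmetric under the MPO representation `R`: for every
simple object `x` a positive number `n x` and action tensors `φ̂_x`, `φ̂_x⁻¹` with auxiliary space
`F_x = ℂ ^ n x`. -/
structure Symmetry (R : MPORep S F P) (A : P → Matrix (Fin D) (Fin D) ℂ) where
  n : ι → ℕ
  n_pos : ∀ x, 0 < n x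
  act : ∀ x, Matrix (Fin (n x) × Fin D) (Fin (R.χ x) × Fin D) ℂ
  inv : ∀ x, Matrix (Fin (R.χ x) × Fin D) (Fin (n x) × Fin D) ℂ
  isAction : ∀ x, IsAction A (R.O x) (act x) (inv x)

/-- The MPO tensor of `x ⊗ y`. -/
def MPORep.O₂ (R : MPORep S F P) (x y : ι) :
    P → P → Matrix (Fin (R.χ x) × Fin (R.χ y)) (Fin (R.χ x) × Fin (R.χ y)) ℂ :=
  mulMPO (R.O x) (R.O y)

namespace Symmetry

variable {R : MPORep S F P} {A : P → Matrix (Fin D) (Fin D) ℂ} (Φ : Symmetry R A)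

/-- The action tensor `φ̂_{x ⊗ y}`, built with the fusion tensors `B` of the auxiliary spaces. -/
def act₂ (B : FusionTensors S F Φ.n) (x y : ι) :
    Matrix ((Fin (Φ.n x) × Fin (Φ.n y)) × Fin D) ((Fin (R.χ x) × Fin (R.χ y)) × Fin D) ℂ :=
  ∑ z, ∑ μ, onBond D (B.fus x y z μ) * Φ.act z * onBond D (R.T.spl x y z μ)

/-- The right inverse `φ̂_{x ⊗ y}⁻¹`. -/
def inv₂ (B : FusionTensors S F Φ.n) (x y : ι) :
    Matrix ((Fin (R.χ x) × Fin (R.χ y)) × Fin D) ((Fin (Φ.n x) × Fin (Φ.n y)) × Fin D) ℂ :=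
  ∑ z, ∑ μ, onBond D (R.T.fus x y z μ) * Φ.inv z * onBond D (B.spl x y z μ)

/-- The action tensor `φ̂_{(x ⊗ y) ⊗ z}`. -/
def actLeft (B : FusionTensors S F Φ.n) (x y z : ι) :
    Matrix (((Fin (Φ.n x) × Fin (Φ.n y)) × Fin (Φ.n z)) × Fin D)
      (((Fin (R.χ x) × Fin (R.χ y)) × Fin (R.χ z)) × Fin D) ℂ :=
  ∑ w, ∑ u, ∑ μ, ∑ ν,
    onBond D ((B.fus x y u μ ⊗ₖ (1 : Matrix (Fin (Φ.n z)) (Fin (Φ.n z)) ℂ)) * B.fus u z w ν) *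
      Φ.act w *
      onBond D (R.T.spl u z w ν *
        (R.T.spl x y u μ ⊗ₖ (1 : Matrix (Fin (R.χ z)) (Fin (R.χ z)) ℂ)))

/-- The action tensor `φ̂_{x ⊗ (y ⊗ z)}`. -/
def actRight (B : FusionTensors S F Φ.n) (x y z : ι) :
    Matrix ((Fin (Φ.n x) × (Fin (Φ.n y) × Fin (Φ.n z))) × Fin D)
      ((Fin (R.χ x) × (Fin (R.χ y) × Fin (R.χ z))) × Fin D) ℂ :=
  ∑ w, ∑ v, ∑ ρ, ∑ σ,
    onBond D (((1 : Matrix (Fin (Φ.n x)) (Fin (Φ.n x)) ℂ) ⊗ₖ B.fus y z v ρ) * B.fus x v w σ) *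
      Φ.act w *
      onBond D (R.T.spl x v w σ *
        ((1 : Matrix (Fin (R.χ x)) (Fin (R.χ x)) ℂ) ⊗ₖ R.T.spl y z v ρ))

/-- `Ω` is the non-abelian factor system for pairs of simple objects:
`φ̂_x φ̂_y = Ω_{x,y} φ̂_{x ⊗ y}`.  As a linear map, `Ω_{x,y}` sends the basis vector
`v_i ⊗ v_j` to `∑ k, Ω_{x,y} (i, j) k • v_k`. -/
def IsOmega (B : FusionTensors S F Φ.n)
    (Ω : ∀ x y, Matrix (Fin (Φ.n x) × Fin (Φ.n y)) (Fin (Φ.n x) × Fin (Φ.n y)) ℂ) : Prop :=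
  ∀ x y, mulAction (Φ.act x) (Φ.act y) = onBond D (Ω x y) * Φ.act₂ B x y

/-- `Ω` is the factor system `Ω_{x ⊗ y, z}`: `φ̂_{x ⊗ y} φ̂_z = Ω_{x ⊗ y, z} φ̂_{(x ⊗ y) ⊗ z}`. -/
def IsOmegaLeft (B : FusionTensors S F Φ.n)
    (Ω : ∀ x y z, Matrix ((Fin (Φ.n x) × Fin (Φ.n y)) × Fin (Φ.n z))
      ((Fin (Φ.n x) × Fin (Φ.n y)) × Fin (Φ.n z)) ℂ) : Prop :=
  ∀ x y z, mulAction (Φ.act₂ B x y) (Φ.act z) = onBond D (Ω x y z) * Φ.actLeft B x y z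

/-- `Ω` is the factor system `Ω_{x, y ⊗ z}`: `φ̂_x φ̂_{y ⊗ z} = Ω_{x, y ⊗ z} φ̂_{x ⊗ (y ⊗ z)}`. -/
def IsOmegaRight (B : FusionTensors S F Φ.n)
    (Ω : ∀ x y z, Matrix (Fin (Φ.n x) × (Fin (Φ.n y) × Fin (Φ.n z)))
      (Fin (Φ.n x) × (Fin (Φ.n y) × Fin (Φ.n z))) ℂ) : Prop :=
  ∀ x y z, mulAction (Φ.act x) (Φ.act₂ B y z) = onBond D (Ω x y z) * Φ.actRight B x y z

/-- Families of numbers `L^{xy}_{(i,j),(z;k,μ)}`. -/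
abbrev LFamily : Type :=
  ∀ x y : ι, Fin (Φ.n x) → Fin (Φ.n y) → ∀ z, Fin (Φ.n z) → Fin (mult S x y z) → ℂ

/-- `L` is the family of L-symbols:
`(φ_x)_i (φ_y)_j = ∑ z k μ, L^{xy}_{(i,j),(z;k,μ)} (φ_z)_k (φ̄_{xy}^z)_μ`. -/
def IsLSymbols (L : Φ.LFamily) : Prop :=
  ∀ x y i j a s, mulAction (Φ.act x) (Φ.act y) ((i, j), a) s =
    ∑ z, ∑ k, ∑ μ, L x y i j z k μ * (Φ.act z * onBond D (R.T.spl x y z μ)) (k, a) s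

end Symmetry

/-- Families of linear maps `F^MPS(x) ⊗ F^MPS(y) → F^MPS(x ⊗ y)` for simple `x`, `y`, where
`F^MPS` is the space of left fixed points of the mixed transfer matrix. -/
abbrev JFamily (R : MPORep S F P) (A : P → Matrix (Fin D) (Fin D) ℂ) : Type :=
  ∀ x y, leftFixed A (R.O x) ⊗[ℂ] leftFixed A (R.O y) →ₗ[ℂ] leftFixed A (R.O₂ x y)

/-- `J` is the triple inner product of infinite MPSs: its matrix elements between fixed points are
the values of the triple diagram, with the identity of the bond space of `x ⊗ y` in the middle, in
the limit of infinitely long wings. -/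
def IsTripleInnerProduct (R : MPORep S F P) (A : P → Matrix (Fin D) (Fin D) ℂ)
    (J : JFamily R A) : Prop :=
  ∀ x y (s : leftFixed A (R.O x)) (t : leftFixed A (R.O y)) (w : rightFixed A (R.O₂ x y)),
    Filter.Tendsto (fun ℓ : ℕ × ℕ × ℕ =>
      tripleDiagram A (R.O x) (R.O y) (R.O₂ x y) 1 ℓ.1 ℓ.2.1 ℓ.2.2 s.1 t.1 w.1)
      Filter.atTop (𝓝 ((J x y (s ⊗ₜ[ℂ] t)).1 ⬝ᵥ w.1))

end Symmetric

end MPSFiber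

end

open MPSFiber

/-! The engine is a Perron–Frobenius statement: for an injective left canonical `A`, the only
matrices with `∑ i, (A i)ᴴ * X * A i = X` are the scalars (`exists_smul_one_of_fixed`). Given action
tensors `φ`, `φinv` of an MPO tensor, multiplying a left fixed point of the mixed transfer matrix by
`φinv` yields blocks that are fixed in this sense, so the fixed point is a combination of the rows
of `φ` (`exists_eq_sum_leftVec`). Since `φ * φinv = 1` and `tr Λ = 1`, these rows are dual to the
columns of `φinv` followed by `Λ`. Hence two action tensors of the same MPO tensor differ by a
unique invertible matrix on the auxiliary spaces (`IsAction.exists_eq_onBond_mul`,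
`IsAction.exists_inverse`).

The algebra of factor systems is then a comparison of action tensors of `O₂ x y`. Comparing the
product `φ̂_x φ̂_y` with the direct sum of the `φ̂_z` over the fusion channels gives the dimension
formula and the L-symbols; associativity of the product makes the L-symbols themselves auxiliary
fusion tensors (`exists_isLSymbols`). Comparing the product with `φ̂_{x ⊗ y}` gives `Ω`. The cocycle
condition expresses one threefold product in two ways, and rests on `actLeft_eq_actRight`. That in
turn needs an F-symbol relation for the splitting tensors, which is not assumed but forced by
injectivity of the MPO tensors (`sum_smul_split_eq`).

On fixed points the wings of a triple diagram act trivially, so the limit is that of a constant and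
`J` glues two fixed points along an MPS bond.

For the fiber functor, every object is decomposed into simple ones and each simple `x` is sent to `ℂ
^ n x`. By Schur's lemma morphisms become matrices, and the fusion tensors define the tensorator.
Its associativity is the F-symbol relation; its invertibility is the completeness of the fusion
channels, which holds by the dimension formula (`tensorMat_assoc`, `tensorMat_mul_cotensorMat`). The
unit constraint comes for free: the space of the unit object is one-dimensional, it contains a
vector with `u · u = u`, and multiplication by `u` is idempotent and injective, hence the identity
(`exists_unit`). With the L-symbols as fusion tensors, this tensorator is the gluing of fixed
points. -/

namespace MPSFiber

open Matrix

/-! ### Fixed points of an injective left canonical tensor -/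

section Perron

open scoped ComplexOrder

variable {P : Type} {D : ℕ} {A : P → Matrix (Fin D) (Fin D) ℂ}

/-- If every member of an injective family kills `X` from the left, then `X = 0`. -/
theorem IsInjective.eq_zero_of_mul_eq_zero {Q : Type} {m : ℕ} {B : Q → Matrix (Fin m) (Fin m) ℂ}
    (hB : IsInjective B) {N : Type} {X : Matrix (Fin m) N ℂ} (h : ∀ q, B q * X = 0) : X = 0 := by
  have key : ∀ Y : Matrix (Fin m) (Fin m) ℂ, Y * X = 0 := by
    intro Y
    have hY : Y ∈ NonUnitalAlgebra.adjoin ℂ (Set.range B) := by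
      rw [show NonUnitalAlgebra.adjoin ℂ (Set.range B) = ⊤ from hB]; trivial
    induction hY using NonUnitalAlgebra.adjoin_induction with
    | mem x hx => obtain ⟨q, rfl⟩ := hx; exact h q
    | add x y _ _ hx hy => rw [Matrix.add_mul, hx, hy, add_zero]
    | zero => rw [Matrix.zero_mul]
    | mul x y _ _ hx hy => rw [Matrix.mul_assoc, hy, Matrix.mul_zero]
    | smul r x _ hx => rw [Matrix.smul_mul, hx, smul_zero]
  simpa using key 1

/-- If `Y` kills some `v ≠ 0` and its kernel is invariant under an injective family, then
`Y = 0`. -/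
theorem IsInjective.eq_zero_of_ker_invariant (hA : IsInjective A) {Y : Matrix (Fin D) (Fin D) ℂ}
    (hinv : ∀ i v, Y *ᵥ v = 0 → Y *ᵥ (A i *ᵥ v) = 0) {v : Fin D → ℂ} (hv : v ≠ 0)
    (hYv : Y *ᵥ v = 0) : Y = 0 := by
  have key : ∀ B : Matrix (Fin D) (Fin D) ℂ, ∀ w, Y *ᵥ w = 0 → Y *ᵥ (B *ᵥ w) = 0 := by
    intro B
    have hB : B ∈ NonUnitalAlgebra.adjoin ℂ (Set.range A) := by
      rw [show NonUnitalAlgebra.adjoin ℂ (Set.range A) = ⊤ from hA]; trivial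
    induction hB using NonUnitalAlgebra.adjoin_induction with
    | mem x hx => obtain ⟨q, rfl⟩ := hx; exact hinv q
    | add x y _ _ hx hy =>
      intro w hw; rw [Matrix.add_mulVec, Matrix.mulVec_add, hx w hw, hy w hw, add_zero]
    | zero => intro w _; simp
    | mul x y _ _ hx hy => intro w hw; rw [← Matrix.mulVec_mulVec]; exact hx _ (hy w hw)
    | smul r x _ hx => intro w hw; rw [Matrix.smul_mulVec, Matrix.mulVec_smul, hx w hw, smul_zero]
  obtain ⟨b, hb⟩ : ∃ b, v b ≠ 0 := by
    by_contra! hcon; exact hv (funext hcon)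
  ext i j
  have h1 := key (Matrix.single j b (v b)⁻¹) v hYv
  have h2 : Matrix.single j b (v b)⁻¹ *ᵥ v = Pi.single j 1 := by
    rw [Matrix.single_mulVec]; congr 1; exact inv_mul_cancel₀ hb
  rw [h2] at h1
  simpa using congrFun h1 i

variable [Fintype P]

/-- With `l` the largest eigenvalue of `X`, the matrix `Y = l - X` is positive semidefinite,
singular and fixed. If `Y v = 0`, then `0 = ⟨v, Y v⟩` is the sum of the nonnegative numbers `⟨A i v,
Y (A i v)⟩`, so each `A i v` lies in the kernel as well. By injectivity a nonzero invariant kernel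
is everything. -/
theorem exists_smul_one_of_isHermitian_of_fixed (hA : IsInjective A) (h1 : ∑ i, (A i)ᴴ * A i = 1)
    (hD : 0 < D) {X : Matrix (Fin D) (Fin D) ℂ} (hX : X.IsHermitian)
    (hfix : ∑ i, (A i)ᴴ * X * A i = X) : ∃ c : ℂ, X = c • 1 := by
  have : Nonempty (Fin D) := ⟨⟨0, hD⟩⟩
  obtain ⟨j, hj⟩ := Finite.exists_max hX.eigenvalues
  set l : ℝ := hX.eigenvalues j
  refine ⟨l, ?_⟩
  set Y : Matrix (Fin D) (Fin D) ℂ := (l : ℂ) • 1 - X with hYdef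
  have hYpos : Y.PosSemidef := by
    have hdiag : (Matrix.diagonal fun k => ((l - hX.eigenvalues k : ℝ) : ℂ)).PosSemidef := by
      rw [Matrix.posSemidef_diagonal_iff]
      intro k
      exact_mod_cast sub_nonneg.2 (hj k)
    have hU := Matrix.mem_unitaryGroup_iff.1 hX.eigenvectorUnitary.2
    have := hdiag.mul_mul_conjTranspose_same (hX.eigenvectorUnitary : Matrix (Fin D) (Fin D) ℂ)
    convert this using 1
    have hspec := hX.spectral_theorem
    rw [Unitary.conjStarAlgAut_apply] at hspec
    have hd : (Matrix.diagonal fun k => ((l - hX.eigenvalues k : ℝ) : ℂ)) =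
        (l : ℂ) • 1 - Matrix.diagonal (RCLike.ofReal ∘ hX.eigenvalues) := by
      ext a b
      by_cases hab : a = b
      · subst hab; simp
      · simp [hab]
    rw [hd, Matrix.mul_sub, Matrix.sub_mul, hYdef]
    congr 1
    rw [Matrix.mul_smul, Matrix.smul_mul, Matrix.mul_one]
    congr 1
    exact hU.symm
  have hYfix : ∑ i, (A i)ᴴ * Y * A i = Y := by
    simp only [hYdef, Matrix.mul_sub, Matrix.sub_mul, Finset.sum_sub_distrib, hfix,
      Matrix.mul_smul, Matrix.smul_mul, Matrix.mul_one, ← Finset.smul_sum, h1]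
  have hinv : ∀ i v, Y *ᵥ v = 0 → Y *ᵥ (A i *ᵥ v) = 0 := by
    intro i v hv
    have hsum : ∑ i, star (A i *ᵥ v) ⬝ᵥ (Y *ᵥ (A i *ᵥ v)) = 0 := by
      have h0 : star v ⬝ᵥ (Y *ᵥ v) = 0 := by rw [hv, dotProduct_zero]
      rw [← h0]
      conv_rhs => rw [← hYfix]
      rw [Matrix.sum_mulVec, dotProduct_sum]
      refine Finset.sum_congr rfl fun i _ => ?_
      rw [Matrix.star_mulVec, ← Matrix.dotProduct_mulVec, Matrix.mulVec_mulVec,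
        Matrix.mulVec_mulVec, Matrix.mul_assoc]
    have hz := (Finset.sum_eq_zero_iff_of_nonneg
      (fun i _ => hYpos.dotProduct_mulVec_nonneg (A i *ᵥ v))).1 hsum i (Finset.mem_univ i)
    exact (hYpos.dotProduct_mulVec_zero_iff _).1 hz
  have hv := hX.mulVec_eigenvectorBasis j
  have hne : (hX.eigenvectorBasis j : Fin D → ℂ) ≠ 0 := by
    intro h
    exact hX.eigenvectorBasis.orthonormal.ne_zero j (by ext a; exact congrFun h a)
  have hYv : Y *ᵥ (hX.eigenvectorBasis j : Fin D → ℂ) = 0 := by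
    rw [hYdef, Matrix.sub_mulVec, hv, Matrix.smul_mulVec, Matrix.one_mulVec, sub_eq_zero]
    ext a; simp [l]
  exact (sub_eq_zero.1 (hA.eq_zero_of_ker_invariant hinv hne hYv)).symm

/-- Uniqueness of the left fixed point of an injective left canonical MPS tensor. -/
theorem exists_smul_one_of_fixed (hA : IsInjective A) (h1 : ∑ i, (A i)ᴴ * A i = 1)
    (hD : 0 < D) {X : Matrix (Fin D) (Fin D) ℂ}
    (hfix : ∑ i, (A i)ᴴ * X * A i = X) : ∃ c : ℂ, X = c • 1 := by
  have hfix' : ∑ i, (A i)ᴴ * Xᴴ * A i = Xᴴ := by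
    conv_rhs => rw [← hfix]
    rw [Matrix.conjTranspose_sum]
    refine Finset.sum_congr rfl fun i _ => ?_
    simp [Matrix.mul_assoc]
  -- The fixed space is closed under adjoints, so the Hermitian matrices `X + Xᴴ` and `i (X - Xᴴ)`
  -- are fixed and `X` is recovered from them.
  obtain ⟨c, hc⟩ := exists_smul_one_of_isHermitian_of_fixed hA h1 hD (X := X + Xᴴ)
    (by simp [Matrix.IsHermitian, add_comm])
    (by simp [Matrix.mul_add, Matrix.add_mul, Finset.sum_add_distrib, hfix, hfix'])
  obtain ⟨d, hd⟩ := exists_smul_one_of_isHermitian_of_fixed hA h1 hD (X := Complex.I • (X - Xᴴ))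
    (by simp [Matrix.IsHermitian, sub_eq_add_neg, add_comm])
    (by simp only [Matrix.mul_sub, Matrix.sub_mul, Finset.sum_sub_distrib, hfix, hfix',
      Matrix.mul_smul, Matrix.smul_mul, ← Finset.smul_sum])
  refine ⟨2⁻¹ * (c - Complex.I * d), ?_⟩
  have hd' : X - Xᴴ = (-Complex.I * d) • 1 := by
    rw [mul_smul, ← hd, smul_smul]; simp
  have : X = (2⁻¹ : ℂ) • ((X + Xᴴ) + (X - Xᴴ)) := by
    rw [add_add_sub_cancel, ← two_smul ℂ X, smul_smul]; simp
  rw [this, hc, hd', ← add_smul, smul_smul]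
  congr 1; ring

end Perron

/-! ### Fixed points of mixed transfer matrices -/

section Transfer

variable {P : Type} [Fintype P] {D : ℕ} {A : P → Matrix (Fin D) (Fin D) ℂ}
variable {M N K K' : Type}

/-- A left vector of a mixed transfer matrix as a matrix from `A*`-bond to the other bonds. -/
def leftMat (s : (Fin D × M) × Fin D → ℂ) : Matrix (Fin D) (M × Fin D) ℂ :=
  Matrix.of fun a t => s ((a, t.1), t.2)

/-- A right vector of a mixed transfer matrix as a matrix to the `A*`-bond. -/
def rightMat (w : (Fin D × M) × Fin D → ℂ) : Matrix (M × Fin D) (Fin D) ℂ :=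
  Matrix.of fun t a => w ((a, t.1), t.2)

theorem leftMat_injective :
    Function.Injective (leftMat : ((Fin D × M) × Fin D → ℂ) → Matrix (Fin D) (M × Fin D) ℂ) :=
  fun _ _ h => funext fun p => congrFun (congrFun h p.1.1) (p.1.2, p.2)

theorem rightMat_injective :
    Function.Injective (rightMat : ((Fin D × M) × Fin D → ℂ) → Matrix (M × Fin D) (Fin D) ℂ) :=
  fun _ _ h => funext fun p => congrFun (congrFun h (p.1.2, p.2)) p.1.1

theorem IsLeftCanonical.sum_conjTranspose_mul (h : IsLeftCanonical A) :
    ∑ i, (A i)ᴴ * A i = 1 := by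
  ext a b
  have := congrFun h (a, b)
  rw [← this]
  simp only [Matrix.vecMul, dotProduct, transfer, Matrix.sum_apply, Finset.mul_sum,
    Matrix.mul_apply, Fintype.sum_prod_type, Matrix.kroneckerMap_apply, Matrix.map_apply,
    Matrix.one_apply, ite_mul, one_mul, zero_mul,
    Matrix.conjTranspose_apply]
  rw [Finset.sum_comm]
  simp

section

variable [Fintype M]

/-- Regrouping the legs isolates the factor `∑ j, O i j ⊗ₖ A j`, to which the symmetry relation
`IsAction.symm` applies. -/
theorem leftMat_vecMul_mixedTransfer (O : P → P → Matrix M M ℂ) (s : (Fin D × M) × Fin D → ℂ) :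
    leftMat (Matrix.vecMul s (mixedTransfer A O)) =
      ∑ i, (A i)ᴴ * leftMat s * ∑ j, O i j ⊗ₖ A j := by
  have hterm : ∀ i j, leftMat (Matrix.vecMul s (((A i).map star ⊗ₖ O i j) ⊗ₖ A j)) =
      (A i)ᴴ * leftMat s * (O i j ⊗ₖ A j) := by
    intro i j
    ext a ⟨m, b⟩
    simp only [leftMat, Matrix.of_apply, Matrix.vecMul, dotProduct, Matrix.mul_apply,
      Fintype.sum_prod_type, Matrix.kroneckerMap_apply, Matrix.map_apply,
      Matrix.conjTranspose_apply, Finset.sum_mul]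
    rw [Finset.sum_comm]
    refine Finset.sum_congr rfl fun m' _ => ?_
    rw [Finset.sum_comm]
    refine Finset.sum_congr rfl fun b' _ => Finset.sum_congr rfl fun a' _ => ?_
    ring
  simp only [Matrix.mul_sum, ← hterm]
  ext a t
  simp only [leftMat, mixedTransfer, Matrix.vecMul_sum, Matrix.of_apply, Matrix.sum_apply,
    Finset.sum_apply]

theorem rightMat_mulVec_mixedTransfer (O : P → P → Matrix M M ℂ)
    (w : (Fin D × M) × Fin D → ℂ) :
    rightMat (Matrix.mulVec (mixedTransfer A O) w) =
      ∑ i, (∑ j, O i j ⊗ₖ A j) * rightMat w * (A i)ᴴ := by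
  have hterm : ∀ i j, rightMat (Matrix.mulVec (((A i).map star ⊗ₖ O i j) ⊗ₖ A j) w) =
      (O i j ⊗ₖ A j) * rightMat w * (A i)ᴴ := by
    intro i j
    ext ⟨m, b⟩ a
    simp only [rightMat, Matrix.of_apply, Matrix.mulVec, dotProduct, Matrix.mul_apply,
      Fintype.sum_prod_type, Matrix.kroneckerMap_apply, Matrix.map_apply,
      Matrix.conjTranspose_apply, Finset.sum_mul]
    refine Finset.sum_congr rfl fun a' _ => Finset.sum_congr rfl fun m' _ =>
      Finset.sum_congr rfl fun b' _ => ?_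
    ring
  simp only [Matrix.sum_mul, ← hterm]
  ext t a
  simp only [rightMat, mixedTransfer, Matrix.sum_mulVec, Matrix.of_apply, Matrix.sum_apply,
    Finset.sum_apply]

theorem mem_leftFixed {O : P → P → Matrix M M ℂ} {s : (Fin D × M) × Fin D → ℂ} :
    s ∈ leftFixed A O ↔ Matrix.vecMul s (mixedTransfer A O) = s := by
  simp [leftFixed, LinearMap.mem_ker, sub_eq_zero]

theorem mem_rightFixed {O : P → P → Matrix M M ℂ} {w : (Fin D × M) × Fin D → ℂ} :
    w ∈ rightFixed A O ↔ Matrix.mulVec (mixedTransfer A O) w = w := by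
  simp [rightFixed, LinearMap.mem_ker, sub_eq_zero]

/-- A matrix and its transpose have the same rank, so `T - 1` has left and right kernels of equal
dimension. -/
theorem finrank_rightFixed_eq [DecidableEq M] (O : P → P → Matrix M M ℂ) :
    Module.finrank ℂ (rightFixed A O) = Module.finrank ℂ (leftFixed A O) := by
  have key : ∀ T : Matrix ((Fin D × M) × Fin D) ((Fin D × M) × Fin D) ℂ,
      Module.finrank ℂ (LinearMap.ker (T.mulVecLin - LinearMap.id)) =
        Fintype.card ((Fin D × M) × Fin D) - (T - 1).rank := by
    intro T
    have : T.mulVecLin - LinearMap.id = (T - 1).mulVecLin := by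
      ext v; simp
    rw [this, Matrix.rank]
    have := LinearMap.finrank_range_add_finrank_ker (T - 1).mulVecLin
    rw [Module.finrank_fintype_fun_eq_card] at this
    omega
  have h2 : leftFixed A O = LinearMap.ker ((mixedTransfer A O)ᵀ.mulVecLin - LinearMap.id) := by
    ext s
    rw [mem_leftFixed]
    simp [LinearMap.mem_ker, sub_eq_zero]
  rw [h2, rightFixed, key, key, ← Matrix.rank_transpose (mixedTransfer A O - 1),
    Matrix.transpose_sub, Matrix.transpose_one]

end

section Action

variable [Fintype M] [Fintype K] [DecidableEq K]
variable {O : P → P → Matrix M M ℂ}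
  {φ : Matrix (K × Fin D) (M × Fin D) ℂ} {φinv : Matrix (M × Fin D) (K × Fin D) ℂ}

/-- The blocks of a matrix between bonds and `A`-bonds. -/
theorem mul_one_kronecker_apply {N' : Type} (X : Matrix N' (K × Fin D) ℂ)
    (B : Matrix (Fin D) (Fin D) ℂ) (a : N') (k : K) (b : Fin D) :
    (X * ((1 : Matrix K K ℂ) ⊗ₖ B)) a (k, b) = ∑ c, X a (k, c) * B c b := by
  simp [Matrix.mul_apply, Fintype.sum_prod_type, Matrix.kroneckerMap_apply, Matrix.one_apply]

theorem one_kronecker_mul_apply {I I' J J' : Type} [Fintype I] [Fintype J] [DecidableEq J]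
    (X : Matrix I' I ℂ) (Y : Matrix (J × I) J' ℂ) (t : J) (p : I') (q : J') :
    (((1 : Matrix J J ℂ) ⊗ₖ X) * Y) (t, p) q = ∑ s, X p s * Y (t, s) q := by
  simp [Matrix.mul_apply, Fintype.sum_prod_type, Matrix.kroneckerMap_apply, Matrix.one_apply]

/-- Pulling `A i` through `φ` makes `φ * φinv` cancel; what remains in front of the row is `∑ i, (A
i)ᴴ * A i = 1`. -/
theorem leftVec_mem (h : IsAction A O φ φinv) (h1 : ∑ i, (A i)ᴴ * A i = 1) (k : K) :
    leftVec φ k ∈ leftFixed A O := by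
  rw [mem_leftFixed]
  apply leftMat_injective
  -- `E` is the inclusion of the block `k`, so `E * φ` is the block row `k` of `φ`; it intertwines
  -- `A i` with `1 ⊗ₖ A i`.
  let E : Matrix (Fin D) (K × Fin D) ℂ := Matrix.of fun a t => if t = (k, a) then 1 else 0
  have hE : leftMat (leftVec φ k) = E * φ := by
    ext a ⟨m, b⟩
    simp [leftMat, leftVec, Matrix.mul_apply, E]
  have hE' : ∀ B : Matrix (Fin D) (Fin D) ℂ, E * ((1 : Matrix K K ℂ) ⊗ₖ B) = B * E := by
    intro B
    ext a ⟨l, b⟩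
    rw [mul_one_kronecker_apply, Matrix.mul_apply]
    by_cases hl : l = k <;> simp [E, hl]
  rw [leftMat_vecMul_mixedTransfer, hE]
  calc ∑ i, (A i)ᴴ * (E * φ) * ∑ j, O i j ⊗ₖ A j
      = ∑ i, ((A i)ᴴ * A i) * (E * φ) := by
        refine Finset.sum_congr rfl fun i _ => ?_
        rw [h.symm i]
        simp only [Matrix.mul_assoc]
        rw [← Matrix.mul_assoc φ φinv, h.orth, Matrix.one_mul, ← Matrix.mul_assoc E, hE',
          Matrix.mul_assoc]
    _ = E * φ := by rw [← Matrix.sum_mul, h1, Matrix.one_mul]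

/-- The blocks of `W = leftMat s * φinv` are fixed by `X ↦ ∑ i, (A i)ᴴ * X * A i`, hence are
scalars. Because `φinv * φ` need not be the identity, `leftMat s = W * φ` does not follow from the
definition of `W`; it is the fixed-point equation of `s` that supplies it. -/
theorem exists_eq_sum_leftVec (h : IsAction A O φ φinv) (hA : IsInjective A)
    (h1 : ∑ i, (A i)ᴴ * A i = 1) (hD : 0 < D) {s : (Fin D × M) × Fin D → ℂ}
    (hs : s ∈ leftFixed A O) : ∃ c : K → ℂ, s = ∑ k, c k • leftVec φ k := by
  rw [mem_leftFixed] at hs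
  set W := leftMat s * φinv with hW
  have hsW : leftMat s = (∑ i, (A i)ᴴ * W * ((1 : Matrix K K ℂ) ⊗ₖ A i)) * φ := by
    conv_lhs => rw [← hs]
    rw [leftMat_vecMul_mixedTransfer, Matrix.sum_mul]
    refine Finset.sum_congr rfl fun i _ => ?_
    rw [h.symm i, hW]
    simp only [Matrix.mul_assoc]
  have hWfix : W = ∑ i, (A i)ᴴ * W * ((1 : Matrix K K ℂ) ⊗ₖ A i) := by
    conv_lhs => rw [hW, hsW, Matrix.mul_assoc, h.orth, Matrix.mul_one]
  have hblock : ∀ k, ∃ c : ℂ,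
      (Matrix.of fun a b => W a (k, b)) = c • (1 : Matrix (Fin D) (Fin D) ℂ) := by
    intro k
    refine exists_smul_one_of_fixed hA h1 hD ?_
    ext a b
    conv_rhs => rw [Matrix.of_apply, hWfix]
    rw [Matrix.sum_apply, Matrix.sum_apply]
    refine Finset.sum_congr rfl fun i _ => ?_
    rw [mul_one_kronecker_apply, Matrix.mul_apply]
    simp [Matrix.mul_apply]
  choose c hc using hblock
  refine ⟨c, leftMat_injective ?_⟩
  rw [hsW, ← hWfix]
  ext a ⟨m, b⟩
  have hc' : ∀ k a b, W a (k, b) = c k * (1 : Matrix (Fin D) (Fin D) ℂ) a b := fun k a b => by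
    have := congrFun (congrFun (hc k) a) b
    simpa using this
  rw [Matrix.mul_apply, Fintype.sum_prod_type]
  simp [hc', leftMat, leftVec, Finset.sum_apply, Matrix.one_apply]

/-- Mirror image of `leftVec_mem`: after `φ * φinv` cancels, the fixed-point equation of `Λ` takes
the place of left canonicity. -/
theorem rightVec_mem (h : IsAction A O φ φinv) {Λ : Fin D × Fin D → ℂ}
    (hΛ : IsNormalizedRightFixed A Λ) (k : K) : rightVec φinv Λ k ∈ rightFixed A O := by
  rw [mem_rightFixed]
  apply rightMat_injective
  let L : Matrix (Fin D) (Fin D) ℂ := Matrix.of fun b a => Λ (a, b)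
  let E : Matrix (K × Fin D) (Fin D) ℂ := Matrix.of fun t a => if t = (k, a) then 1 else 0
  have hL : ∑ i, A i * L * (A i)ᴴ = L := by
    ext b a
    conv_rhs => simp only [L, Matrix.of_apply]; rw [← hΛ.1]
    rw [transfer, Matrix.sum_mulVec, Finset.sum_apply, Matrix.sum_apply]
    refine Finset.sum_congr rfl fun i _ => ?_
    simp only [Matrix.mulVec, dotProduct, Matrix.mul_apply, Fintype.sum_prod_type,
      Matrix.kroneckerMap_apply, Matrix.map_apply, Matrix.conjTranspose_apply, L, Matrix.of_apply,
      Finset.sum_mul]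
    refine Finset.sum_congr rfl fun a' _ => Finset.sum_congr rfl fun b' _ => ?_
    ring
  have hE : rightMat (rightVec φinv Λ k) = φinv * (E * L) := by
    ext ⟨m, b⟩ a
    rw [← Matrix.mul_assoc]
    simp [rightMat, rightVec, Matrix.mul_apply, E, L]
  have hE' : ∀ B : Matrix (Fin D) (Fin D) ℂ, ((1 : Matrix K K ℂ) ⊗ₖ B) * E = E * B := by
    intro B
    ext ⟨l, b⟩ a
    rw [one_kronecker_mul_apply, Matrix.mul_apply]
    by_cases hl : l = k <;> simp [E, hl]
  rw [rightMat_mulVec_mixedTransfer, hE]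
  calc ∑ i, (∑ j, O i j ⊗ₖ A j) * (φinv * (E * L)) * (A i)ᴴ
      = ∑ i, φinv * (E * (A i * L * (A i)ᴴ)) := by
        refine Finset.sum_congr rfl fun i _ => ?_
        rw [h.symm i]
        simp only [Matrix.mul_assoc]
        rw [← Matrix.mul_assoc φ φinv, h.orth, Matrix.one_mul, ← Matrix.mul_assoc _ E, hE']
        simp only [Matrix.mul_assoc]
    _ = φinv * (E * L) := by rw [← Matrix.mul_sum, ← Matrix.mul_sum, hL]

theorem leftVec_dotProduct_rightVec {M K K' : Type} [Fintype M]
    (Y : Matrix (M × Fin D) (K × Fin D) ℂ)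
    (X : Matrix (K' × Fin D) (M × Fin D) ℂ) (Λ : Fin D × Fin D → ℂ) (k : K') (l : K) :
    leftVec X k ⬝ᵥ rightVec Y Λ l = ∑ a, ∑ b, (X * Y) (k, a) (l, b) * Λ (a, b) := by
  simp only [dotProduct, leftVec, rightVec, Fintype.sum_prod_type, Matrix.mul_apply,
    Finset.sum_mul, Finset.mul_sum]
  refine Finset.sum_congr rfl fun a _ => ?_
  symm
  rw [Finset.sum_comm]
  refine Finset.sum_congr rfl fun m _ => ?_
  rw [Finset.sum_comm]
  refine Finset.sum_congr rfl fun c _ => Finset.sum_congr rfl fun b _ => ?_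
  ring

/-- The tool that evaluates all closed diagrams below: once a contraction has the form `Ω ⊗ 1`, the
MPS loop contributes only `tr Λ = 1`. -/
theorem leftVec_dotProduct_rightVec_of_eq {M K : Type} [Fintype M]
    {Λ : Fin D × Fin D → ℂ} (hΛ : ∑ a, Λ (a, a) = 1)
    (Y : Matrix (M × Fin D) (K × Fin D) ℂ) {K' : Type}
    (X : Matrix (K' × Fin D) (M × Fin D) ℂ) {Ω : Matrix K' K ℂ} (h : X * Y = onBond D Ω)
    (k : K') (l : K) : leftVec X k ⬝ᵥ rightVec Y Λ l = Ω k l := by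
  rw [leftVec_dotProduct_rightVec, h]
  simp [onBond, Matrix.kroneckerMap_apply, Matrix.one_apply, ← Finset.mul_sum, hΛ]

end Action

end Transfer

/-! ### Dual bases of fixed points and comparison of action tensors -/

section FixedPoints

variable {P : Type} [Fintype P] {D : ℕ} {A : P → Matrix (Fin D) (Fin D) ℂ}
variable {M N K K' : Type} [Fintype M] [Fintype K] [DecidableEq K] [Fintype K'] [DecidableEq K']
variable {O : P → P → Matrix M M ℂ}
  {φ : Matrix (K × Fin D) (M × Fin D) ℂ} {φinv : Matrix (M × Fin D) (K × Fin D) ℂ}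
  {ψ : Matrix (K' × Fin D) (M × Fin D) ℂ} {ψinv : Matrix (M × Fin D) (K' × Fin D) ℂ}
  {Λ : Fin D × Fin D → ℂ}

/-- For `D = 0` the trace is an empty sum and cannot be `1`. -/
theorem IsNormalizedRightFixed.pos (hΛ : IsNormalizedRightFixed A Λ) : 0 < D := by
  rcases Nat.eq_zero_or_pos D with rfl | h
  · simpa using hΛ.2
  · exact h

theorem onBond_mul {K₁ K₂ K₃ : Type} [Fintype K₂] (X : Matrix K₁ K₂ ℂ) (Y : Matrix K₂ K₃ ℂ) :
    onBond D (X * Y) = onBond D X * onBond D Y := by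
  rw [onBond, onBond, onBond, ← Matrix.mul_kronecker_mul, Matrix.one_mul]

theorem onBond_one {K : Type} [DecidableEq K] : onBond D (1 : Matrix K K ℂ) = 1 := by
  rw [onBond, Matrix.one_kronecker_one]

theorem onBond_zero {K₁ K₂ : Type} : onBond D (0 : Matrix K₁ K₂ ℂ) = 0 := by
  rw [onBond, Matrix.zero_kronecker]

theorem onBond_sum {K₁ K₂ T : Type} (s : Finset T) (X : T → Matrix K₁ K₂ ℂ) :
    onBond D (∑ t ∈ s, X t) = ∑ t ∈ s, onBond D (X t) := by
  ext a b
  simp [onBond, Matrix.sum_apply, Matrix.kroneckerMap_apply, Finset.sum_mul]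

theorem onBond_smul {K₁ K₂ : Type} (c : ℂ) (X : Matrix K₁ K₂ ℂ) :
    onBond D (c • X) = c • onBond D X := by
  rw [onBond, onBond, Matrix.smul_kronecker]

theorem onBond_injective {K₁ K₂ : Type} (hD : 0 < D) :
    Function.Injective (onBond D : Matrix K₁ K₂ ℂ → Matrix (K₁ × Fin D) (K₂ × Fin D) ℂ) := by
  intro X Y h
  ext a b
  have := congrFun (congrFun h (a, ⟨0, hD⟩)) (b, ⟨0, hD⟩)
  simpa [onBond, Matrix.kroneckerMap_apply] using this

theorem onBond_mul_apply {K₁ K₂ N' : Type} [Fintype K₂] (X : Matrix K₁ K₂ ℂ)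
    (Y : Matrix (K₂ × Fin D) N' ℂ) (k : K₁) (a : Fin D) (s : N') :
    (onBond D X * Y) (k, a) s = ∑ l, X k l * Y (l, a) s := by
  simp [onBond, Matrix.mul_apply, Fintype.sum_prod_type, Matrix.kroneckerMap_apply,
    Matrix.one_apply]

theorem mul_onBond_apply {K₁ K₂ N' : Type} [Fintype K₂] (X : Matrix K₂ K₁ ℂ)
    (Y : Matrix N' (K₂ × Fin D) ℂ) (k : K₁) (a : Fin D) (s : N') :
    (Y * onBond D X) s (k, a) = ∑ l, Y s (l, a) * X l k := by
  simp [onBond, Matrix.mul_apply, Fintype.sum_prod_type, Matrix.kroneckerMap_apply,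
    Matrix.one_apply]

theorem leftVec_onBond_mul {K₁ K M : Type} [Fintype K] {φ : Matrix (K × Fin D) (M × Fin D) ℂ}
    (X : Matrix K₁ K ℂ) (k : K₁) :
    leftVec (onBond D X * φ) k = ∑ l, X k l • leftVec φ l := by
  ext s
  simp [leftVec, onBond_mul_apply, Finset.sum_apply]

/-- An action tensor has a right inverse and can be cancelled on the right. This is the source of
all uniqueness statements and of the cocycle condition. -/
theorem IsAction.eq_of_onBond_mul_eq (h : IsAction A O φ φinv) (hD : 0 < D) {K₁ : Type}
    {X Y : Matrix K₁ K ℂ} (hXY : onBond D X * φ = onBond D Y * φ) : X = Y := by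
  apply onBond_injective hD
  rw [← Matrix.mul_one (onBond D X), ← Matrix.mul_one (onBond D Y), ← h.orth,
    ← Matrix.mul_assoc, ← Matrix.mul_assoc, hXY]

theorem IsAction.leftVec_dotProduct_rightVec (h : IsAction A O φ φinv)
    (hΛ : IsNormalizedRightFixed A Λ) (k l : K) :
    leftVec φ k ⬝ᵥ rightVec φinv Λ l = if k = l then 1 else 0 := by
  rw [leftVec_dotProduct_rightVec_of_eq hΛ.2 φinv φ (Ω := 1) (by rw [h.orth, onBond_one]),
    Matrix.one_apply]

theorem linearIndependent_of_dotProduct {I J : Type} [Fintype J] [Fintype I] [DecidableEq I]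
    {f g : I → J → ℂ}
    (h : ∀ k l, f k ⬝ᵥ g l = if k = l then 1 else 0) : LinearIndependent ℂ f := by
  rw [Fintype.linearIndependent_iff]
  intro c hc k
  have := congrArg (· ⬝ᵥ g k) hc
  simpa [sum_dotProduct, h] using this

/-- The left fixed points given by the rows of an action tensor form a basis. -/
theorem IsAction.exists_leftBasis (h : IsAction A O φ φinv) (hA : IsInjective A)
    (hcan : IsLeftCanonical A) (hΛ : IsNormalizedRightFixed A Λ) :
    ∃ b : Module.Basis K ℂ (leftFixed A O), ∀ k, (b k).1 = leftVec φ k := by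
  have h1 := hcan.sum_conjTranspose_mul
  let f : K → leftFixed A O := fun k => ⟨leftVec φ k, leftVec_mem h h1 k⟩
  have hf : LinearIndependent ℂ f := by
    apply LinearIndependent.of_comp (leftFixed A O).subtype
    exact linearIndependent_of_dotProduct (g := rightVec φinv Λ)
      (h.leftVec_dotProduct_rightVec hΛ)
  refine ⟨Module.Basis.mk hf ?_, fun k => by rw [Module.Basis.mk_apply]⟩
  rintro ⟨s, hs⟩ -
  obtain ⟨c, hc⟩ := exists_eq_sum_leftVec h hA h1 hΛ.pos hs
  have : (⟨s, hs⟩ : leftFixed A O) = ∑ k, c k • f k := by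
    apply Subtype.ext
    simp [f, hc]
  rw [this]
  exact Submodule.sum_mem _ fun k _ => Submodule.smul_mem _ _ (Submodule.subset_span ⟨k, rfl⟩)

theorem IsAction.finrank_leftFixed (h : IsAction A O φ φinv) (hA : IsInjective A)
    (hcan : IsLeftCanonical A) (hΛ : IsNormalizedRightFixed A Λ) :
    Module.finrank ℂ (leftFixed A O) = Fintype.card K := by
  obtain ⟨b, -⟩ := h.exists_leftBasis hA hcan hΛ
  exact Module.finrank_eq_card_basis b

/-- The rows of an action tensor and the columns of its right inverse give dual bases of the spaces
of left and right fixed points. -/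
theorem IsAction.exists_dual_bases [DecidableEq M] (h : IsAction A O φ φinv) (hA : IsInjective A)
    (hcan : IsLeftCanonical A) (hΛ : IsNormalizedRightFixed A Λ) :
    ∃ (bL : Module.Basis K ℂ (leftFixed A O)) (bR : Module.Basis K ℂ (rightFixed A O)),
      (∀ i, (bL i).1 = leftVec φ i) ∧ (∀ i, (bR i).1 = rightVec φinv Λ i) ∧
      ∀ i j, (bL i).1 ⬝ᵥ (bR j).1 = if i = j then 1 else 0 := by
  obtain ⟨bL, hbL⟩ := h.exists_leftBasis hA hcan hΛ
  let g : K → rightFixed A O := fun k => ⟨rightVec φinv Λ k, rightVec_mem h hΛ k⟩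
  have hg : LinearIndependent ℂ g := by
    apply LinearIndependent.of_comp (rightFixed A O).subtype
    refine linearIndependent_of_dotProduct (g := leftVec φ) fun k l => ?_
    rw [dotProduct_comm]
    simp only [Function.comp, g, Submodule.subtype_apply, h.leftVec_dotProduct_rightVec hΛ,
      eq_comm]
  -- Spanning on the right is obtained by counting: the two fixed-point spaces have equal dimension,
  -- so linear independence suffices.
  have hcard : Fintype.card K = Module.finrank ℂ (rightFixed A O) := by
    rw [finrank_rightFixed_eq, h.finrank_leftFixed hA hcan hΛ]
  have hspan := hg.span_eq_top_of_card_eq_finrank' hcard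
  have hbR : ∀ i, ((Module.Basis.mk hg hspan.ge) i).1 = rightVec φinv Λ i := fun i => by
    rw [Module.Basis.mk_apply]
  refine ⟨bL, Module.Basis.mk hg hspan.ge, hbL, hbR, fun i j => ?_⟩
  rw [hbL, hbR, h.leftVec_dotProduct_rightVec hΛ]

/-- Two action tensors of the same MPO tensor differ by a matrix on the auxiliary spaces. -/
theorem IsAction.exists_eq_onBond_mul (h : IsAction A O φ φinv) (h' : IsAction A O ψ ψinv)
    (hA : IsInjective A) (hcan : IsLeftCanonical A) (hΛ : IsNormalizedRightFixed A Λ) :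
    ∃ Ω : Matrix K K' ℂ, φ = onBond D Ω * ψ := by
  have h1 := hcan.sum_conjTranspose_mul
  -- Each row of `φ` is a left fixed point and therefore expands in the rows of `ψ`; the
  -- coefficients form `Ω`.
  have := fun k => exists_eq_sum_leftVec h' hA h1 hΛ.pos (leftVec_mem h h1 k)
  choose Ω hΩ using this
  refine ⟨Matrix.of Ω, ?_⟩
  ext ⟨k, a⟩ ⟨m, b⟩
  have := congrFun (hΩ k) ((a, m), b)
  rw [onBond_mul_apply]
  simpa [leftVec, Finset.sum_apply] using this

/-- Exchange the two action tensors to get `Ω'`, then cancel `φ` and `ψ`. The index types may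
differ, so invertibility is given by two equations. -/
theorem IsAction.exists_inverse (h : IsAction A O φ φinv) (h' : IsAction A O ψ ψinv)
    (hA : IsInjective A) (hcan : IsLeftCanonical A) (hΛ : IsNormalizedRightFixed A Λ)
    {Ω : Matrix K K' ℂ} (hΩ : φ = onBond D Ω * ψ) :
    ∃ Ω' : Matrix K' K ℂ, Ω * Ω' = 1 ∧ Ω' * Ω = 1 := by
  obtain ⟨Ω', hΩ'⟩ := h'.exists_eq_onBond_mul h hA hcan hΛ
  refine ⟨Ω', h.eq_of_onBond_mul_eq hΛ.pos ?_, h'.eq_of_onBond_mul_eq hΛ.pos ?_⟩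
  · rw [onBond_mul, Matrix.mul_assoc, ← hΩ', ← hΩ, onBond_one, Matrix.one_mul]
  · rw [onBond_mul, Matrix.mul_assoc, ← hΩ, ← hΩ', onBond_one, Matrix.one_mul]

theorem IsAction.isUnit (h : IsAction A O φ φinv) {φ' : Matrix (K × Fin D) (M × Fin D) ℂ}
    {φinv' : Matrix (M × Fin D) (K × Fin D) ℂ} (h' : IsAction A O φ' φinv')
    (hA : IsInjective A) (hcan : IsLeftCanonical A) (hΛ : IsNormalizedRightFixed A Λ)
    {Ω : Matrix K K ℂ} (hΩ : φ = onBond D Ω * φ') : IsUnit Ω := by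
  obtain ⟨Ω', h1, h2⟩ := h.exists_inverse h' hA hcan hΛ hΩ
  exact ⟨⟨Ω, Ω', h1, h2⟩, rfl⟩

theorem IsAction.card_eq (h : IsAction A O φ φinv) (h' : IsAction A O ψ ψinv)
    (hA : IsInjective A) (hcan : IsLeftCanonical A) (hΛ : IsNormalizedRightFixed A Λ) :
    Fintype.card K = Fintype.card K' := by
  rw [← h.finrank_leftFixed hA hcan hΛ, h'.finrank_leftFixed hA hcan hΛ]

end FixedPoints

/-! ### Products and direct sums of action tensors -/

section Products

variable {P : Type} [Fintype P] {D : ℕ} {A : P → Matrix (Fin D) (Fin D) ℂ}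
variable {K K' L L' M M' N N' Q : Type}

/-- Exchange of the last two bonds. -/
def swapLast (M N Q : Type) : (M × N) × Q ≃ (M × Q) × N where
  toFun s := ((s.1.1, s.2), s.1.2)
  invFun s := ((s.1.1, s.2), s.1.2)

/-- A matrix on a bond and the MPS bond, tensored from the left with a matrix on another bond. -/
def onLeft (Y : Matrix Q L ℂ) (X : Matrix (M × Fin D) (N × Fin D) ℂ) :
    Matrix ((Q × M) × Fin D) ((L × N) × Fin D) ℂ :=
  (Y ⊗ₖ X).submatrix (Equiv.prodAssoc _ _ _) (Equiv.prodAssoc _ _ _)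

/-- A matrix on a bond and the MPS bond, tensored with a matrix on a bond between them. -/
def onRight (X : Matrix (M × Fin D) (N × Fin D) ℂ) (Y : Matrix Q L ℂ) :
    Matrix ((M × Q) × Fin D) ((N × L) × Fin D) ℂ :=
  (X ⊗ₖ Y).submatrix (swapLast _ _ _) (swapLast _ _ _)

theorem onLeft_mul [Fintype N] [Fintype L] (Y : Matrix Q L ℂ) (Y' : Matrix L K ℂ)
    (X : Matrix (M × Fin D) (N × Fin D) ℂ) (X' : Matrix (N × Fin D) (N' × Fin D) ℂ) :
    onLeft (Y * Y') (X * X') = onLeft Y X * onLeft Y' X' := by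
  rw [onLeft, onLeft, onLeft, Matrix.submatrix_mul_equiv, Matrix.mul_kronecker_mul]

theorem onRight_mul [Fintype N] [Fintype L] (Y : Matrix Q L ℂ) (Y' : Matrix L K ℂ)
    (X : Matrix (M × Fin D) (N × Fin D) ℂ) (X' : Matrix (N × Fin D) (N' × Fin D) ℂ) :
    onRight (X * X') (Y * Y') = onRight X Y * onRight X' Y' := by
  rw [onRight, onRight, onRight, Matrix.submatrix_mul_equiv, Matrix.mul_kronecker_mul]

theorem onLeft_one [DecidableEq Q] [DecidableEq M] :
    onLeft (D := D) (1 : Matrix Q Q ℂ) (1 : Matrix (M × Fin D) (M × Fin D) ℂ) = 1 := by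
  rw [onLeft, Matrix.one_kronecker_one, Matrix.submatrix_one_equiv]

theorem onRight_one [DecidableEq Q] [DecidableEq M] :
    onRight (D := D) (1 : Matrix (M × Fin D) (M × Fin D) ℂ) (1 : Matrix Q Q ℂ) = 1 := by
  rw [onRight, Matrix.one_kronecker_one, Matrix.submatrix_one_equiv]

theorem onLeft_kronecker (Y : Matrix Q L ℂ) (X : Matrix M N ℂ) (B : Matrix (Fin D) (Fin D) ℂ) :
    onLeft Y (X ⊗ₖ B) = (Y ⊗ₖ X) ⊗ₖ B := by
  ext a b
  simp [onLeft, Matrix.kroneckerMap_apply, mul_assoc]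

theorem onRight_kronecker (Y : Matrix Q L ℂ) (X : Matrix M N ℂ) (B : Matrix (Fin D) (Fin D) ℂ) :
    onRight (X ⊗ₖ B) Y = (X ⊗ₖ Y) ⊗ₖ B := by
  ext a b
  simp [onRight, swapLast, Matrix.kroneckerMap_apply, mul_right_comm]

theorem onLeft_sum {T : Type} (s : Finset T) (Y : Matrix Q L ℂ)
    (X : T → Matrix (M × Fin D) (N × Fin D) ℂ) :
    onLeft Y (∑ t ∈ s, X t) = ∑ t ∈ s, onLeft Y (X t) := by
  ext a b
  simp [onLeft, Matrix.sum_apply, Matrix.kroneckerMap_apply, Finset.mul_sum]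

theorem onRight_sum {T : Type} (s : Finset T) (Y : Matrix Q L ℂ)
    (X : T → Matrix (M × Fin D) (N × Fin D) ℂ) :
    onRight (∑ t ∈ s, X t) Y = ∑ t ∈ s, onRight (X t) Y := by
  ext a b
  simp [onRight, Matrix.sum_apply, Matrix.kroneckerMap_apply, Finset.sum_mul]

/-- Writing the contraction as a matrix product lets the mixed-product rule for Kronecker products
replace computations with indices. -/
theorem mulAction_eq [DecidableEq M] [DecidableEq K'] [Fintype M] [Fintype K']
    (φ : Matrix (K × Fin D) (M × Fin D) ℂ) (ψ : Matrix (K' × Fin D) (N × Fin D) ℂ) :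
    mulAction φ ψ = onRight φ (1 : Matrix K' K' ℂ) * onLeft (1 : Matrix M M ℂ) ψ := by
  ext ⟨⟨k, k'⟩, a⟩ ⟨⟨m, n⟩, b⟩
  simp [mulAction, onRight, onLeft, swapLast, Matrix.mul_apply, Fintype.sum_prod_type,
    Matrix.kroneckerMap_apply, Matrix.one_apply]

theorem mulAction_onBond_mul [Fintype K] [Fintype K'] [DecidableEq K']
    (X : Matrix L K ℂ) (φ : Matrix (K × Fin D) (M × Fin D) ℂ)
    (ψ : Matrix (K' × Fin D) (N × Fin D) ℂ) :
    mulAction (onBond D X * φ) ψ = onBond D (X ⊗ₖ (1 : Matrix K' K' ℂ)) * mulAction φ ψ := by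
  ext ⟨⟨k, k'⟩, a⟩ ⟨⟨m, n⟩, b⟩
  simp only [onBond_mul_apply, mulAction, Fintype.sum_prod_type, Matrix.kroneckerMap_apply,
    Matrix.one_apply, mul_ite, mul_one, mul_zero, ite_mul, zero_mul, Finset.sum_ite_eq,
    Finset.mem_univ, if_true]
  simp only [Finset.sum_mul, Finset.mul_sum]
  rw [Finset.sum_comm]
  simp only [mul_assoc]

theorem mulAction_onBond_mul_right [Fintype K] [Fintype K'] [DecidableEq K]
    (X : Matrix L K' ℂ) (φ : Matrix (K × Fin D) (M × Fin D) ℂ)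
    (ψ : Matrix (K' × Fin D) (N × Fin D) ℂ) :
    mulAction φ (onBond D X * ψ) = onBond D ((1 : Matrix K K ℂ) ⊗ₖ X) * mulAction φ ψ := by
  ext ⟨⟨k, k'⟩, a⟩ ⟨⟨m, n⟩, b⟩
  simp only [onBond_mul_apply, mulAction, Fintype.sum_prod_type_right, Matrix.kroneckerMap_apply,
    Matrix.one_apply, ite_mul, one_mul, zero_mul, Finset.sum_ite_eq,
    Finset.mem_univ, if_true]
  simp only [Finset.mul_sum]
  rw [Finset.sum_comm]
  simp only [mul_left_comm]

theorem mulAction_mul_onBond [Fintype M] [Fintype N] [DecidableEq N]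
    (X : Matrix M L ℂ) (φ : Matrix (K × Fin D) (M × Fin D) ℂ)
    (ψ : Matrix (K' × Fin D) (N × Fin D) ℂ) :
    mulAction (φ * onBond D X) ψ = mulAction φ ψ * onBond D (X ⊗ₖ (1 : Matrix N N ℂ)) := by
  ext ⟨⟨k, k'⟩, a⟩ ⟨⟨m, n⟩, b⟩
  simp only [mul_onBond_apply, mulAction, Fintype.sum_prod_type, Matrix.kroneckerMap_apply,
    Matrix.one_apply, mul_ite, mul_one, mul_zero, Finset.sum_ite_eq',
    Finset.mem_univ, if_true, Finset.sum_mul]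
  rw [Finset.sum_comm]
  simp only [mul_right_comm]

theorem mulAction_mul_onBond_right [Fintype M] [Fintype N] [DecidableEq M]
    (X : Matrix N L ℂ) (φ : Matrix (K × Fin D) (M × Fin D) ℂ)
    (ψ : Matrix (K' × Fin D) (N × Fin D) ℂ) :
    mulAction φ (ψ * onBond D X) = mulAction φ ψ * onBond D ((1 : Matrix M M ℂ) ⊗ₖ X) := by
  ext ⟨⟨k, k'⟩, a⟩ ⟨⟨m, n⟩, b⟩
  simp only [mul_onBond_apply, mulAction, Fintype.sum_prod_type_right, Matrix.kroneckerMap_apply,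
    Matrix.one_apply, ite_mul, mul_ite, one_mul, zero_mul, mul_zero, Finset.sum_ite_eq',
    Finset.mem_univ, if_true, Finset.mul_sum, Finset.sum_mul]
  rw [Finset.sum_comm]
  simp only [mul_assoc]

theorem mulAction_assoc (φ : Matrix (K × Fin D) (M × Fin D) ℂ)
    (ψ : Matrix (K' × Fin D) (N × Fin D) ℂ) (ω : Matrix (L × Fin D) (Q × Fin D) ℂ) :
    mulAction (mulAction φ ψ) ω = (mulAction φ (mulAction ψ ω)).submatrix
      (Prod.map (Equiv.prodAssoc _ _ _) id) (Prod.map (Equiv.prodAssoc _ _ _) id) := by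
  ext a b
  simp only [mulAction, Matrix.submatrix_apply, Prod.map, Equiv.prodAssoc_apply, id,
    Finset.sum_mul, Finset.mul_sum]
  rw [Finset.sum_comm]
  simp only [mul_assoc]

variable [Fintype M] [Fintype K] [DecidableEq K] [Fintype K'] [DecidableEq K']
  [Fintype N] [DecidableEq M]

/-- The right inverse of the product of two action tensors. -/
def mulActionInv (φinv : Matrix (M × Fin D) (K × Fin D) ℂ)
    (ψinv : Matrix (N × Fin D) (K' × Fin D) ℂ) :
    Matrix ((M × N) × Fin D) ((K × K') × Fin D) ℂ :=
  onLeft (1 : Matrix M M ℂ) ψinv * onRight φinv (1 : Matrix K' K' ℂ)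

variable {O : P → P → Matrix M M ℂ} {O' : P → P → Matrix N N ℂ}
  {φ : Matrix (K × Fin D) (M × Fin D) ℂ} {φinv : Matrix (M × Fin D) (K × Fin D) ℂ}
  {ψ : Matrix (K' × Fin D) (N × Fin D) ℂ} {ψinv : Matrix (N × Fin D) (K' × Fin D) ℂ}

/-- The product of action tensors is an action tensor of the product of the MPO tensors. -/
theorem IsAction.mulAction (h : IsAction A O φ φinv) (h' : IsAction A O' ψ ψinv) :
    IsAction A (mulMPO O O') (mulAction φ ψ) (mulActionInv φinv ψinv) where
  orth := by
    rw [mulAction_eq, mulActionInv, Matrix.mul_assoc, ← Matrix.mul_assoc (onLeft _ ψ),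
      ← onLeft_mul, h'.orth, Matrix.mul_one, onLeft_one, Matrix.one_mul, ← onRight_mul, h.orth,
      Matrix.mul_one, onRight_one]
  symm i := by
    -- Summing over the last physical index first applies the relation of `O'`. This leaves `O i j
    -- ⊗ₖ A j` between `ψinv` and `ψ`, ready for the relation of `O`.
    have h1 : ∀ j, ∑ k, (O i j ⊗ₖ O' j k) ⊗ₖ A k =
        onLeft (1 : Matrix M M ℂ) ψinv * onRight (O i j ⊗ₖ A j) (1 : Matrix K' K' ℂ) *
          onLeft (1 : Matrix M M ℂ) ψ := by
      intro j
      simp only [← onLeft_kronecker, ← onLeft_sum, onRight_kronecker]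
      rw [h'.symm j]
      simp only [← onLeft_mul, Matrix.one_mul, Matrix.mul_one]
    have h2 : ∑ k, mulMPO O O' i k ⊗ₖ A k = ∑ j, ∑ k, (O i j ⊗ₖ O' j k) ⊗ₖ A k := by
      rw [Finset.sum_comm]
      refine Finset.sum_congr rfl fun k _ => ?_
      ext a b
      simp [mulMPO, Matrix.sum_apply, Matrix.kroneckerMap_apply, Finset.sum_mul]
    rw [h2]
    simp only [h1, ← Matrix.sum_mul, ← Matrix.mul_sum, ← onRight_sum]
    have h3 : onRight (φinv * ((1 : Matrix K K ℂ) ⊗ₖ A i) * φ) (1 : Matrix K' K' ℂ) =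
        onRight φinv (1 : Matrix K' K' ℂ) * ((1 : Matrix (K × K') (K × K') ℂ) ⊗ₖ A i) *
          onRight φ (1 : Matrix K' K' ℂ) := by
      rw [← Matrix.one_kronecker_one (α := ℂ) (m := K) (n := K'), ← onRight_kronecker,
        ← onRight_mul, ← onRight_mul, Matrix.mul_one, Matrix.mul_one]
    rw [h.symm i, h3, mulAction_eq, mulActionInv]
    simp only [Matrix.mul_assoc]

theorem onBond_mul_kronecker {K₁ K₂ : Type} [Fintype K₁] [DecidableEq K₁] [Fintype K₂]
    [DecidableEq K₂] (X : Matrix K₁ K₂ ℂ) (B : Matrix (Fin D) (Fin D) ℂ) :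
    onBond D X * ((1 : Matrix K₂ K₂ ℂ) ⊗ₖ B) = ((1 : Matrix K₁ K₁ ℂ) ⊗ₖ B) * onBond D X := by
  rw [onBond, ← Matrix.mul_kronecker_mul, ← Matrix.mul_kronecker_mul]
  simp

/-- Action tensors of the summands of a decomposed MPO tensor assemble to an action tensor. -/
theorem IsAction.of_decomposition {K M : Type} [Fintype K] [DecidableEq K] [Fintype M]
    {T : Type} [Fintype T] [DecidableEq T] {m κ : T → Type}
    [∀ t, Fintype (m t)] [∀ t, DecidableEq (m t)] [∀ t, Fintype (κ t)] [∀ t, DecidableEq (κ t)]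
    {O : P → P → Matrix M M ℂ}
    {Ot : ∀ t, P → P → Matrix (m t) (m t) ℂ}
    {φ : ∀ t, Matrix (κ t × Fin D) (m t × Fin D) ℂ}
    {φinv : ∀ t, Matrix (m t × Fin D) (κ t × Fin D) ℂ} (h : ∀ t, IsAction A (Ot t) (φ t) (φinv t))
    {f : ∀ t, Matrix M (m t) ℂ} {s : ∀ t, Matrix (m t) M ℂ}
    (hsf : ∀ t, s t * f t = 1) (hsf' : ∀ t t', t ≠ t' → s t * f t' = 0)
    (hO : ∀ i k, O i k = ∑ t, f t * Ot t i k * s t)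
    {g : ∀ t, Matrix K (κ t) ℂ} {r : ∀ t, Matrix (κ t) K ℂ}
    (hrg : ∀ t, r t * g t = 1) (hrg' : ∀ t t', t ≠ t' → r t * g t' = 0)
    (hgr : ∑ t, g t * r t = 1) :
    IsAction A O (∑ t, onBond D (g t) * φ t * onBond D (s t))
      (∑ t, onBond D (f t) * φinv t * onBond D (r t)) where
  orth := by
    -- The identity on `K` is resolved by `hgr` into its channels; cross terms of the product vanish
    -- because `s t * f t' = 0`.
    rw [Matrix.sum_mul, ← onBond_one, ← hgr, onBond_sum]
    refine Finset.sum_congr rfl fun t _ => ?_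
    rw [Matrix.mul_sum, Finset.sum_eq_single t]
    · rw [Matrix.mul_assoc, Matrix.mul_assoc, ← Matrix.mul_assoc (onBond D (s t)),
        ← Matrix.mul_assoc (onBond D (s t)), ← onBond_mul, hsf, onBond_one, Matrix.one_mul,
        ← Matrix.mul_assoc (φ t), (h t).orth, Matrix.one_mul, onBond_mul]
    · intro t' _ ht
      rw [Matrix.mul_assoc, Matrix.mul_assoc, ← Matrix.mul_assoc (onBond D (s t)),
        ← Matrix.mul_assoc (onBond D (s t)), ← onBond_mul, hsf' _ _ ht.symm, onBond_zero]
      simp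
    · simp
  symm i := by
    have h1 : ∑ k, O i k ⊗ₖ A k = ∑ t, onBond D (f t) * (∑ k, Ot t i k ⊗ₖ A k) *
        onBond D (s t) := by
      simp only [Matrix.mul_sum, Matrix.sum_mul]
      rw [Finset.sum_comm]
      refine Finset.sum_congr rfl fun k _ => ?_
      rw [hO]
      simp only [onBond, ← Matrix.mul_kronecker_mul, Matrix.one_mul, Matrix.mul_one]
      ext a b
      simp [Matrix.sum_apply, Matrix.kroneckerMap_apply, Finset.sum_mul]
    -- `A i` slides past matrices on the auxiliary bond, bringing `r t` next to `g t'`, so the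
    -- orthogonality of the auxiliary channels removes the cross terms.
    have h2 : ∀ t t', onBond D (r t) * ((1 : Matrix K K ℂ) ⊗ₖ A i) * onBond D (g t') =
        ((1 : Matrix (κ t) (κ t) ℂ) ⊗ₖ A i) * onBond D (r t * g t') := by
      intro t t'
      rw [onBond_mul_kronecker, Matrix.mul_assoc, ← onBond_mul]
    have h3 : ∀ t t', onBond D (f t) * φinv t * onBond D (r t) * ((1 : Matrix K K ℂ) ⊗ₖ A i) *
        (onBond D (g t') * φ t' * onBond D (s t')) =
        onBond D (f t) * φinv t * (onBond D (r t) * ((1 : Matrix K K ℂ) ⊗ₖ A i) *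
          onBond D (g t')) * (φ t' * onBond D (s t')) := by
      intro t t'
      simp only [Matrix.mul_assoc]
    rw [h1, Matrix.sum_mul, Matrix.sum_mul]
    refine Finset.sum_congr rfl fun t _ => ?_
    rw [(h t).symm i, Matrix.mul_sum, Finset.sum_eq_single t]
    · rw [h3, h2, hrg, onBond_one]
      simp only [Matrix.mul_assoc, Matrix.one_mul]
    · intro t' _ ht
      rw [h3, h2, hrg' _ _ ht.symm, onBond_zero]
      simp
    · simp

end Products

/-! ### Splitting tensors determined by fusion tensors; products of MPO tensors -/

section Decomposition

/-- If two decompositions of an MPO tensor into the same injective MPO tensors have fusion tensors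
related by `F`, then the splitting tensors are related by the transposed coefficients. -/
theorem sum_smul_split_eq {P ι M : Type} [Fintype ι] [Fintype M] {m : ι → ℕ} {T T' : ι → Type}
    [∀ w, Fintype (T w)] [∀ w, Fintype (T' w)] [∀ w, DecidableEq (T' w)]
    {O : P → P → Matrix M M ℂ} {Ow : ∀ w, P → P → Matrix (Fin (m w)) (Fin (m w)) ℂ}
    (hOw : ∀ w, IsInjective fun ij : P × P => Ow w ij.1 ij.2)
    {f : ∀ w, T w → Matrix M (Fin (m w)) ℂ} {s : ∀ w, T w → Matrix (Fin (m w)) M ℂ}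
    {f' : ∀ w, T' w → Matrix M (Fin (m w)) ℂ} {s' : ∀ w, T' w → Matrix (Fin (m w)) M ℂ}
    {G : ∀ w, T w → T' w → ℂ}
    (hO : ∀ i k, O i k = ∑ w, ∑ t, f w t * Ow w i k * s w t)
    (hO' : ∀ i k, O i k = ∑ w, ∑ t, f' w t * Ow w i k * s' w t)
    (hs : ∀ w t t', s' w t * f' w t' = if t = t' then 1 else 0)
    (hs' : ∀ w w', w ≠ w' → ∀ t t', s' w t * f' w' t' = 0)
    (hG : ∀ w t, f w t = ∑ t', G w t t' • f' w t') (w : ι) (t' : T' w) :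
    ∑ t, G w t t' • s w t = s' w t' := by
  rw [← sub_eq_zero]
  -- Computing `s' w t' * O` with each decomposition gives `Ow w * ∑ t, G w t t' • s w t` and `Ow w
  -- * s' w t'`. All `Ow w i k` thus kill the difference, which is zero by injectivity.
  refine (hOw w).eq_zero_of_mul_eq_zero fun q => ?_
  have h1 : s' w t' * O q.1 q.2 = Ow w q.1 q.2 * ∑ t, G w t t' • s w t := by
    rw [hO, Matrix.mul_sum, Finset.sum_eq_single w]
    · rw [Matrix.mul_sum, Matrix.mul_sum]
      refine Finset.sum_congr rfl fun t _ => ?_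
      have : s' w t' * f w t = G w t t' • 1 := by
        rw [hG, Matrix.mul_sum, Finset.sum_eq_single t']
        · rw [Matrix.mul_smul, hs, if_pos rfl]
        · intro t'' _ ht
          rw [Matrix.mul_smul, hs, if_neg ht.symm, smul_zero]
        · simp
      rw [Matrix.mul_assoc, ← Matrix.mul_assoc (s' w t'), this]
      simp
    · intro w' _ hw
      rw [Matrix.mul_sum]
      refine Finset.sum_eq_zero fun t _ => ?_
      have : s' w t' * f w' t = 0 := by
        rw [hG, Matrix.mul_sum]
        exact Finset.sum_eq_zero fun t'' _ => by rw [Matrix.mul_smul, hs' _ _ hw.symm, smul_zero]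
      rw [Matrix.mul_assoc, ← Matrix.mul_assoc (s' w t'), this, Matrix.zero_mul]
    · simp
  have h2 : s' w t' * O q.1 q.2 = Ow w q.1 q.2 * s' w t' := by
    rw [hO', Matrix.mul_sum, Finset.sum_eq_single w]
    · rw [Matrix.mul_sum, Finset.sum_eq_single t']
      · rw [Matrix.mul_assoc, ← Matrix.mul_assoc (s' w t'), hs, if_pos rfl, Matrix.one_mul]
      · intro t'' _ ht
        rw [Matrix.mul_assoc, ← Matrix.mul_assoc (s' w t'), hs, if_neg ht.symm, Matrix.zero_mul]
      · simp
    · intro w' _ hw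
      rw [Matrix.mul_sum]
      refine Finset.sum_eq_zero fun t'' _ => ?_
      rw [Matrix.mul_assoc, ← Matrix.mul_assoc (s' w t'), hs' _ _ hw.symm, Matrix.zero_mul]
    · simp
  rw [Matrix.mul_sub, ← h1, ← h2, sub_self]

variable {P : Type} [Fintype P]

theorem mulMPO_sum {M N T : Type} (s : Finset T) (O : T → P → P → Matrix M M ℂ)
    (O' : P → P → Matrix N N ℂ) :
    mulMPO (fun i k => ∑ t ∈ s, O t i k) O' = fun i k => ∑ t ∈ s, mulMPO (O t) O' i k := by
  ext i k a b
  simp only [mulMPO, Matrix.sum_apply, Matrix.kroneckerMap_apply, Finset.sum_mul]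
  rw [Finset.sum_comm]

theorem mulMPO_sum_right {M N T : Type} (s : Finset T) (O : P → P → Matrix M M ℂ)
    (O' : T → P → P → Matrix N N ℂ) :
    mulMPO O (fun i k => ∑ t ∈ s, O' t i k) = fun i k => ∑ t ∈ s, mulMPO O (O' t) i k := by
  ext i k a b
  simp only [mulMPO, Matrix.sum_apply, Matrix.kroneckerMap_apply, Finset.mul_sum]
  rw [Finset.sum_comm]

theorem mulMPO_conj {M M' N : Type} [Fintype M'] [Fintype N] [DecidableEq N]
    (f : Matrix M M' ℂ) (O : P → P → Matrix M' M' ℂ) (s : Matrix M' M ℂ)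
    (O' : P → P → Matrix N N ℂ) (i k : P) :
    mulMPO (fun i k => f * O i k * s) O' i k =
      (f ⊗ₖ (1 : Matrix N N ℂ)) * mulMPO O O' i k * (s ⊗ₖ (1 : Matrix N N ℂ)) := by
  simp only [mulMPO, Matrix.mul_sum, Matrix.sum_mul, ← Matrix.mul_kronecker_mul, Matrix.one_mul,
    Matrix.mul_one]

theorem mulMPO_conj_right {M N N' : Type} [Fintype N'] [Fintype M] [DecidableEq M]
    (O : P → P → Matrix M M ℂ) (f : Matrix N N' ℂ) (O' : P → P → Matrix N' N' ℂ)
    (s : Matrix N' N ℂ) (i k : P) :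
    mulMPO O (fun i k => f * O' i k * s) i k =
      ((1 : Matrix M M ℂ) ⊗ₖ f) * mulMPO O O' i k * ((1 : Matrix M M ℂ) ⊗ₖ s) := by
  simp only [mulMPO, Matrix.mul_sum, Matrix.sum_mul, ← Matrix.mul_kronecker_mul, Matrix.one_mul,
    Matrix.mul_one]

theorem mulMPO_assoc {M N Q : Type} (O : P → P → Matrix M M ℂ) (O' : P → P → Matrix N N ℂ)
    (O'' : P → P → Matrix Q Q ℂ) (i k : P) :
    mulMPO (mulMPO O O') O'' i k = (mulMPO O (mulMPO O' O'') i k).submatrix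
      (Equiv.prodAssoc _ _ _) (Equiv.prodAssoc _ _ _) := by
  ext a b
  simp only [mulMPO, Matrix.sum_apply, Matrix.submatrix_apply, Equiv.prodAssoc_apply,
    Matrix.kroneckerMap_apply, Finset.sum_mul, Finset.mul_sum]
  rw [Finset.sum_comm]
  simp only [mul_assoc]

end Decomposition

/-! ### Completeness of fusion channels and iterated fusion -/

section Fusion

variable {C : Type u} [Category.{v} C] [Preadditive C] [Linear ℂ C] [MonoidalCategory C]
variable {ι : Type} [Fintype ι] {S : ι → C} {F : FFamily S}

/-- The index set of the fusion channels of `x` and `y`. -/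
abbrev Channel (S : ι → C) (x y : ι) : Type := Σ z, Fin (mult S x y z)

theorem FusionTensors.spl_mul_fus_self {m : ι → ℕ} (B : FusionTensors S F m) {x y : ι}
    (t : Channel S x y) : B.spl x y t.1 t.2 * B.fus x y t.1 t.2 = 1 := by
  rw [B.spl_mul_fus, if_pos rfl]

theorem FusionTensors.spl_mul_fus_eq_zero {m : ι → ℕ} (B : FusionTensors S F m) {x y : ι}
    {t t' : Channel S x y} (h : t ≠ t') : B.spl x y t.1 t.2 * B.fus x y t'.1 t'.2 = 0 := by
  obtain ⟨z, μ⟩ := t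
  obtain ⟨z', μ'⟩ := t'
  by_cases hz : z = z'
  · subst hz
    rw [B.spl_mul_fus, if_neg (by rintro rfl; exact h rfl)]
  · exact B.spl_mul_fus_of_ne _ _ _ _ hz _ _

/-- If the dimensions add up, the fusion channels are complete. -/
theorem FusionTensors.sum_fus_mul_spl {m : ι → ℕ} (B : FusionTensors S F m) {x y : ι}
    (h : m x * m y = ∑ z, mult S x y z * m z) :
    ∑ t : Channel S x y, B.fus x y t.1 t.2 * B.spl x y t.1 t.2 = 1 := by
  classical
  let G : Matrix (Fin (m x) × Fin (m y)) (Σ t : Channel S x y, Fin (m t.1)) ℂ :=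
    Matrix.of fun p q => B.fus x y q.1.1 q.1.2 p q.2
  let G' : Matrix (Σ t : Channel S x y, Fin (m t.1)) (Fin (m x) × Fin (m y)) ℂ :=
    Matrix.of fun q p => B.spl x y q.1.1 q.1.2 q.2 p
  have hG : G' * G = 1 := by
    ext ⟨t, k⟩ ⟨t', k'⟩
    have h0 : (G' * G) ⟨t, k⟩ ⟨t', k'⟩ =
        (B.spl x y t.1 t.2 * B.fus x y t'.1 t'.2) k k' := by
      simp [G, G', Matrix.mul_apply]
    rw [h0]
    by_cases htt : t = t'
    · subst htt
      rw [B.spl_mul_fus_self]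
      simp [Matrix.one_apply]
    · rw [B.spl_mul_fus_eq_zero htt, Matrix.one_apply_ne]
      · rfl
      · intro hc; exact htt (congrArg Sigma.fst hc)
  have hcard : Fintype.card (Σ t : Channel S x y, Fin (m t.1)) =
      Fintype.card (Fin (m x) × Fin (m y)) := by
    simp [Fintype.card_sigma, Fintype.sum_sigma, h]
  -- By the dimension formula `G` is square, so its left inverse, formed by the splitting tensors,
  -- is also a right inverse.
  rw [Matrix.mul_eq_one_comm_of_card_eq _ _ _ hcard] at hG
  rw [← hG]
  ext p q
  simp only [Matrix.sum_apply, Matrix.mul_apply, G, G', Matrix.of_apply]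
  exact (Fintype.sum_sigma (fun j : Σ t : Channel S x y, Fin (m t.1) =>
    B.fus x y j.1.1 j.1.2 p j.2 * B.spl x y j.1.1 j.1.2 j.2 q)).symm

/-- The channels of a threefold product, fused from the left. -/
abbrev LeftChannel (S : ι → C) (x y z w : ι) : Type :=
  Σ u, Fin (mult S x y u) × Fin (mult S u z w)

/-- The channels of a threefold product, fused from the right. -/
abbrev RightChannel (S : ι → C) (x y z w : ι) : Type :=
  Σ v, Fin (mult S y z v) × Fin (mult S x v w)

namespace FusionTensors

variable {m : ι → ℕ} (B : FusionTensors S F m)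

/-- Iterated fusion tensors `(x ⊗ y) ⊗ z → w`. -/
def fusLeft (x y z w : ι) (t : LeftChannel S x y z w) :
    Matrix ((Fin (m x) × Fin (m y)) × Fin (m z)) (Fin (m w)) ℂ :=
  (B.fus x y t.1 t.2.1 ⊗ₖ (1 : Matrix (Fin (m z)) (Fin (m z)) ℂ)) * B.fus t.1 z w t.2.2

/-- Iterated splitting tensors `w → (x ⊗ y) ⊗ z`. -/
def splLeft (x y z w : ι) (t : LeftChannel S x y z w) :
    Matrix (Fin (m w)) ((Fin (m x) × Fin (m y)) × Fin (m z)) ℂ :=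
  B.spl t.1 z w t.2.2 * (B.spl x y t.1 t.2.1 ⊗ₖ (1 : Matrix (Fin (m z)) (Fin (m z)) ℂ))

/-- Iterated fusion tensors `x ⊗ (y ⊗ z) → w`. -/
def fusRight (x y z w : ι) (t : RightChannel S x y z w) :
    Matrix (Fin (m x) × (Fin (m y) × Fin (m z))) (Fin (m w)) ℂ :=
  ((1 : Matrix (Fin (m x)) (Fin (m x)) ℂ) ⊗ₖ B.fus y z t.1 t.2.1) * B.fus x t.1 w t.2.2

/-- Iterated splitting tensors `w → x ⊗ (y ⊗ z)`. -/
def splRight (x y z w : ι) (t : RightChannel S x y z w) :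
    Matrix (Fin (m w)) (Fin (m x) × (Fin (m y) × Fin (m z))) ℂ :=
  B.spl x t.1 w t.2.2 * ((1 : Matrix (Fin (m x)) (Fin (m x)) ℂ) ⊗ₖ B.spl y z t.1 t.2.1)

theorem fusLeft_eq (x y z w : ι) (t : LeftChannel S x y z w) :
    B.fusLeft x y z w t = ∑ t' : RightChannel S x y z w,
      F x y z w t.1 t.2.1 t.2.2 t'.1 t'.2.1 t'.2.2 •
        (B.fusRight x y z w t').submatrix (Equiv.prodAssoc _ _ _) id := by
  rw [fusLeft, B.fus_assoc, Fintype.sum_sigma]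
  simp only [Fintype.sum_prod_type]
  ext a b
  simp only [Matrix.submatrix_apply, Matrix.sum_apply, Matrix.smul_apply, fusRight, id]

theorem splRight_mul_fusRight (x y z v w w' : ι) (ρ : Fin (mult S y z v))
    (σ : Fin (mult S x v w)) (σ' : Fin (mult S x v w')) :
    B.splRight x y z w ⟨v, ρ, σ⟩ * B.fusRight x y z w' ⟨v, ρ, σ'⟩ =
      B.spl x v w σ * B.fus x v w' σ' := by
  rw [splRight, fusRight, Matrix.mul_assoc, ← Matrix.mul_assoc _ _ (B.fus x _ _ _),
    ← Matrix.mul_kronecker_mul, B.spl_mul_fus, if_pos rfl, Matrix.one_mul,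
    Matrix.one_kronecker_one, Matrix.one_mul]

theorem splRight_mul_fusRight_eq_zero (x y z w w' : ι) {t t' : Channel S y z} (h : t ≠ t')
    (σ : Fin (mult S x t.1 w)) (σ' : Fin (mult S x t'.1 w')) :
    B.splRight x y z w ⟨t.1, t.2, σ⟩ * B.fusRight x y z w' ⟨t'.1, t'.2, σ'⟩ = 0 := by
  rw [splRight, fusRight, Matrix.mul_assoc, ← Matrix.mul_assoc _ _ (B.fus x _ _ _),
    ← Matrix.mul_kronecker_mul, B.spl_mul_fus_eq_zero h, Matrix.one_mul,
    Matrix.kronecker_zero, Matrix.zero_mul, Matrix.mul_zero]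

theorem splRight_mul_fusRight_of_ne (x y z : ι) {w w' : ι} (hw : w ≠ w')
    (t : RightChannel S x y z w) (t' : RightChannel S x y z w') :
    B.splRight x y z w t * B.fusRight x y z w' t' = 0 := by
  obtain ⟨v, ρ, σ⟩ := t
  obtain ⟨v', ρ', σ'⟩ := t'
  by_cases h : (⟨v, ρ⟩ : Channel S y z) = ⟨v', ρ'⟩
  · obtain ⟨rfl, h⟩ := Sigma.mk.inj h
    obtain rfl := eq_of_heq h
    rw [splRight_mul_fusRight, B.spl_mul_fus_of_ne _ _ _ _ hw]
  · exact B.splRight_mul_fusRight_eq_zero x y z w w' h σ σ'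

theorem splRight_mul_fusRight_self [DecidableEq ι] (x y z w : ι)
    (t t' : RightChannel S x y z w) :
    B.splRight x y z w t * B.fusRight x y z w t' = if t = t' then 1 else 0 := by
  obtain ⟨v, ρ, σ⟩ := t
  obtain ⟨v', ρ', σ'⟩ := t'
  by_cases h : (⟨v, ρ⟩ : Channel S y z) = ⟨v', ρ'⟩
  · obtain ⟨rfl, h⟩ := Sigma.mk.inj h
    obtain rfl := eq_of_heq h
    rw [splRight_mul_fusRight, B.spl_mul_fus]
    simp
  · rw [if_neg, B.splRight_mul_fusRight_eq_zero x y z w w h σ σ']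
    intro hc
    obtain ⟨rfl, hc⟩ := Sigma.mk.inj hc
    obtain ⟨rfl, -⟩ := Prod.mk.inj (eq_of_heq hc)
    exact h rfl

end FusionTensors

variable {P : Type} [Fintype P]

theorem MPORep.O₂_eq (R : MPORep S F P) (x y : ι) :
    R.O₂ x y = fun i k => ∑ t : Channel S x y,
      R.T.fus x y t.1 t.2 * R.O t.1 i k * R.T.spl x y t.1 t.2 := by
  ext1 i
  ext1 k
  rw [MPORep.O₂, R.fusion, Fintype.sum_sigma]

theorem MPORep.mulMPO_O₂ (R : MPORep S F P) (x y z : ι) (i k : P) :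
    mulMPO (R.O₂ x y) (R.O z) i k = ∑ t : Channel S x y,
      (R.T.fus x y t.1 t.2 ⊗ₖ (1 : Matrix (Fin (R.χ z)) (Fin (R.χ z)) ℂ)) * R.O₂ t.1 z i k *
        (R.T.spl x y t.1 t.2 ⊗ₖ (1 : Matrix (Fin (R.χ z)) (Fin (R.χ z)) ℂ)) := by
  rw [R.O₂_eq x y, mulMPO_sum]
  simp only [mulMPO_conj]
  rfl

theorem MPORep.mulMPO_O₂_right (R : MPORep S F P) (x y z : ι) (i k : P) :
    mulMPO (R.O x) (R.O₂ y z) i k = ∑ t : Channel S y z,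
      ((1 : Matrix (Fin (R.χ x)) (Fin (R.χ x)) ℂ) ⊗ₖ R.T.fus y z t.1 t.2) * R.O₂ x t.1 i k *
        ((1 : Matrix (Fin (R.χ x)) (Fin (R.χ x)) ℂ) ⊗ₖ R.T.spl y z t.1 t.2) := by
  rw [R.O₂_eq y z, mulMPO_sum_right]
  simp only [mulMPO_conj_right]
  rfl

/-- Passes from fusing one pair at a time to a sum ordered by the final label `w`, where the
F-symbols act. -/
theorem sum_channel_left {V : Type*} [AddCommMonoid V] (x y z : ι)
    (g : ∀ w, LeftChannel S x y z w → V) :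
    ∑ t : Channel S x y, ∑ t' : Channel S t.1 z, g t'.1 ⟨t.1, t.2, t'.2⟩ =
      ∑ w, ∑ t : LeftChannel S x y z w, g w t := by
  simp only [Fintype.sum_sigma, Fintype.sum_prod_type]
  symm
  rw [Finset.sum_comm]
  refine Finset.sum_congr rfl fun v _ => ?_
  rw [Finset.sum_comm]

theorem sum_channel_right {V : Type*} [AddCommMonoid V] (x y z : ι)
    (g : ∀ w, RightChannel S x y z w → V) :
    ∑ t : Channel S y z, ∑ t' : Channel S x t.1, g t'.1 ⟨t.1, t.2, t'.2⟩ =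
      ∑ w, ∑ t : RightChannel S x y z w, g w t := by
  simp only [Fintype.sum_sigma, Fintype.sum_prod_type]
  symm
  rw [Finset.sum_comm]
  refine Finset.sum_congr rfl fun v _ => ?_
  rw [Finset.sum_comm]

theorem MPORep.mulMPO_left (R : MPORep S F P) (x y z : ι) (i k : P) :
    mulMPO (R.O₂ x y) (R.O z) i k = ∑ w, ∑ t : LeftChannel S x y z w,
      R.T.fusLeft x y z w t * R.O w i k * R.T.splLeft x y z w t := by
  rw [R.mulMPO_O₂, ← sum_channel_left]
  refine Finset.sum_congr rfl fun t _ => ?_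
  rw [R.O₂_eq, Matrix.mul_sum, Matrix.sum_mul]
  refine Finset.sum_congr rfl fun t' _ => ?_
  simp only [FusionTensors.fusLeft, FusionTensors.splLeft, Matrix.mul_assoc]

theorem MPORep.mulMPO_right (R : MPORep S F P) (x y z : ι) (i k : P) :
    mulMPO (R.O x) (R.O₂ y z) i k = ∑ w, ∑ t : RightChannel S x y z w,
      R.T.fusRight x y z w t * R.O w i k * R.T.splRight x y z w t := by
  rw [R.mulMPO_O₂_right, ← sum_channel_right]
  refine Finset.sum_congr rfl fun t _ => ?_
  rw [R.O₂_eq, Matrix.mul_sum, Matrix.sum_mul]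
  refine Finset.sum_congr rfl fun t' _ => ?_
  simp only [FusionTensors.fusRight, FusionTensors.splRight, Matrix.mul_assoc]

/-- The F-symbol relation for the splitting tensors of an MPO representation. -/
theorem MPORep.sum_splLeft (R : MPORep S F P) (x y z w : ι) (t' : RightChannel S x y z w) :
    ∑ t : LeftChannel S x y z w, F x y z w t.1 t.2.1 t.2.2 t'.1 t'.2.1 t'.2.2 •
      R.T.splLeft x y z w t =
      (R.T.splRight x y z w t').submatrix id (Equiv.prodAssoc _ _ _) := by
  classical
  -- The threefold product of MPO tensors is decomposed in both orders of fusion; the F-symbols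
  -- relate the fusion tensors, hence, transposed, the splitting tensors.
  refine sum_smul_split_eq (O := mulMPO (R.O₂ x y) (R.O z)) (Ow := R.O) R.injective
    (T := fun w => LeftChannel S x y z w) (T' := fun w => RightChannel S x y z w)
    (f := fun w t => R.T.fusLeft x y z w t) (s := fun w t => R.T.splLeft x y z w t)
    (f' := fun w t => (R.T.fusRight x y z w t).submatrix (Equiv.prodAssoc _ _ _) id)
    (s' := fun w t => (R.T.splRight x y z w t).submatrix id (Equiv.prodAssoc _ _ _))
    (G := fun w t t' => F x y z w t.1 t.2.1 t.2.2 t'.1 t'.2.1 t'.2.2)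
    (R.mulMPO_left x y z) ?_ ?_ ?_ (fun w t => R.T.fusLeft_eq x y z w t) w t'
  · intro i k
    rw [MPORep.O₂, mulMPO_assoc]
    change (mulMPO (R.O x) (R.O₂ y z) i k).submatrix _ _ = _
    rw [R.mulMPO_right]
    ext a b
    simp only [Matrix.submatrix_apply, Matrix.sum_apply, Matrix.mul_apply, id]
  · intro w t t'
    rw [Matrix.submatrix_mul_equiv, R.T.splRight_mul_fusRight_self, Matrix.submatrix_id_id]
  · intro w w' hw t t'
    rw [Matrix.submatrix_mul_equiv, R.T.splRight_mul_fusRight_of_ne _ _ _ hw,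
      Matrix.submatrix_zero]
    rfl

end Fusion

/-! ### L-symbols and auxiliary fusion tensors -/

section Symmetric

variable {C : Type u} [Category.{v} C] [Preadditive C] [Linear ℂ C] [MonoidalCategory C]
variable {ι : Type} [Fintype ι] {S : ι → C} {F : FFamily S}
variable {P : Type} [Fintype P] {D : ℕ}

theorem onBond_submatrix {K K' L L' : Type} (X : Matrix K L ℂ) (f : K' → K) (g : L' → L) :
    onBond D (X.submatrix f g) = (onBond D X).submatrix (Prod.map f id) (Prod.map g id) :=
  rfl

theorem submatrix_prodAssoc_mul {K₁ K₂ K₃ K₄ N M : Type} [Fintype K₁] [Fintype K₂]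
    [Fintype K₃] [Fintype K₄] (f : M → N)
    (X : Matrix N ((K₁ × K₂ × K₃) × K₄) ℂ) {L : Type} (Y : Matrix ((K₁ × K₂ × K₃) × K₄) L ℂ)
    {L' : Type} (g : L' → L) :
    X.submatrix f (Prod.map (Equiv.prodAssoc K₁ K₂ K₃) (id : K₄ → K₄)) *
      Y.submatrix (Prod.map (Equiv.prodAssoc K₁ K₂ K₃) id) g = (X * Y).submatrix f g :=
  Matrix.submatrix_mul_equiv X Y f ((Equiv.prodAssoc K₁ K₂ K₃).prodCongr (Equiv.refl K₄)) g

theorem submatrix_id_mul {K L M N : Type} [Fintype L] (X : Matrix K L ℂ) (Y : Matrix L M ℂ)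
    (f : N → K) : X.submatrix f id * Y = (X * Y).submatrix f id :=
  rfl

namespace Symmetry

variable {R : MPORep S F P} {A : P → Matrix (Fin D) (Fin D) ℂ} (Φ : Symmetry R A)
  {Λ : Fin D × Fin D → ℂ}

theorem isAction_mulAction (x y : ι) :
    IsAction A (R.O₂ x y) (mulAction (Φ.act x) (Φ.act y)) (mulActionInv (Φ.inv x) (Φ.inv y)) :=
  (Φ.isAction x).mulAction (Φ.isAction y)

/-- The action tensor of `x ⊗ y` whose auxiliary space is the direct sum over the channels. -/
def actSum (x y : ι) : Matrix ((Σ t : Channel S x y, Fin (Φ.n t.1)) × Fin D)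
    ((Fin (R.χ x) × Fin (R.χ y)) × Fin D) ℂ :=
  fun p => (Φ.act p.1.1.1 * onBond D (R.T.spl x y p.1.1.1 p.1.1.2)) (p.1.2, p.2)

/-- This action tensor requires no auxiliary fusion tensors, so it is available before their
existence is known; comparison with the product of action tensors then produces them. -/
theorem exists_isAction_actSum [DecidableEq ι] (x y : ι) :
    ∃ φinv, IsAction A (R.O₂ x y) (Φ.actSum x y) φinv := by
  -- `g t` is the inclusion of the summand `t`, and its transpose is the projection onto it.
  let g : ∀ t : Channel S x y, Matrix (Σ t : Channel S x y, Fin (Φ.n t.1)) (Fin (Φ.n t.1)) ℂ :=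
    fun t => Matrix.of fun p k => if p = ⟨t, k⟩ then 1 else 0
  have h := IsAction.of_decomposition (T := Channel S x y) (m := fun t => Fin (R.χ t.1))
    (κ := fun t => Fin (Φ.n t.1)) (O := R.O₂ x y) (fun t => Φ.isAction t.1)
    (f := fun t => R.T.fus x y t.1 t.2) (s := fun t => R.T.spl x y t.1 t.2)
    (fun t => R.T.spl_mul_fus_self t) (fun t t' h => R.T.spl_mul_fus_eq_zero h)
    (fun i k => by rw [R.O₂_eq]) (g := g) (r := fun t => (g t)ᵀ)
    (fun t => by
      ext k l
      simp [g, Matrix.mul_apply, Matrix.one_apply, eq_comm])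
    (fun t t' h => by
      ext k l
      have h' : t' ≠ t := h.symm
      simp [g, Matrix.mul_apply, h'])
    (by
      ext p q
      rw [Matrix.sum_apply]
      have : ∀ t, (g t * (g t)ᵀ) p q = ∑ k, if q = ⟨t, k⟩ ∧ p = ⟨t, k⟩ then (1 : ℂ) else 0 := by
        intro t
        simp [g, Matrix.mul_apply, ite_and]
      simp only [this]
      rw [← Fintype.sum_sigma (fun s : Σ t : Channel S x y, Fin (Φ.n t.1) =>
        if q = s ∧ p = s then (1 : ℂ) else 0)]
      simp [ite_and, Matrix.one_apply])
  suffices heq : Φ.actSum x y = ∑ t, onBond D (g t) * Φ.act t.1 *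
      onBond D (R.T.spl x y t.1 t.2) from ⟨_, heq ▸ h⟩
  ext ⟨⟨t, k⟩, a⟩ s
  rw [Matrix.sum_apply, Finset.sum_eq_single t]
  · rw [Matrix.mul_assoc, onBond_mul_apply]
    simp [g, actSum]
  · intro t' _ ht
    rw [Matrix.mul_assoc, onBond_mul_apply]
    refine Finset.sum_eq_zero fun l _ => ?_
    have : g t' ⟨t, k⟩ l = 0 := by
      simp only [g, Matrix.of_apply]
      rw [if_neg]
      intro hc; exact ht (congrArg Sigma.fst hc).symm
    rw [this, zero_mul]
  · simp

/-- The product and the direct sum over channels are action tensors of the same MPO tensor, and the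
size of the auxiliary space is the dimension of the space of left fixed points. -/
theorem n_mul_n (hA : IsInjective A) (hcan : IsLeftCanonical A)
    (hΛ : IsNormalizedRightFixed A Λ) (x y : ι) :
    Φ.n x * Φ.n y = ∑ z, mult S x y z * Φ.n z := by
  classical
  obtain ⟨φinv, h⟩ := Φ.exists_isAction_actSum x y
  have := (Φ.isAction_mulAction x y).card_eq h hA hcan hΛ
  simpa [Fintype.card_sigma, Fintype.sum_sigma] using this

/-- The L-symbols as matrices. -/
def LMatrix (L : Φ.LFamily) (x y z : ι) (μ : Fin (mult S x y z)) :
    Matrix (Fin (Φ.n x) × Fin (Φ.n y)) (Fin (Φ.n z)) ℂ :=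
  Matrix.of fun p k => L x y p.1 p.2 z k μ

theorem isLSymbols_iff (L : Φ.LFamily) : Φ.IsLSymbols L ↔
    ∀ x y, mulAction (Φ.act x) (Φ.act y) = ∑ t : Channel S x y,
      onBond D (Φ.LMatrix L x y t.1 t.2) * (Φ.act t.1 * onBond D (R.T.spl x y t.1 t.2)) := by
  have key : ∀ x y i j a s, (∑ t : Channel S x y,
      onBond D (Φ.LMatrix L x y t.1 t.2) * (Φ.act t.1 * onBond D (R.T.spl x y t.1 t.2)))
        ((i, j), a) s = ∑ z, ∑ k, ∑ μ, L x y i j z k μ *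
          (Φ.act z * onBond D (R.T.spl x y z μ)) (k, a) s := by
    intro x y i j a s
    rw [Matrix.sum_apply, Fintype.sum_sigma]
    refine Finset.sum_congr rfl fun z _ => ?_
    rw [Finset.sum_comm]
    refine Finset.sum_congr rfl fun μ _ => ?_
    rw [onBond_mul_apply]
    rfl
  constructor
  · intro h x y
    ext ⟨⟨i, j⟩, a⟩ s
    rw [key, h x y i j a s]
  · intro h x y i j a s
    rw [h x y, key]

/-- Orthogonality of the MPO fusion tensors selects a single channel from the defining relation. -/
theorem IsLSymbols.mulAction_mul_fus {Φ : Symmetry R A} {L : Φ.LFamily} (h : Φ.IsLSymbols L)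
    (x y z : ι) (μ : Fin (mult S x y z)) :
    mulAction (Φ.act x) (Φ.act y) * onBond D (R.T.fus x y z μ) =
      onBond D (Φ.LMatrix L x y z μ) * Φ.act z := by
  rw [(Φ.isLSymbols_iff L).1 h x y, Matrix.sum_mul,
    Finset.sum_eq_single (⟨z, μ⟩ : Channel S x y)]
  · rw [Matrix.mul_assoc, Matrix.mul_assoc, ← onBond_mul, R.T.spl_mul_fus_self ⟨z, μ⟩, onBond_one,
      Matrix.mul_one]
  · intro t _ ht
    have := R.T.spl_mul_fus_eq_zero ht
    rw [Matrix.mul_assoc, Matrix.mul_assoc, ← onBond_mul, this, onBond_zero, Matrix.mul_zero,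
      Matrix.mul_zero]
  · simp

theorem IsLSymbols.mulAction_mul_fus_mul_inv {Φ : Symmetry R A} {L : Φ.LFamily}
    (h : Φ.IsLSymbols L) (x y z : ι) (μ : Fin (mult S x y z)) :
    mulAction (Φ.act x) (Φ.act y) * onBond D (R.T.fus x y z μ) * Φ.inv z =
      onBond D (Φ.LMatrix L x y z μ) := by
  rw [h.mulAction_mul_fus, Matrix.mul_assoc, (Φ.isAction z).orth, Matrix.mul_one]

theorem IsLSymbols.unique {Φ : Symmetry R A} {L L' : Φ.LFamily} (hD : 0 < D)
    (h : Φ.IsLSymbols L) (h' : Φ.IsLSymbols L') : L = L' := by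
  funext x y i j z k μ
  have : Φ.LMatrix L x y z μ = Φ.LMatrix L' x y z μ := by
    apply onBond_injective hD
    rw [← h.mulAction_mul_fus_mul_inv, h'.mulAction_mul_fus_mul_inv]
  exact congrFun (congrFun this (i, j)) k

/-- The L-symbols exist, and are the fusion tensors of auxiliary spaces. -/
theorem exists_isLSymbols (hA : IsInjective A) (hcan : IsLeftCanonical A)
    (hΛ : IsNormalizedRightFixed A Λ) :
    ∃ (L : Φ.LFamily) (B : FusionTensors S F Φ.n), Φ.IsLSymbols L ∧
      ∀ x y z μ, B.fus x y z μ = Φ.LMatrix L x y z μ := by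
  classical
  -- `Ω` compares the product with the direct sum. Its blocks of columns are the L-symbols and the
  -- blocks of rows of its inverse will be the splitting tensors, so orthogonality is `Ω' * Ω = 1`.
  have hΩ : ∀ x y, ∃ (Ω : Matrix (Fin (Φ.n x) × Fin (Φ.n y))
      (Σ t : Channel S x y, Fin (Φ.n t.1)) ℂ)
      (Ω' : Matrix (Σ t : Channel S x y, Fin (Φ.n t.1)) (Fin (Φ.n x) × Fin (Φ.n y)) ℂ),
      mulAction (Φ.act x) (Φ.act y) = onBond D Ω * Φ.actSum x y ∧ Ω' * Ω = 1 := by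
    intro x y
    obtain ⟨φinv, h⟩ := Φ.exists_isAction_actSum x y
    obtain ⟨Ω, hΩ⟩ := (Φ.isAction_mulAction x y).exists_eq_onBond_mul h hA hcan hΛ
    obtain ⟨Ω', -, h2⟩ := (Φ.isAction_mulAction x y).exists_inverse h hA hcan hΛ hΩ
    exact ⟨Ω, Ω', hΩ, h2⟩
  choose Ω Ω' hΩ hinv using hΩ
  let L : Φ.LFamily := fun x y i j z k μ => Ω x y (i, j) ⟨⟨z, μ⟩, k⟩
  have hL : Φ.IsLSymbols L := by
    rw [isLSymbols_iff]
    intro x y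
    rw [hΩ]
    ext p s
    obtain ⟨p, a⟩ := p
    rw [onBond_mul_apply, Fintype.sum_sigma, Matrix.sum_apply]
    refine Finset.sum_congr rfl fun t _ => ?_
    rw [onBond_mul_apply]
    rfl
  have horth : ∀ x y (t t' : Channel S x y) k l,
      (∑ p, Ω' x y ⟨t, k⟩ p * Φ.LMatrix L x y t'.1 t'.2 p l) =
        if (⟨t, k⟩ : Σ t : Channel S x y, Fin (Φ.n t.1)) = ⟨t', l⟩ then 1 else 0 := by
    intro x y t t' k l
    have := congrFun (congrFun (hinv x y) ⟨t, k⟩) ⟨t', l⟩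
    rw [Matrix.mul_apply, Matrix.one_apply] at this
    exact this
  have hassoc : ∀ (x y z w u : ι) (μ : Fin (mult S x y u)) (ν : Fin (mult S u z w)),
      (Φ.LMatrix L x y u μ ⊗ₖ (1 : Matrix (Fin (Φ.n z)) (Fin (Φ.n z)) ℂ)) * Φ.LMatrix L u z w ν =
      (∑ v, ∑ ρ, ∑ σ, F x y z w u μ ν v ρ σ •
        (((1 : Matrix (Fin (Φ.n x)) (Fin (Φ.n x)) ℂ) ⊗ₖ Φ.LMatrix L y z v ρ) *
          Φ.LMatrix L x v w σ)).submatrix (Equiv.prodAssoc _ _ _) id := by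
    intro x y z w u μ ν
    -- Followed by `Φ.act w`, each iterated product of L-symbols becomes the threefold action tensor
    -- followed by the corresponding iterated MPO fusion tensor. The F-symbol relation of the latter
    -- is thereby inherited.
    apply (Φ.isAction w).eq_of_onBond_mul_eq hΛ.pos
    have hl : ∀ (u : ι) (μ : Fin (mult S x y u)) (ν : Fin (mult S u z w)),
        onBond D ((Φ.LMatrix L x y u μ ⊗ₖ (1 : Matrix (Fin (Φ.n z)) (Fin (Φ.n z)) ℂ)) *
          Φ.LMatrix L u z w ν) * Φ.act w =
        mulAction (mulAction (Φ.act x) (Φ.act y)) (Φ.act z) *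
          onBond D (R.T.fusLeft x y z w ⟨u, μ, ν⟩) := by
      intro u μ ν
      rw [onBond_mul, Matrix.mul_assoc, ← hL.mulAction_mul_fus, ← Matrix.mul_assoc,
        ← mulAction_onBond_mul, ← hL.mulAction_mul_fus, mulAction_mul_onBond, Matrix.mul_assoc,
        ← onBond_mul]
      rfl
    have hr : ∀ (v : ι) (ρ : Fin (mult S y z v)) (σ : Fin (mult S x v w)),
        onBond D (((1 : Matrix (Fin (Φ.n x)) (Fin (Φ.n x)) ℂ) ⊗ₖ Φ.LMatrix L y z v ρ) *
          Φ.LMatrix L x v w σ) * Φ.act w =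
        mulAction (Φ.act x) (mulAction (Φ.act y) (Φ.act z)) *
          onBond D (R.T.fusRight x y z w ⟨v, ρ, σ⟩) := by
      intro v ρ σ
      rw [onBond_mul, Matrix.mul_assoc, ← hL.mulAction_mul_fus, ← Matrix.mul_assoc,
        ← mulAction_onBond_mul_right, ← hL.mulAction_mul_fus, mulAction_mul_onBond_right,
        Matrix.mul_assoc, ← onBond_mul]
      rfl
    rw [hl, R.T.fusLeft_eq, mulAction_assoc, onBond_sum]
    rw [Fintype.sum_sigma]
    simp only [Fintype.sum_prod_type, onBond_smul, onBond_submatrix, Matrix.mul_sum,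
      Matrix.mul_smul, submatrix_prodAssoc_mul, Prod.map_id, submatrix_id_mul, onBond_sum,
      Matrix.sum_mul, Matrix.smul_mul, hr]
    ext p s
    simp only [Matrix.sum_apply, Matrix.smul_apply, Matrix.submatrix_apply]
  refine ⟨L, ⟨fun x y z μ => Φ.LMatrix L x y z μ,
    fun x y z μ => Matrix.of fun k p => Ω' x y ⟨⟨z, μ⟩, k⟩ p, ?_, ?_, hassoc⟩, hL,
    fun _ _ _ _ => rfl⟩
  · intro x y z μ ν
    ext k l
    have := horth x y ⟨z, μ⟩ ⟨z, ν⟩ k l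
    rw [Matrix.mul_apply]
    refine this.trans ?_
    by_cases h : μ = ν
    · subst h; simp [Matrix.one_apply]
    · simp [h]
  · intro x y z z' hz μ ν
    ext k l
    have := horth x y ⟨z, μ⟩ ⟨z', ν⟩ k l
    rw [Matrix.mul_apply]
    refine this.trans ?_
    rw [if_neg, Matrix.zero_apply]
    intro hc
    exact hz (congrArg (fun s => s.1.1) hc)

variable (B : FusionTensors S F Φ.n)

/-- The orthogonality of `B` alone would not suffice: `φ̂ φ̂⁻¹ = 1` also needs its channels to be
complete, which follows from `n_mul_n`. -/
theorem isAction₂ (hA : IsInjective A) (hcan : IsLeftCanonical A)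
    (hΛ : IsNormalizedRightFixed A Λ) (x y : ι) :
    IsAction A (R.O₂ x y) (Φ.act₂ B x y) (Φ.inv₂ B x y) := by
  classical
  have h := IsAction.of_decomposition (T := Channel S x y) (m := fun t => Fin (R.χ t.1))
    (κ := fun t => Fin (Φ.n t.1)) (O := R.O₂ x y) (fun t => Φ.isAction t.1)
    (f := fun t => R.T.fus x y t.1 t.2) (s := fun t => R.T.spl x y t.1 t.2)
    (fun t => R.T.spl_mul_fus_self t) (fun t t' h => R.T.spl_mul_fus_eq_zero h)
    (fun i k => by rw [R.O₂_eq]) (g := fun t => B.fus x y t.1 t.2)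
    (r := fun t => B.spl x y t.1 t.2)
    (fun t => B.spl_mul_fus_self t) (fun t t' h => B.spl_mul_fus_eq_zero h)
    (B.sum_fus_mul_spl (Φ.n_mul_n hA hcan hΛ x y))
  rw [Fintype.sum_sigma, Fintype.sum_sigma] at h
  exact h

end Symmetry

end Symmetric

/-! ### Triple diagrams terminated by fixed points -/

section Diagrams

variable {P : Type} [Fintype P] {D : ℕ} {A : P → Matrix (Fin D) (Fin D) ℂ}
variable {K K' M N Q : Type} [Fintype M] [Fintype N]

/-- Two left vectors joined along the MPS bond between them. -/
def glue {M N : Type} (s : (Fin D × M) × Fin D → ℂ) (t : (Fin D × N) × Fin D → ℂ) :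
    (Fin D × (M × N)) × Fin D → ℂ :=
  fun p => ∑ b, s ((p.1.1, p.1.2.1), b) * t ((b, p.1.2.2), p.2)

/-- `glue` as a bilinear map. -/
def glueMap (D : ℕ) (M N : Type) : ((Fin D × M) × Fin D → ℂ) →ₗ[ℂ]
    ((Fin D × N) × Fin D → ℂ) →ₗ[ℂ] ((Fin D × (M × N)) × Fin D → ℂ) :=
  LinearMap.mk₂ ℂ glue
    (fun s s' t => by ext p; simp [glue, add_mul, Finset.sum_add_distrib])
    (fun c s t => by ext p; simp [glue, mul_assoc, Finset.mul_sum])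
    (fun s t t' => by ext p; simp [glue, mul_add, Finset.sum_add_distrib])
    (fun c s t => by ext p; simp [glue, mul_left_comm, Finset.mul_sum])

theorem glueMap_apply {M N : Type} (s : (Fin D × M) × Fin D → ℂ) (t : (Fin D × N) × Fin D → ℂ) :
    glueMap D M N s t = glue s t :=
  rfl

theorem glue_leftVec {M N : Type} (φ : Matrix (K × Fin D) (M × Fin D) ℂ)
    (ψ : Matrix (K' × Fin D) (N × Fin D) ℂ) (i : K) (j : K') :
    glue (leftVec φ i) (leftVec ψ j) = leftVec (mulAction φ ψ) (i, j) :=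
  rfl

theorem actOnBond_leftVec (φ : Matrix (K × Fin D) (M × Fin D) ℂ) (X : Matrix M Q ℂ) (i : K) :
    actOnBond (leftVec φ i) X = leftVec (φ * onBond D X) i := by
  ext s
  simp [actOnBond, leftVec, mul_onBond_apply]

theorem actOnBond_one [DecidableEq M] (s : (Fin D × M) × Fin D → ℂ) :
    actOnBond s (1 : Matrix M M ℂ) = s := by
  ext p
  simp [actOnBond, Matrix.one_apply]

section Wings

variable [DecidableEq M] [DecidableEq N] [Fintype Q] [DecidableEq Q]

theorem vecMul_pow_of_mem {O : P → P → Matrix M M ℂ} {s : (Fin D × M) × Fin D → ℂ}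
    (hs : s ∈ leftFixed A O) (L : ℕ) : Matrix.vecMul s (mixedTransfer A O ^ L) = s := by
  rw [mem_leftFixed] at hs
  induction L with
  | zero => simp
  | succ L ih => rw [pow_succ, ← Matrix.vecMul_vecMul, ih, hs]

theorem pow_mulVec_of_mem {O : P → P → Matrix M M ℂ} {w : (Fin D × M) × Fin D → ℂ}
    (hw : w ∈ rightFixed A O) (L : ℕ) : Matrix.mulVec (mixedTransfer A O ^ L) w = w := by
  rw [mem_rightFixed] at hw
  induction L with
  | zero => simp
  | succ L ih => rw [pow_succ, ← Matrix.mulVec_mulVec, hw, ih]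

/-- The triple diagram terminated by fixed points does not depend on the lengths of its wings. -/
theorem tripleDiagram_eq {O₁ : P → P → Matrix M M ℂ} {O₂ : P → P → Matrix N N ℂ}
    {O₃ : P → P → Matrix Q Q ℂ} (X : Matrix (M × N) Q ℂ) (L₁ L₂ L₃ : ℕ)
    {s : (Fin D × M) × Fin D → ℂ} {t : (Fin D × N) × Fin D → ℂ} {w : (Fin D × Q) × Fin D → ℂ}
    (hs : s ∈ leftFixed A O₁) (ht : t ∈ leftFixed A O₂) (hw : w ∈ rightFixed A O₃) :
    tripleDiagram A O₁ O₂ O₃ X L₁ L₂ L₃ s t w = actOnBond (glue s t) X ⬝ᵥ w := by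
  simp only [tripleDiagram, vecMul_pow_of_mem hs, vecMul_pow_of_mem ht, pow_mulVec_of_mem hw,
    dotProduct, actOnBond, glue, Fintype.sum_prod_type, Finset.sum_mul]
  refine Finset.sum_congr rfl fun a _ => ?_
  conv_lhs => rw [Finset.sum_comm]
  conv_rhs => rw [Finset.sum_comm]
  refine Finset.sum_congr rfl fun c _ => ?_
  conv_lhs => rw [Finset.sum_comm]
  conv_rhs => rw [Finset.sum_comm]
  refine Finset.sum_congr rfl fun p _ => ?_
  conv_lhs => rw [Finset.sum_comm]
  conv_rhs => rw [Finset.sum_comm]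
  refine Finset.sum_congr rfl fun q _ => ?_
  rw [Finset.sum_comm]

end Wings

variable [Fintype K] [DecidableEq K] [Fintype K'] [DecidableEq K']
variable {O : P → P → Matrix M M ℂ} {O' : P → P → Matrix N N ℂ}
  {φ : Matrix (K × Fin D) (M × Fin D) ℂ} {φinv : Matrix (M × Fin D) (K × Fin D) ℂ}
  {ψ : Matrix (K' × Fin D) (N × Fin D) ℂ} {ψinv : Matrix (N × Fin D) (K' × Fin D) ℂ}
  {Λ : Fin D × Fin D → ℂ}

/-- By bilinearity it is enough to glue rows of action tensors, and this gives rows of the product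
action tensor. -/
theorem IsAction.glue_mem [DecidableEq M] (h : IsAction A O φ φinv) (h' : IsAction A O' ψ ψinv)
    (hA : IsInjective A) (hcan : IsLeftCanonical A) (hD : 0 < D)
    {s : (Fin D × M) × Fin D → ℂ} {t : (Fin D × N) × Fin D → ℂ}
    (hs : s ∈ leftFixed A O) (ht : t ∈ leftFixed A O') :
    glue s t ∈ leftFixed A (mulMPO O O') := by
  have h1 := hcan.sum_conjTranspose_mul
  obtain ⟨c, rfl⟩ := exists_eq_sum_leftVec h hA h1 hD hs
  obtain ⟨d, rfl⟩ := exists_eq_sum_leftVec h' hA h1 hD ht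
  rw [← glueMap_apply]
  simp only [map_sum, map_smul, LinearMap.sum_apply, LinearMap.smul_apply, glueMap_apply,
    glue_leftVec]
  exact Submodule.sum_mem _ fun k _ => Submodule.smul_mem _ _ <| Submodule.sum_mem _ fun l _ =>
    Submodule.smul_mem _ _ (leftVec_mem (h.mulAction h') h1 _)

/-- Right fixed points separate left ones: pairing with the dual basis reads off the coefficients.
-/
theorem IsAction.eq_of_dotProduct_eq (h : IsAction A O φ φinv) (hA : IsInjective A)
    (hcan : IsLeftCanonical A) (hΛ : IsNormalizedRightFixed A Λ)
    {s t : (Fin D × M) × Fin D → ℂ} (hs : s ∈ leftFixed A O) (ht : t ∈ leftFixed A O)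
    (hst : ∀ w ∈ rightFixed A O, s ⬝ᵥ w = t ⬝ᵥ w) : s = t := by
  have h1 := hcan.sum_conjTranspose_mul
  obtain ⟨c, rfl⟩ := exists_eq_sum_leftVec h hA h1 hΛ.pos hs
  obtain ⟨d, rfl⟩ := exists_eq_sum_leftVec h hA h1 hΛ.pos ht
  refine Finset.sum_congr rfl fun k _ => ?_
  have := hst _ (rightVec_mem h hΛ k)
  simp only [sum_dotProduct, smul_dotProduct, h.leftVec_dotProduct_rightVec hΛ] at this
  simp only [smul_eq_mul, mul_ite, mul_one, mul_zero, Finset.sum_ite_eq', Finset.mem_univ,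
    if_true] at this
  rw [this]

end Diagrams

/-! ### The triple inner product and the threefold action tensors -/

section Symmetric

variable {C : Type u} [Category.{v} C] [Preadditive C] [Linear ℂ C] [MonoidalCategory C]
variable {ι : Type} [Fintype ι] {S : ι → C} {F : FFamily S}
variable {P : Type} [Fintype P] {D : ℕ}
variable {R : MPORep S F P} {A : P → Matrix (Fin D) (Fin D) ℂ}
  {Λ : Fin D × Fin D → ℂ}

/-- The triple inner product as the map that glues fixed points. -/
def Symmetry.glueFamily (Φ : Symmetry R A) (hA : IsInjective A) (hcan : IsLeftCanonical A)
    (hD : 0 < D) :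
    JFamily R A := fun x y =>
  TensorProduct.lift (LinearMap.mk₂ ℂ
    (fun s t => ⟨glue s.1 t.1,
      (Φ.isAction x).glue_mem (Φ.isAction y) hA hcan hD s.2 t.2⟩)
    (fun s s' t => Subtype.ext (LinearMap.map_add₂ (glueMap D _ _) s.1 s'.1 t.1))
    (fun c s t => Subtype.ext (LinearMap.map_smul₂ (glueMap D _ _) c s.1 t.1))
    (fun s t t' => Subtype.ext (map_add (glueMap D _ _ s.1) t.1 t'.1))
    (fun c s t => Subtype.ext (map_smul (glueMap D _ _ s.1) c t.1)))

theorem tripleDiagram_fixed (x y : ι) (L₁ L₂ L₃ : ℕ) (s : leftFixed A (R.O x))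
    (t : leftFixed A (R.O y)) (w : rightFixed A (R.O₂ x y)) :
    tripleDiagram A (R.O x) (R.O y) (R.O₂ x y) 1 L₁ L₂ L₃ s.1 t.1 w.1 = glue s.1 t.1 ⬝ᵥ w.1 := by
  rw [tripleDiagram_eq 1 L₁ L₂ L₃ s.2 t.2 w.2, actOnBond_one]

/-- The diagram does not depend on the lengths of the wings, so its limit is its value, namely the
glued vector paired with `w`; such pairings determine a left fixed point. -/
theorem Symmetry.isTripleInnerProduct_iff (Φ : Symmetry R A) (hA : IsInjective A)
    (hcan : IsLeftCanonical A)
    (hΛ : IsNormalizedRightFixed A Λ) (J : JFamily R A) :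
    IsTripleInnerProduct R A J ↔ ∀ x y (s : leftFixed A (R.O x)) (t : leftFixed A (R.O y)),
      (J x y (s ⊗ₜ[ℂ] t)).1 = glue s.1 t.1 := by
  simp only [IsTripleInnerProduct, tripleDiagram_fixed]
  constructor
  · intro h x y s t
    refine (Φ.isAction_mulAction x y).eq_of_dotProduct_eq hA hcan hΛ (J x y (s ⊗ₜ[ℂ] t)).2
      ((Φ.isAction x).glue_mem (Φ.isAction y) hA hcan hΛ.pos s.2 t.2) fun w hw => ?_
    exact tendsto_nhds_unique (h x y s t ⟨w, hw⟩) tendsto_const_nhds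
  · intro h x y s t w
    rw [h]
    exact tendsto_const_nhds

theorem Symmetry.existsUnique_tripleInnerProduct (Φ : Symmetry R A) (hA : IsInjective A)
    (hcan : IsLeftCanonical A)
    (hΛ : IsNormalizedRightFixed A Λ) : ∃! J, IsTripleInnerProduct R A J := by
  refine ⟨Φ.glueFamily hA hcan hΛ.pos, ?_, ?_⟩
  · change IsTripleInnerProduct R A _
    rw [Φ.isTripleInnerProduct_iff hA hcan hΛ]
    intro x y s t
    rfl
  · intro J hJ
    rw [Φ.isTripleInnerProduct_iff hA hcan hΛ] at hJ
    funext x y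
    refine TensorProduct.ext' fun s t => Subtype.ext ?_
    rw [hJ]
    rfl

namespace Symmetry

variable (Φ : Symmetry R A) (B : FusionTensors S F Φ.n)

theorem actLeft_eq (x y z : ι) : Φ.actLeft B x y z = ∑ w, ∑ t : LeftChannel S x y z w,
    onBond D (B.fusLeft x y z w t) * Φ.act w * onBond D (R.T.splLeft x y z w t) := by
  simp only [Fintype.sum_sigma, Fintype.sum_prod_type]
  rfl

theorem actRight_eq (x y z : ι) : Φ.actRight B x y z = ∑ w, ∑ t : RightChannel S x y z w,
    onBond D (B.fusRight x y z w t) * Φ.act w * onBond D (R.T.splRight x y z w t) := by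
  simp only [Fintype.sum_sigma, Fintype.sum_prod_type]
  rfl

theorem act₂_eq (x y : ι) : Φ.act₂ B x y = ∑ t : Channel S x y,
    onBond D (B.fus x y t.1 t.2) * Φ.act t.1 * onBond D (R.T.spl x y t.1 t.2) := by
  rw [Fintype.sum_sigma]
  rfl

/-- In this form the tensor is assembled from the `act₂ B u z` over the channels `u` of `x ⊗ y`, so
`IsAction.of_decomposition` applies once more. -/
theorem actLeft_eq_sum (x y z : ι) : Φ.actLeft B x y z = ∑ t : Channel S x y,
    onBond D (B.fus x y t.1 t.2 ⊗ₖ (1 : Matrix (Fin (Φ.n z)) (Fin (Φ.n z)) ℂ)) *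
      Φ.act₂ B t.1 z *
      onBond D (R.T.spl x y t.1 t.2 ⊗ₖ (1 : Matrix (Fin (R.χ z)) (Fin (R.χ z)) ℂ)) := by
  rw [actLeft_eq, ← sum_channel_left]
  refine Finset.sum_congr rfl fun t _ => ?_
  rw [act₂_eq, Matrix.mul_sum, Matrix.sum_mul]
  refine Finset.sum_congr rfl fun t' _ => ?_
  simp only [FusionTensors.fusLeft, FusionTensors.splLeft, onBond_mul, Matrix.mul_assoc]

theorem actRight_eq_sum (x y z : ι) : Φ.actRight B x y z = ∑ t : Channel S y z,
    onBond D ((1 : Matrix (Fin (Φ.n x)) (Fin (Φ.n x)) ℂ) ⊗ₖ B.fus y z t.1 t.2) *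
      Φ.act₂ B x t.1 *
      onBond D ((1 : Matrix (Fin (R.χ x)) (Fin (R.χ x)) ℂ) ⊗ₖ R.T.spl y z t.1 t.2) := by
  rw [actRight_eq, ← sum_channel_right]
  refine Finset.sum_congr rfl fun t _ => ?_
  rw [act₂_eq, Matrix.mul_sum, Matrix.sum_mul]
  refine Finset.sum_congr rfl fun t' _ => ?_
  simp only [FusionTensors.fusRight, FusionTensors.splRight, onBond_mul, Matrix.mul_assoc]

theorem exists_isActionLeft (hA : IsInjective A) (hcan : IsLeftCanonical A)
    (hΛ : IsNormalizedRightFixed A Λ) (x y z : ι) :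
    ∃ φinv, IsAction A (mulMPO (R.O₂ x y) (R.O z)) (Φ.actLeft B x y z) φinv := by
  classical
  rw [actLeft_eq_sum]
  refine ⟨_, IsAction.of_decomposition (fun t : Channel S x y => Φ.isAction₂ B hA hcan hΛ t.1 z)
    (f := fun t => R.T.fus x y t.1 t.2 ⊗ₖ (1 : Matrix (Fin (R.χ z)) (Fin (R.χ z)) ℂ))
    (r := fun t => B.spl x y t.1 t.2 ⊗ₖ (1 : Matrix (Fin (Φ.n z)) (Fin (Φ.n z)) ℂ))
    (fun t => ?_) (fun t t' h => ?_) (R.mulMPO_O₂ x y z) (fun t => ?_) (fun t t' h => ?_) ?_⟩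
  · rw [← Matrix.mul_kronecker_mul, R.T.spl_mul_fus_self, Matrix.one_mul, Matrix.one_kronecker_one]
  · rw [← Matrix.mul_kronecker_mul, R.T.spl_mul_fus_eq_zero h, Matrix.zero_kronecker]
  · rw [← Matrix.mul_kronecker_mul, B.spl_mul_fus_self, Matrix.one_mul, Matrix.one_kronecker_one]
  · rw [← Matrix.mul_kronecker_mul, B.spl_mul_fus_eq_zero h, Matrix.zero_kronecker]
  · rw [← Matrix.one_kronecker_one, ← B.sum_fus_mul_spl (Φ.n_mul_n hA hcan hΛ x y)]
    ext a b
    simp [← Matrix.mul_kronecker_mul, Matrix.sum_apply, Matrix.kroneckerMap_apply,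
      Finset.sum_mul]

theorem exists_isActionRight (hA : IsInjective A) (hcan : IsLeftCanonical A)
    (hΛ : IsNormalizedRightFixed A Λ) (x y z : ι) :
    ∃ φinv, IsAction A (mulMPO (R.O x) (R.O₂ y z)) (Φ.actRight B x y z) φinv := by
  classical
  rw [actRight_eq_sum]
  refine ⟨_, IsAction.of_decomposition (fun t : Channel S y z => Φ.isAction₂ B hA hcan hΛ x t.1)
    (f := fun t => (1 : Matrix (Fin (R.χ x)) (Fin (R.χ x)) ℂ) ⊗ₖ R.T.fus y z t.1 t.2)
    (r := fun t => (1 : Matrix (Fin (Φ.n x)) (Fin (Φ.n x)) ℂ) ⊗ₖ B.spl y z t.1 t.2)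
    (fun t => ?_) (fun t t' h => ?_) (R.mulMPO_O₂_right x y z) (fun t => ?_) (fun t t' h => ?_) ?_⟩
  · rw [← Matrix.mul_kronecker_mul, R.T.spl_mul_fus_self, Matrix.one_mul, Matrix.one_kronecker_one]
  · rw [← Matrix.mul_kronecker_mul, R.T.spl_mul_fus_eq_zero h, Matrix.kronecker_zero]
  · rw [← Matrix.mul_kronecker_mul, B.spl_mul_fus_self, Matrix.one_mul, Matrix.one_kronecker_one]
  · rw [← Matrix.mul_kronecker_mul, B.spl_mul_fus_eq_zero h, Matrix.kronecker_zero]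
  · rw [← Matrix.one_kronecker_one, ← B.sum_fus_mul_spl (Φ.n_mul_n hA hcan hΛ y z)]
    ext a b
    simp [← Matrix.mul_kronecker_mul, Matrix.sum_apply, Matrix.kroneckerMap_apply,
      Finset.mul_sum]

/-- The action tensors `φ̂_{(x ⊗ y) ⊗ z}` and `φ̂_{x ⊗ (y ⊗ z)}` agree. -/
theorem actLeft_eq_actRight (x y z : ι) :
    Φ.actLeft B x y z = (Φ.actRight B x y z).submatrix
      (Prod.map (Equiv.prodAssoc _ _ _) id) (Prod.map (Equiv.prodAssoc _ _ _) id) := by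
  rw [actLeft_eq, actRight_eq]
  have key : ∀ w, (∑ t : LeftChannel S x y z w,
      onBond D (B.fusLeft x y z w t) * Φ.act w * onBond D (R.T.splLeft x y z w t)) =
      ∑ t' : RightChannel S x y z w,
        (onBond D (B.fusRight x y z w t') * Φ.act w *
          onBond D (R.T.splRight x y z w t')).submatrix
          (Prod.map (Equiv.prodAssoc _ _ _) id) (Prod.map (Equiv.prodAssoc _ _ _) id) := by
    intro w
    -- The F-symbols that appear on the auxiliary side are moved across `Φ.act w` and absorbed by
    -- the splitting tensors of the MPO.
    simp only [B.fusLeft_eq, onBond_sum, onBond_smul, Matrix.sum_mul, Matrix.smul_mul]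
    rw [Finset.sum_comm]
    refine Finset.sum_congr rfl fun t' _ => ?_
    have h := congrArg (onBond D) (R.sum_splLeft x y z w t')
    rw [onBond_sum] at h
    simp only [onBond_smul] at h
    simp only [← Matrix.mul_smul, ← Matrix.mul_sum, h]
    rfl
  simp only [key]
  ext a b
  simp only [Matrix.sum_apply, Matrix.submatrix_apply]

end Symmetry

end Symmetric

/-! ### Matrices of morphisms between simple objects and their products -/

noncomputable section Simple

variable {C : Type u} [Category.{v} C] [Preadditive C] [Linear ℂ C] [MonoidalCategory C]
  [MonoidalPreadditive C] [MonoidalLinear ℂ C] [RigidCategory C]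
  [Limits.HasFiniteBiproducts C] {ι : Type} [Fintype ι] {S : ι → C} (hS : IsFusionCategory S)
  (n : ι → ℕ)

theorem IsFusionCategory.id_ne_zero (hS : IsFusionCategory S) (x : ι) : 𝟙 (S x) ≠ 0 := by
  intro h
  have h1 := hS.end_simple x
  have : Subsingleton (S x ⟶ S x) := ⟨fun f g => by
    rw [← Category.comp_id f, ← Category.comp_id g, h, Limits.comp_zero, Limits.comp_zero]⟩
  rw [Module.finrank_zero_of_subsingleton] at h1
  exact zero_ne_one h1

/-- The identity of a simple object as a basis of its endomorphism space. -/
def IsFusionCategory.idBasis (x : ι) : Module.Basis Unit ℂ (S x ⟶ S x) :=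
  FiniteDimensional.basisSingleton Unit (hS.end_simple x) (𝟙 (S x)) (hS.id_ne_zero x)

theorem IsFusionCategory.idBasis_apply (x : ι) (u : Unit) : hS.idBasis x u = 𝟙 (S x) :=
  FiniteDimensional.basisSingleton_apply _ _ _ _ _

theorem IsFusionCategory.exists_eq_smul_id (hS : IsFusionCategory S) {x : ι} (f : S x ⟶ S x) :
    ∃ c : ℂ, f = c • 𝟙 (S x) := by
  have := (hS.idBasis x).sum_repr f
  simp only [Finset.univ_unique, Finset.sum_singleton, hS.idBasis_apply] at this
  exact ⟨_, this.symm⟩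

open Classical in
/-- Morphisms between simple objects as matrices between the vector spaces `ℂ ^ n x`. -/
def simpleMat (x y : ι) : (S x ⟶ S y) →ₗ[ℂ] Matrix (Fin (n x)) (Fin (n y)) ℂ :=
  if h : x = y then h ▸ ((hS.idBasis x).constr ℂ fun _ => (1 : Matrix (Fin (n x)) (Fin (n x)) ℂ))
  else 0

theorem simpleMat_id (x : ι) : simpleMat hS n x x (𝟙 (S x)) = 1 := by
  rw [simpleMat, dif_pos rfl, ← hS.idBasis_apply x ()]
  exact (hS.idBasis x).constr_basis _ _ _

theorem simpleMat_comp {x y z : ι} (f : S x ⟶ S y) (g : S y ⟶ S z) :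
    simpleMat hS n x z (f ≫ g) = simpleMat hS n x y f * simpleMat hS n y z g := by
  by_cases hxy : x = y
  · subst hxy
    obtain ⟨c, rfl⟩ := hS.exists_eq_smul_id f
    rw [map_smul, simpleMat_id, Linear.smul_comp, Category.id_comp, map_smul, Matrix.smul_mul,
      Matrix.one_mul]
  · rw [hS.hom_eq_zero x y hxy f, map_zero, Limits.zero_comp, map_zero, Matrix.zero_mul]

variable {n} {F : FFamily S} (e : FusionBasis S) (B : FusionTensors S F n)

/-- Morphisms `x ⊗ y ⟶ z` as matrices, defined by the fusion tensors. -/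
def fusMat (x y z : ι) :
    (S x ⊗ S y ⟶ S z) →ₗ[ℂ] Matrix (Fin (n x) × Fin (n y)) (Fin (n z)) ℂ :=
  (e x y z).constr ℂ (B.fus x y z)

theorem fusMat_basis (x y z : ι) (μ : Fin (mult S x y z)) :
    fusMat e B x y z (e x y z μ) = B.fus x y z μ :=
  (e x y z).constr_basis _ _ _

/-- Morphisms `z ⟶ x ⊗ y` as matrices, defined by the splitting tensors. -/
def splMat (x y z : ι) :
    (S z ⟶ S x ⊗ S y) →ₗ[ℂ] Matrix (Fin (n z)) (Fin (n x) × Fin (n y)) ℂ where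
  -- No basis of `Hom(z, x ⊗ y)` is chosen: `b` is tested against every `e x y t.1 t.2`, and the
  -- resulting scalars weight the splitting tensors.
  toFun b := ∑ t : Channel S x y, simpleMat hS n z t.1 (b ≫ e x y t.1 t.2) * B.spl x y t.1 t.2
  map_add' b b' := by
    simp only [Preadditive.add_comp, map_add, Matrix.add_mul, Finset.sum_add_distrib]
  map_smul' c b := by
    simp only [Linear.smul_comp, map_smul, Matrix.smul_mul, Finset.smul_sum, RingHom.id_apply]

theorem splMat_apply {x y z : ι} (b : S z ⟶ S x ⊗ S y) : splMat hS e B x y z b =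
    ∑ t : Channel S x y, simpleMat hS n z t.1 (b ≫ e x y t.1 t.2) * B.spl x y t.1 t.2 :=
  rfl

/-- By Schur's lemma `g` is a multiple of the identity or zero. The compatibilities with whiskering
below hold for the same reason. -/
theorem fusMat_comp {x y z w : ι} (a : S x ⊗ S y ⟶ S z) (g : S z ⟶ S w) :
    fusMat e B x y w (a ≫ g) = fusMat e B x y z a * simpleMat hS n z w g := by
  by_cases h : z = w
  · subst h
    obtain ⟨c, rfl⟩ := hS.exists_eq_smul_id g
    rw [map_smul, simpleMat_id, Linear.comp_smul, Category.comp_id, map_smul, Matrix.mul_smul,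
      Matrix.mul_one]
  · rw [hS.hom_eq_zero z w h g, map_zero, Limits.comp_zero, map_zero, Matrix.mul_zero]

theorem fusMat_whiskerRight_comp {x x' y z : ι} (f : S x ⟶ S x') (a : S x' ⊗ S y ⟶ S z) :
    fusMat e B x y z (f ▷ S y ≫ a) =
      (simpleMat hS n x x' f ⊗ₖ (1 : Matrix (Fin (n y)) (Fin (n y)) ℂ)) * fusMat e B x' y z a := by
  by_cases h : x = x'
  · subst h
    obtain ⟨c, rfl⟩ := hS.exists_eq_smul_id f
    rw [map_smul, simpleMat_id, MonoidalLinear.smul_whiskerRight, Linear.smul_comp,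
      id_whiskerRight, Category.id_comp, map_smul, Matrix.smul_kronecker, Matrix.one_kronecker_one,
      Matrix.smul_mul, Matrix.one_mul]
  · rw [hS.hom_eq_zero x x' h f, map_zero, MonoidalPreadditive.zero_whiskerRight,
      Limits.zero_comp, map_zero, Matrix.zero_kronecker, Matrix.zero_mul]

theorem fusMat_whiskerLeft_comp {x y y' z : ι} (f : S y ⟶ S y') (a : S x ⊗ S y' ⟶ S z) :
    fusMat e B x y z (S x ◁ f ≫ a) =
      ((1 : Matrix (Fin (n x)) (Fin (n x)) ℂ) ⊗ₖ simpleMat hS n y y' f) * fusMat e B x y' z a := by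
  by_cases h : y = y'
  · subst h
    obtain ⟨c, rfl⟩ := hS.exists_eq_smul_id f
    rw [map_smul, simpleMat_id, MonoidalLinear.whiskerLeft_smul, Linear.smul_comp,
      whiskerLeft_id, Category.id_comp, map_smul, Matrix.kronecker_smul, Matrix.one_kronecker_one,
      Matrix.smul_mul, Matrix.one_mul]
  · rw [hS.hom_eq_zero y y' h f, map_zero, MonoidalPreadditive.whiskerLeft_zero,
      Limits.zero_comp, map_zero, Matrix.kronecker_zero, Matrix.zero_mul]

theorem fusMat_tensorHom_comp {x x' y y' z : ι} (f : S x ⟶ S x') (g : S y ⟶ S y')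
    (a : S x' ⊗ S y' ⟶ S z) : fusMat e B x y z ((f ⊗ₘ g) ≫ a) =
      (simpleMat hS n x x' f ⊗ₖ simpleMat hS n y y' g) * fusMat e B x' y' z a := by
  rw [MonoidalCategory.tensorHom_def, Category.assoc, fusMat_whiskerRight_comp hS,
    fusMat_whiskerLeft_comp hS,
    ← Matrix.mul_assoc, ← Matrix.mul_kronecker_mul, Matrix.mul_one, Matrix.one_mul]

theorem splMat_mul_fusMat {x y z w : ι} (b : S z ⟶ S x ⊗ S y) (a : S x ⊗ S y ⟶ S w) :
    splMat hS e B x y z b * fusMat e B x y w a = simpleMat hS n z w (b ≫ a) := by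
  obtain ⟨c, rfl⟩ : ∃ c : Fin (mult S x y w) → ℂ, a = ∑ μ, c μ • e x y w μ :=
    ⟨_, ((e x y w).sum_repr a).symm⟩
  have key : ∀ μ, splMat hS e B x y z b * B.fus x y w μ =
      simpleMat hS n z w (b ≫ e x y w μ) := by
    intro μ
    rw [splMat_apply, Matrix.sum_mul, Finset.sum_eq_single (⟨w, μ⟩ : Channel S x y)]
    · rw [Matrix.mul_assoc, B.spl_mul_fus_self ⟨w, μ⟩, Matrix.mul_one]
    · intro t _ ht
      have := B.spl_mul_fus_eq_zero ht
      rw [Matrix.mul_assoc, this, Matrix.mul_zero]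
    · simp
  simp only [map_sum, map_smul, Preadditive.comp_sum, Linear.comp_smul, Matrix.mul_sum,
    Matrix.mul_smul, fusMat_basis, key]

/-- A decomposition of an object into simple objects. -/
structure Decomposition (S : ι → C) (c : C) where
  len : ℕ
  idx : Fin len → ι
  incl : ∀ k, S (idx k) ⟶ c
  proj : ∀ k, c ⟶ S (idx k)
  incl_proj_self : ∀ k, incl k ≫ proj k = 𝟙 _
  incl_proj_of_ne : ∀ k l, k ≠ l → incl k ≫ proj l = 0
  total : ∑ k, proj k ≫ incl k = 𝟙 c

theorem IsFusionCategory.nonempty_decomposition (hS : IsFusionCategory S) (c : C) :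
    Nonempty (Decomposition S c) := by
  obtain ⟨m, f, ⟨i⟩⟩ := hS.semisimple c
  refine ⟨⟨m, f, fun k => Limits.biproduct.ι (fun k => S (f k)) k ≫ i.inv,
    fun k => i.hom ≫ Limits.biproduct.π (fun k => S (f k)) k, ?_, ?_, ?_⟩⟩
  · intro k; simp
  · intro k l h
    simp [Limits.biproduct.ι_π_ne _ h]
  · calc _ = i.hom ≫ (∑ k, Limits.biproduct.π (fun k => S (f k)) k ≫
          Limits.biproduct.ι (fun k => S (f k)) k) ≫ i.inv := by
          simp only [Preadditive.sum_comp, Preadditive.comp_sum, Category.assoc]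
      _ = _ := by rw [Limits.biproduct.total]; simp

variable {c c' c'' : C}

/-- The sum over the summands of `c` inserts `dc.total`, so only the composite `a ≫ b` matters. -/
theorem sum_fusMat_mul_splMat (dc : Decomposition S c) {x y x' y' : ι}
    (a : S x ⊗ S y ⟶ c) (b : c ⟶ S x' ⊗ S y') :
    ∑ k, fusMat e B x y _ (a ≫ dc.proj k) * splMat hS e B x' y' _ (dc.incl k ≫ b) =
      ∑ t : Channel S x' y', fusMat e B x y t.1 (a ≫ b ≫ e x' y' t.1 t.2) *
        B.spl x' y' t.1 t.2 := by
  simp only [splMat_apply, Matrix.mul_sum]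
  rw [Finset.sum_comm]
  refine Finset.sum_congr rfl fun t _ => ?_
  simp only [← Matrix.mul_assoc, ← fusMat_comp hS, ← Matrix.sum_mul, ← map_sum]
  congr 2
  have : a ≫ b ≫ e x' y' t.1 t.2 = a ≫ (∑ k, dc.proj k ≫ dc.incl k) ≫ b ≫ e x' y' t.1 t.2 := by
    rw [dc.total, Category.id_comp]
  rw [this]
  simp only [Preadditive.sum_comp, Preadditive.comp_sum, Category.assoc]

theorem sum_fusMat_mul_splMat_tensorHom
    (hB : ∀ x y, ∑ t : Channel S x y, B.fus x y t.1 t.2 * B.spl x y t.1 t.2 = 1)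
    (dc : Decomposition S c) {x y x' y' : ι} (a : S x ⊗ S y ⟶ c) (b : c ⟶ S x' ⊗ S y')
    (f : S x ⟶ S x') (g : S y ⟶ S y') (h : a ≫ b = f ⊗ₘ g) :
    ∑ k, fusMat e B x y _ (a ≫ dc.proj k) * splMat hS e B x' y' _ (dc.incl k ≫ b) =
      simpleMat hS n x x' f ⊗ₖ simpleMat hS n y y' g := by
  rw [sum_fusMat_mul_splMat]
  simp only [← Category.assoc, h, fusMat_tensorHom_comp hS, fusMat_basis, Matrix.mul_assoc,
    ← Matrix.mul_sum, hB, Matrix.mul_one]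

/-- Morphisms `x ⊗ (y ⊗ z) ⟶ w` as matrices. -/
def fusMat₃ (x y z w : ι) (d : Decomposition S (S y ⊗ S z)) :
    (S x ⊗ (S y ⊗ S z) ⟶ S w) →ₗ[ℂ]
      Matrix (Fin (n x) × (Fin (n y) × Fin (n z))) (Fin (n w)) ℂ where
  toFun h := ∑ k, ((1 : Matrix (Fin (n x)) (Fin (n x)) ℂ) ⊗ₖ fusMat e B y z _ (d.proj k)) *
    fusMat e B x _ w (S x ◁ d.incl k ≫ h)
  map_add' b b' := by
    simp only [Preadditive.comp_add, map_add, Matrix.mul_add, Finset.sum_add_distrib]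
  map_smul' c b := by
    simp only [Linear.comp_smul, map_smul, Matrix.mul_smul, Finset.smul_sum, RingHom.id_apply]

theorem fusMat₃_apply {x y z w : ι} (d : Decomposition S (S y ⊗ S z))
    (h : S x ⊗ (S y ⊗ S z) ⟶ S w) : fusMat₃ e B x y z w d h =
      ∑ k, ((1 : Matrix (Fin (n x)) (Fin (n x)) ℂ) ⊗ₖ fusMat e B y z _ (d.proj k)) *
        fusMat e B x _ w (S x ◁ d.incl k ≫ h) :=
  rfl

theorem one_kronecker_sum {X Y Z : Type} [DecidableEq X] {T : Type} (s : Finset T)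
    (f : T → Matrix Y Z ℂ) :
    (1 : Matrix X X ℂ) ⊗ₖ (∑ t ∈ s, f t) = ∑ t ∈ s, (1 : Matrix X X ℂ) ⊗ₖ f t := by
  ext a b
  simp [Matrix.sum_apply, Matrix.kroneckerMap_apply, Finset.mul_sum]

theorem sum_kronecker_one {X Y Z : Type} [DecidableEq X] {T : Type} (s : Finset T)
    (f : T → Matrix Y Z ℂ) :
    (∑ t ∈ s, f t) ⊗ₖ (1 : Matrix X X ℂ) = ∑ t ∈ s, f t ⊗ₖ (1 : Matrix X X ℂ) := by
  ext a b
  simp [Matrix.sum_apply, Matrix.kroneckerMap_apply, Finset.sum_mul]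

/-- Inserting `d.total` in front of `a` shows that on such composites `fusMat₃` is independent of
the decomposition `d`. -/
theorem fusMat₃_comp (hS : IsFusionCategory S) {x y z u w : ι}
    (d : Decomposition S (S y ⊗ S z)) (a : S y ⊗ S z ⟶ S u)
    (b : S x ⊗ S u ⟶ S w) : fusMat₃ e B x y z w d (S x ◁ a ≫ b) =
      ((1 : Matrix (Fin (n x)) (Fin (n x)) ℂ) ⊗ₖ fusMat e B y z u a) * fusMat e B x u w b := by
  have ha : a = ∑ k, d.proj k ≫ d.incl k ≫ a := by
    conv_lhs => rw [← Category.id_comp a, ← d.total]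
    simp only [Preadditive.sum_comp, Category.assoc]
  have h1 : fusMat e B y z u a =
      ∑ k, fusMat e B y z _ (d.proj k) * simpleMat hS n _ u (d.incl k ≫ a) := by
    conv_lhs => rw [ha]
    simp only [map_sum, fusMat_comp hS]
  rw [h1, one_kronecker_sum, Matrix.sum_mul, fusMat₃_apply]
  refine Finset.sum_congr rfl fun k _ => ?_
  rw [← Category.assoc, ← whiskerLeft_comp, fusMat_whiskerLeft_comp hS, ← Matrix.mul_assoc,
    ← Matrix.mul_kronecker_mul, Matrix.one_mul]

variable {e}

/-- On basis morphisms both sides expand with the same F-symbols, one side by `B.fus_assoc` and the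
other by `hF`. Bilinearity in `a` and `b` does the rest. -/
theorem kronecker_fusMat_mul_fusMat (hS : IsFusionCategory S) (hF : IsFSymbols e F)
    {x y z u w : ι} (d : Decomposition S (S y ⊗ S z))
    (a : S x ⊗ S y ⟶ S u) (b : S u ⊗ S z ⟶ S w) :
    (fusMat e B x y u a ⊗ₖ (1 : Matrix (Fin (n z)) (Fin (n z)) ℂ)) * fusMat e B u z w b =
      (fusMat₃ e B x y z w d ((α_ _ _ _).inv ≫ a ▷ S z ≫ b)).submatrix
        (Equiv.prodAssoc _ _ _) id := by
  have key : ∀ μ ν, (B.fus x y u μ ⊗ₖ (1 : Matrix (Fin (n z)) (Fin (n z)) ℂ)) * B.fus u z w ν =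
      (fusMat₃ e B x y z w d ((α_ _ _ _).inv ≫ e x y u μ ▷ S z ≫ e u z w ν)).submatrix
        (Equiv.prodAssoc _ _ _) id := by
    intro μ ν
    rw [B.fus_assoc, hF]
    simp only [Preadditive.comp_sum, Linear.comp_smul, Iso.inv_hom_id_assoc, map_sum, map_smul,
      fusMat₃_comp e B hS, fusMat_basis]
  obtain ⟨p, rfl⟩ : ∃ p : Fin (mult S x y u) → ℂ, a = ∑ μ, p μ • e x y u μ :=
    ⟨_, ((e x y u).sum_repr a).symm⟩
  obtain ⟨q, rfl⟩ : ∃ q : Fin (mult S u z w) → ℂ, b = ∑ ν, q ν • e u z w ν :=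
    ⟨_, ((e u z w).sum_repr b).symm⟩
  simp only [map_sum, map_smul, Preadditive.comp_sum, Preadditive.sum_comp, Linear.comp_smul,
    Linear.smul_comp, sum_whiskerRight, MonoidalLinear.smul_whiskerRight, sum_kronecker_one,
    Matrix.smul_kronecker, Matrix.mul_sum, Matrix.sum_mul, Matrix.mul_smul, Matrix.smul_mul,
    fusMat_basis, key]
  ext i j
  simp only [Matrix.sum_apply, Matrix.smul_apply, Matrix.submatrix_apply]

end Simple

/-! ### Tensor products of coordinate vectors -/

section ProdVec

variable {I I' I'' J J' : Type}

/-- The tensor product of two coordinate vectors. -/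
def prodVec (s : I → ℂ) (t : I' → ℂ) : I × I' → ℂ := fun p => s p.1 * t p.2

theorem prodVec_vecMul_kronecker [Fintype I] [Fintype I'] (s : I → ℂ) (t : I' → ℂ)
    (X : Matrix I J ℂ) (Y : Matrix I' J' ℂ) :
    prodVec s t ᵥ* (X ⊗ₖ Y) = prodVec (s ᵥ* X) (t ᵥ* Y) := by
  ext ⟨j, j'⟩
  simp only [prodVec, Matrix.vecMul, dotProduct, Fintype.sum_prod_type, Matrix.kroneckerMap_apply,
    Finset.sum_mul_sum]
  exact Finset.sum_congr rfl fun _ _ => Finset.sum_congr rfl fun _ _ => by ring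

theorem prodVec_vecMul_kronecker_one [Fintype I] [Fintype I'] [DecidableEq I'] (s : I → ℂ)
    (t : I' → ℂ) (X : Matrix I J ℂ) :
    prodVec s t ᵥ* (X ⊗ₖ (1 : Matrix I' I' ℂ)) = prodVec (s ᵥ* X) t := by
  rw [prodVec_vecMul_kronecker, Matrix.vecMul_one]

theorem prodVec_vecMul_one_kronecker [Fintype I] [Fintype I'] [DecidableEq I] (s : I → ℂ)
    (t : I' → ℂ) (Y : Matrix I' J' ℂ) :
    prodVec s t ᵥ* ((1 : Matrix I I ℂ) ⊗ₖ Y) = prodVec s (t ᵥ* Y) := by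
  rw [prodVec_vecMul_kronecker, Matrix.vecMul_one]

theorem prodVec_assoc_vecMul [Fintype I] [Fintype I'] [Fintype I''] (s : I → ℂ) (t : I' → ℂ)
    (r : I'' → ℂ) (X : Matrix (I × (I' × I'')) J ℂ) :
    prodVec (prodVec s t) r ᵥ* X.submatrix (Equiv.prodAssoc _ _ _) id =
      prodVec s (prodVec t r) ᵥ* X := by
  ext j
  simp only [prodVec, Matrix.vecMul, dotProduct, Fintype.sum_prod_type, Matrix.submatrix_apply,
    Equiv.prodAssoc_apply, id, mul_assoc]

theorem kronecker_one_mul_apply [Fintype I] [Fintype J] [DecidableEq J] (X : Matrix I' I ℂ)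
    (Y : Matrix (I × J) J' ℂ) (p : I') (t : J) (q : J') :
    ((X ⊗ₖ (1 : Matrix J J ℂ)) * Y) (p, t) q = ∑ s, X p s * Y (s, t) q := by
  simp [Matrix.mul_apply, Fintype.sum_prod_type, Matrix.kroneckerMap_apply, Matrix.one_apply]

end ProdVec

/-! ### Matrices of morphisms between decomposed objects -/

noncomputable section Functor

variable {C : Type u} [Category.{v} C] [Preadditive C] [Linear ℂ C] [MonoidalCategory C]
  [MonoidalPreadditive C] [MonoidalLinear ℂ C] [RigidCategory C]
  [Limits.HasFiniteBiproducts C] {ι : Type} [Fintype ι] {S : ι → C} (hS : IsFusionCategory S)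
  {n : ι → ℕ} {F : FFamily S} (e : FusionBasis S) (B : FusionTensors S F n)

/-- The index set of a basis of the vector space of a decomposed object. -/
abbrev Decomposition.Index (n : ι → ℕ) {c : C} (d : Decomposition S c) : Type :=
  Σ k : Fin d.len, Fin (n (d.idx k))

variable {c c' c'' a a' a'' : C} (d : Decomposition S c) (d' : Decomposition S c')
  (d'' : Decomposition S c'')

theorem Decomposition.sum_comp {X Y : C} (f : X ⟶ c) (g : c ⟶ Y) :
    ∑ k, (f ≫ d.proj k) ≫ d.incl k ≫ g = f ≫ g := by
  have : f ≫ g = f ≫ (∑ k, d.proj k ≫ d.incl k) ≫ g := by rw [d.total, Category.id_comp]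
  rw [this]
  simp only [Preadditive.sum_comp, Preadditive.comp_sum, Category.assoc]

theorem Decomposition.sum_index_apply {X Y : Type} (f : ∀ k, Matrix X (Fin (n (d.idx k))) ℂ)
    (g : ∀ k, Matrix (Fin (n (d.idx k))) Y ℂ) (x : X) (y : Y) :
    ∑ r : d.Index n, f r.1 x r.2 * g r.1 r.2 y = (∑ k, f k * g k) x y := by
  rw [Fintype.sum_sigma, Matrix.sum_apply]
  rfl

variable (n) in
/-- The matrix of a morphism between decomposed objects. -/
def homMat (f : c ⟶ c') : Matrix (d.Index n) (d'.Index n) ℂ :=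
  fun p q => simpleMat hS n _ _ (d.incl p.1 ≫ f ≫ d'.proj q.1) p.2 q.2

theorem homMat_id : homMat hS n d d (𝟙 c) = 1 := by
  ext ⟨k, i⟩ ⟨l, j⟩
  rw [homMat, Category.id_comp]
  by_cases h : k = l
  · subst h
    rw [d.incl_proj_self, simpleMat_id]
    simp [Matrix.one_apply]
  · rw [d.incl_proj_of_ne k l h, map_zero, Matrix.one_apply_ne]
    · rfl
    · intro hc; exact h (congrArg Sigma.fst hc)

theorem homMat_comp (f : c ⟶ c') (g : c' ⟶ c'') :
    homMat hS n d d'' (f ≫ g) = homMat hS n d d' f * homMat hS n d' d'' g := by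
  ext p q
  rw [Matrix.mul_apply]
  simp only [homMat]
  rw [d'.sum_index_apply (fun k => simpleMat hS n _ _ (d.incl p.1 ≫ f ≫ d'.proj k))
    (fun k => simpleMat hS n _ _ (d'.incl k ≫ g ≫ d''.proj q.1))]
  simp only [← simpleMat_comp, ← map_sum]
  have := d'.sum_comp (d.incl p.1 ≫ f) (g ≫ d''.proj q.1)
  simp only [Category.assoc] at this ⊢
  rw [this]

theorem homMat_add (f g : c ⟶ c') :
    homMat hS n d d' (f + g) = homMat hS n d d' f + homMat hS n d d' g := by
  ext p q
  simp [homMat]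

theorem homMat_smul (r : ℂ) (f : c ⟶ c') :
    homMat hS n d d' (r • f) = r • homMat hS n d d' f := by
  ext p q
  simp [homMat]

/-- The matrix of a morphism from a tensor product of decomposed objects. -/
def tensorMat (f : c ⊗ c' ⟶ c'') : Matrix (d.Index n × d'.Index n) (d''.Index n) ℂ :=
  fun p q => fusMat e B _ _ _ ((d.incl p.1.1 ⊗ₘ d'.incl p.2.1) ≫ f ≫ d''.proj q.1)
    (p.1.2, p.2.2) q.2

/-- The matrix of a morphism to a tensor product of decomposed objects. -/
def cotensorMat (f : c'' ⟶ c ⊗ c') : Matrix (d''.Index n) (d.Index n × d'.Index n) ℂ :=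
  fun q p => splMat hS e B _ _ _ (d''.incl q.1 ≫ f ≫ (d.proj p.1.1 ⊗ₘ d'.proj p.2.1))
    q.2 (p.1.2, p.2.2)

theorem tensorMat_mul_homMat (f : c ⊗ c' ⟶ c'') (da : Decomposition S a) (g : c'' ⟶ a) :
    tensorMat e B d d' da (f ≫ g) = tensorMat e B d d' d'' f * homMat hS n d'' da g := by
  ext p q
  rw [Matrix.mul_apply]
  simp only [homMat, tensorMat]
  rw [d''.sum_index_apply
    (fun k => fusMat e B _ _ _ ((d.incl p.1.1 ⊗ₘ d'.incl p.2.1) ≫ f ≫ d''.proj k))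
    (fun k => simpleMat hS n _ _ (d''.incl k ≫ g ≫ da.proj q.1))]
  simp only [← fusMat_comp hS, ← map_sum]
  have := d''.sum_comp ((d.incl p.1.1 ⊗ₘ d'.incl p.2.1) ≫ f) (g ≫ da.proj q.1)
  simp only [Category.assoc] at this ⊢
  rw [this]

/-- This becomes the naturality of the tensorator. Inserting the decompositions of `a` and `a'`
reduces it to tensor products of morphisms between simple objects. -/
theorem kronecker_homMat_mul_tensorMat (da : Decomposition S a) (da' : Decomposition S a')
    (f : c ⟶ a) (g : c' ⟶ a') (h : a ⊗ a' ⟶ c'') :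
    (homMat hS n d da f ⊗ₖ homMat hS n d' da' g) * tensorMat e B da da' d'' h =
      tensorMat e B d d' d'' ((f ⊗ₘ g) ≫ h) := by
  ext ⟨⟨k, i⟩, ⟨l, j⟩⟩ ⟨m, r⟩
  have h1 : (d.incl k ⊗ₘ d'.incl l) ≫ ((f ⊗ₘ g) ≫ h) ≫ d''.proj m =
      ∑ k', ∑ l', ((d.incl k ≫ f ≫ da.proj k') ⊗ₘ (d'.incl l ≫ g ≫ da'.proj l')) ≫
        (da.incl k' ⊗ₘ da'.incl l') ≫ h ≫ d''.proj m := by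
    have h2 := da.sum_comp (d.incl k ≫ f) (𝟙 _)
    have h3 := da'.sum_comp (d'.incl l ≫ g) (𝟙 _)
    simp only [Category.comp_id, Category.assoc] at h2 h3
    simp only [← Category.assoc, ← Preadditive.sum_comp, MonoidalCategory.tensorHom_comp_tensorHom,
      ← tensor_sum, ← sum_tensor]
    simp only [Category.assoc, h2, h3]
  simp only [tensorMat, h1, map_sum, fusMat_tensorHom_comp hS, Matrix.sum_apply, Matrix.mul_apply,
    Fintype.sum_prod_type, Fintype.sum_sigma, Matrix.kroneckerMap_apply, homMat]
  refine Finset.sum_congr rfl fun k' _ => ?_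
  rw [Finset.sum_comm]

theorem tensorMat_assoc (hS : IsFusionCategory S) (hF : IsFSymbols e F)
    (dl : Decomposition S (c ⊗ c')) (dr : Decomposition S (c' ⊗ c''))
    (da : Decomposition S a) (f : c ⊗ (c' ⊗ c'') ⟶ a) :
    (tensorMat e B d d' dl (𝟙 _) ⊗ₖ (1 : Matrix (d''.Index n) (d''.Index n) ℂ)) *
        tensorMat e B dl d'' da ((α_ _ _ _).hom ≫ f) =
      (((1 : Matrix (d.Index n) (d.Index n) ℂ) ⊗ₖ tensorMat e B d' d'' dr (𝟙 _)) *
        tensorMat e B d dr da f).submatrix (Equiv.prodAssoc _ _ _) id := by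
  ext ⟨⟨⟨k, i⟩, ⟨l, j⟩⟩, ⟨m, r⟩⟩ ⟨q, p⟩
  obtain ⟨ds⟩ := hS.nonempty_decomposition (S (d'.idx l) ⊗ S (d''.idx m))
  let h : S (d.idx k) ⊗ (S (d'.idx l) ⊗ S (d''.idx m)) ⟶ S (da.idx q) :=
    (d.incl k ⊗ₘ (d'.incl l ⊗ₘ d''.incl m)) ≫ f ≫ da.proj q
  -- Each entry on either side is an entry of the matrix of the same morphism `h` between simple
  -- objects: the sums over the summands of `dl` and of `dr` both collapse by `total`.
  trans fusMat₃ e B _ _ _ _ ds h (i, (j, r)) p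
  · have h1 : ∑ t, (fusMat e B _ _ _ ((d.incl k ⊗ₘ d'.incl l) ≫ dl.proj t) ⊗ₖ
        (1 : Matrix (Fin (n (d''.idx m))) (Fin (n (d''.idx m))) ℂ)) *
        fusMat e B _ _ _ ((dl.incl t ⊗ₘ d''.incl m) ≫ ((α_ _ _ _).hom ≫ f) ≫ da.proj q) =
        (fusMat₃ e B _ _ _ _ ds h).submatrix (Equiv.prodAssoc _ _ _) id := by
      simp only [kronecker_fusMat_mul_fusMat B hS hF ds]
      have h2 : h = ∑ t, (α_ _ _ _).inv ≫ ((d.incl k ⊗ₘ d'.incl l) ≫ dl.proj t) ▷ _ ≫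
          (dl.incl t ⊗ₘ d''.incl m) ≫ ((α_ _ _ _).hom ≫ f) ≫ da.proj q := by
        have h3 : ∀ t, (α_ _ _ _).inv ≫ ((d.incl k ⊗ₘ d'.incl l) ≫ dl.proj t) ▷ _ ≫
            (dl.incl t ⊗ₘ d''.incl m) ≫ ((α_ _ _ _).hom ≫ f) ≫ da.proj q =
            (α_ _ _ _).inv ≫ (((d.incl k ⊗ₘ d'.incl l) ≫ dl.proj t ≫ dl.incl t) ⊗ₘ
              d''.incl m) ≫ (α_ _ _ _).hom ≫ f ≫ da.proj q := by
          intro t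
          rw [← tensorHom_id, MonoidalCategory.tensorHom_comp_tensorHom_assoc, Category.id_comp]
          simp only [Category.assoc]
        simp only [h3, ← Preadditive.comp_sum, ← Preadditive.sum_comp, ← sum_tensor, dl.total,
          Category.comp_id]
        rw [MonoidalCategory.associator_naturality_assoc, Iso.inv_hom_id_assoc]
      rw [h2, map_sum]
      ext x y
      simp only [Matrix.sum_apply, Matrix.submatrix_apply]
    have h4 := congrFun (congrFun h1 ((i, j), r)) p
    rw [Matrix.submatrix_apply, Matrix.sum_apply] at h4
    refine Eq.trans ?_ h4
    simp only [kronecker_one_mul_apply, tensorMat, Category.id_comp]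
    rw [Fintype.sum_sigma]
  · have h1 : ∑ t, ((1 : Matrix (Fin (n (d.idx k))) (Fin (n (d.idx k))) ℂ) ⊗ₖ
        fusMat e B _ _ _ ((d'.incl l ⊗ₘ d''.incl m) ≫ dr.proj t)) *
        fusMat e B _ _ _ ((d.incl k ⊗ₘ dr.incl t) ≫ f ≫ da.proj q) =
        fusMat₃ e B _ _ _ _ ds h := by
      simp only [← fusMat₃_comp e B hS ds, ← map_sum]
      congr 1
      have h3 : ∀ t, _ ◁ ((d'.incl l ⊗ₘ d''.incl m) ≫ dr.proj t) ≫
          (d.incl k ⊗ₘ dr.incl t) ≫ f ≫ da.proj q =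
          (d.incl k ⊗ₘ ((d'.incl l ⊗ₘ d''.incl m) ≫ dr.proj t ≫ dr.incl t)) ≫
            f ≫ da.proj q := by
        intro t
        rw [← id_tensorHom, MonoidalCategory.tensorHom_comp_tensorHom_assoc, Category.id_comp]
        simp only [Category.assoc]
      simp only [h3, ← Preadditive.comp_sum, ← Preadditive.sum_comp, ← tensor_sum, dr.total,
        Category.comp_id, h]
    have h4 := congrFun (congrFun h1 (i, (j, r))) p
    rw [Matrix.sum_apply] at h4
    refine Eq.trans h4.symm ?_
    simp only [Matrix.submatrix_apply, Equiv.prodAssoc_apply, one_kronecker_mul_apply, tensorMat,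
      Category.id_comp, id]
    rw [Fintype.sum_sigma]

/-- The product of matrices to and from decomposed objects. -/
theorem tensorMat_mul_cotensorMat
    (hB : ∀ x y, ∑ t : Channel S x y, B.fus x y t.1 t.2 * B.spl x y t.1 t.2 = 1)
    (da : Decomposition S a) (da' : Decomposition S a')
    (f : c ⊗ c' ⟶ c'') (g : c'' ⟶ a ⊗ a') (f' : c ⟶ a) (g' : c' ⟶ a') (hfg : f ≫ g = f' ⊗ₘ g') :
    tensorMat e B d d' d'' f * cotensorMat hS e B da da' d'' g =
      homMat hS n d da f' ⊗ₖ homMat hS n d' da' g' := by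
  ext ⟨⟨k, i⟩, ⟨l, j⟩⟩ ⟨⟨k', i'⟩, ⟨l', j'⟩⟩
  rw [Matrix.mul_apply]
  simp only [tensorMat, cotensorMat, Matrix.kroneckerMap_apply, homMat]
  rw [d''.sum_index_apply (fun m => fusMat e B _ _ _ ((d.incl k ⊗ₘ d'.incl l) ≫ f ≫ d''.proj m))
    (fun m => splMat hS e B _ _ _ (d''.incl m ≫ g ≫ (da.proj k' ⊗ₘ da'.proj l')))]
  have := sum_fusMat_mul_splMat_tensorHom hS e B hB d'' ((d.incl k ⊗ₘ d'.incl l) ≫ f)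
    (g ≫ (da.proj k' ⊗ₘ da'.proj l')) (d.incl k ≫ f' ≫ da.proj k') (d'.incl l ≫ g' ≫ da'.proj l')
    (by
      rw [Category.assoc, reassoc_of% hfg, MonoidalCategory.tensorHom_comp_tensorHom,
        MonoidalCategory.tensorHom_comp_tensorHom])
  simp only [Category.assoc] at this ⊢
  rw [this]
  rfl

/-- Together with `tensorMat_mul_cotensorMat` this inverts the tensorator; this half uses
orthogonality of the fusion tensors, the other one completeness. -/
theorem cotensorMat_mul_tensorMat (da : Decomposition S a) (g : a ⟶ c ⊗ c') (f : c ⊗ c' ⟶ c'') :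
    cotensorMat hS e B d d' da g * tensorMat e B d d' d'' f = homMat hS n da d'' (g ≫ f) := by
  ext ⟨q, p⟩ ⟨q', p'⟩
  have h1 : da.incl q ≫ (g ≫ f) ≫ d''.proj q' = ∑ k, ∑ l,
      (da.incl q ≫ g ≫ (d.proj k ⊗ₘ d'.proj l)) ≫ (d.incl k ⊗ₘ d'.incl l) ≫ f ≫ d''.proj q' := by
    simp only [← Category.assoc, ← Preadditive.sum_comp]
    simp only [Category.assoc, MonoidalCategory.tensorHom_comp_tensorHom, ← Preadditive.comp_sum,
      ← tensor_sum, ← sum_tensor, d.total, d'.total, id_tensorHom_id, Category.comp_id]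
  simp only [homMat, h1, map_sum, ← splMat_mul_fusMat hS e B, Matrix.sum_apply, Matrix.mul_apply,
    Fintype.sum_prod_type, Fintype.sum_sigma, cotensorMat, tensorMat]
  refine Finset.sum_congr rfl fun k _ => ?_
  rw [Finset.sum_comm]

end Functor

/-! ### The functor to vector spaces and its monoidal structure -/

noncomputable section FiberFunctor

variable {C : Type u} [Category.{v} C] [Preadditive C] [Linear ℂ C] [MonoidalCategory C]
  [MonoidalPreadditive C] [MonoidalLinear ℂ C] [RigidCategory C]
  [Limits.HasFiniteBiproducts C] {ι : Type} [Fintype ι] {S : ι → C} (hS : IsFusionCategory S)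
  (n : ι → ℕ) {F : FFamily S} (e : FusionBasis S) (B : FusionTensors S F n)
  (dec : ∀ c : C, Decomposition S c)

/-- The linear equivalence given by a pair of inverse matrices. -/
def vecMulEquiv {I J : Type} [Fintype I] [Fintype J] [DecidableEq I] [DecidableEq J]
    (X : Matrix I J ℂ) (Y : Matrix J I ℂ) (hXY : X * Y = 1) (hYX : Y * X = 1) :
    (I → ℂ) ≃ₗ[ℂ] (J → ℂ) :=
  LinearEquiv.ofLinearMap X.vecMulLinear Y.vecMulLinear
    (LinearMap.ext fun s => by
      change (s ᵥ* Y) ᵥ* X = s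
      rw [Matrix.vecMul_vecMul, hYX, Matrix.vecMul_one])
    (LinearMap.ext fun s => by
      change (s ᵥ* X) ᵥ* Y = s
      rw [Matrix.vecMul_vecMul, hXY, Matrix.vecMul_one])

theorem vecMulEquiv_apply {I J : Type} [Fintype I] [Fintype J] [DecidableEq I] [DecidableEq J]
    (X : Matrix I J ℂ) (Y : Matrix J I ℂ) (hXY : X * Y = 1) (hYX : Y * X = 1) (s : I → ℂ) :
    vecMulEquiv X Y hXY hYX s = s ᵥ* X :=
  rfl

/-- The tensor product of coordinate spaces. -/
def prodVecEquiv (I J : Type) [Fintype I] [Fintype J] :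
    (I → ℂ) ⊗[ℂ] (J → ℂ) ≃ₗ[ℂ] (I × J → ℂ) :=
  ((Pi.basisFun ℂ I).tensorProduct (Pi.basisFun ℂ J)).equivFun

theorem prodVecEquiv_tmul {I J : Type} [Fintype I] [Fintype J] (s : I → ℂ) (t : J → ℂ) :
    prodVecEquiv I J (s ⊗ₜ t) = prodVec s t := by
  ext ⟨i, j⟩
  rw [prodVecEquiv, Module.Basis.equivFun_apply, Module.Basis.tensorProduct_repr_tmul_apply,
    Pi.basisFun_repr, Pi.basisFun_repr, prodVec, smul_eq_mul, mul_comm]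

/-- The vector space of an object. -/
abbrev fiberSpace (c : C) : Type := (dec c).Index n → ℂ

variable {n}

/-- The linear map of a morphism. -/
def fiberMap {c c' : C} (f : c ⟶ c') : fiberSpace n dec c →ₗ[ℂ] fiberSpace n dec c' :=
  (homMat hS n (dec c) (dec c') f).vecMulLinear

theorem fiberMap_apply {c c' : C} (f : c ⟶ c') (s : fiberSpace n dec c) :
    fiberMap hS dec f s = s ᵥ* homMat hS n (dec c) (dec c') f :=
  rfl

theorem fiberMap_id (c : C) (s : fiberSpace n dec c) : fiberMap hS dec (𝟙 c) s = s := by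
  rw [fiberMap_apply, homMat_id, Matrix.vecMul_one]

theorem fiberMap_comp {c c' c'' : C} (f : c ⟶ c') (g : c' ⟶ c'') (s : fiberSpace n dec c) :
    fiberMap hS dec (f ≫ g) s = fiberMap hS dec g (fiberMap hS dec f s) := by
  simp only [fiberMap_apply]
  rw [homMat_comp hS _ (dec c'), ← Matrix.vecMul_vecMul]

theorem fiberMap_injective {c c' : C} (f : c ⟶ c') [IsIso f] :
    Function.Injective (fiberMap hS dec f : fiberSpace n dec c → fiberSpace n dec c') := by
  intro s t h
  have := congrArg (fiberMap hS dec (inv f)) h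
  simpa only [← fiberMap_comp, IsIso.hom_inv_id, fiberMap_id] using this

/-- The functor to vector spaces. -/
def fiberFun : C ⥤ FGModuleCat.{0} ℂ where
  obj c := FGModuleCat.of ℂ (fiberSpace n dec c)
  map f := FGModuleCat.ofHom (fiberMap hS dec f)
  map_id c := FGModuleCat.hom_ext (LinearMap.ext (fiberMap_id hS dec c))
  map_comp f g := FGModuleCat.hom_ext (LinearMap.ext (fiberMap_comp hS dec f g))

/-- The tensorator on vectors. -/
def fiberMul {c c' : C} (s : fiberSpace n dec c) (t : fiberSpace n dec c') :
    fiberSpace n dec (c ⊗ c') :=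
  prodVec s t ᵥ* tensorMat e B (dec c) (dec c') (dec (c ⊗ c')) (𝟙 _)

theorem fiberMap_fiberMul {c c' : C} (s : fiberSpace n dec c) (t : fiberSpace n dec c') {d : C}
    (f : c ⊗ c' ⟶ d) : fiberMap hS dec f (fiberMul e B dec s t) =
      prodVec s t ᵥ* tensorMat e B (dec c) (dec c') (dec d) f := by
  rw [fiberMap_apply, fiberMul, Matrix.vecMul_vecMul, ← tensorMat_mul_homMat, Category.id_comp]

theorem fiberMul_natural {c c' d d' : C} (f : c ⟶ d) (g : c' ⟶ d') (s : fiberSpace n dec c)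
    (t : fiberSpace n dec c') :
    fiberMul e B dec (fiberMap hS dec f s) (fiberMap hS dec g t) =
      fiberMap hS dec (f ⊗ₘ g) (fiberMul e B dec s t) := by
  rw [fiberMap_fiberMul, fiberMul, fiberMap_apply, fiberMap_apply, ← prodVec_vecMul_kronecker,
    Matrix.vecMul_vecMul, kronecker_homMat_mul_tensorMat, Category.comp_id]

theorem fiberMul_whiskerRight {c c' d : C} (f : c ⟶ d) (s : fiberSpace n dec c)
    (t : fiberSpace n dec c') : fiberMul e B dec (fiberMap hS dec f s) t =
      fiberMap hS dec (f ▷ c') (fiberMul e B dec s t) := by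
  rw [← tensorHom_id, ← fiberMul_natural, fiberMap_id]

theorem fiberMul_whiskerLeft {c c' d : C} (f : c' ⟶ d) (s : fiberSpace n dec c)
    (t : fiberSpace n dec c') : fiberMul e B dec s (fiberMap hS dec f t) =
      fiberMap hS dec (c ◁ f) (fiberMul e B dec s t) := by
  rw [← id_tensorHom, ← fiberMul_natural, fiberMap_id]

variable {e} in
theorem fiberMul_assoc (hF : IsFSymbols e F) {c c' c'' : C} (s : fiberSpace n dec c)
    (t : fiberSpace n dec c') (r : fiberSpace n dec c'') :
    fiberMap hS dec (α_ c c' c'').hom (fiberMul e B dec (fiberMul e B dec s t) r) =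
      fiberMul e B dec s (fiberMul e B dec t r) := by
  rw [fiberMap_fiberMul]
  conv_lhs => rw [fiberMul, ← prodVec_vecMul_kronecker_one, Matrix.vecMul_vecMul]
  have := tensorMat_assoc e B (dec c) (dec c') (dec c'') hS hF (dec (c ⊗ c')) (dec (c' ⊗ c''))
    (dec (c ⊗ (c' ⊗ c''))) (𝟙 _)
  rw [Category.comp_id] at this
  rw [this, prodVec_assoc_vecMul, ← Matrix.vecMul_vecMul, prodVec_vecMul_one_kronecker]
  rfl

theorem fiberMul_smul_left {c c' : C} (r : ℂ) (s : fiberSpace n dec c)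
    (t : fiberSpace n dec c') : fiberMul e B dec (r • s) t = r • fiberMul e B dec s t := by
  rw [fiberMul, fiberMul, ← Matrix.smul_vecMul]
  congr 1
  ext p
  simp [prodVec, mul_assoc]

theorem fiberMul_smul_right {c c' : C} (r : ℂ) (s : fiberSpace n dec c)
    (t : fiberSpace n dec c') : fiberMul e B dec s (r • t) = r • fiberMul e B dec s t := by
  rw [fiberMul, fiberMul, ← Matrix.smul_vecMul]
  congr 1
  ext p
  simp [prodVec, mul_left_comm]

/-- The tensorator. -/
def fiberMulEquiv
    (hB : ∀ x y, ∑ t : Channel S x y, B.fus x y t.1 t.2 * B.spl x y t.1 t.2 = 1)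
    (c c' : C) : fiberSpace n dec c ⊗[ℂ] fiberSpace n dec c' ≃ₗ[ℂ]
    fiberSpace n dec (c ⊗ c') :=
  (prodVecEquiv _ _).trans <| vecMulEquiv
    (tensorMat e B (dec c) (dec c') (dec (c ⊗ c')) (𝟙 _))
    (cotensorMat hS e B (dec c) (dec c') (dec (c ⊗ c')) (𝟙 _))
    (by
      rw [tensorMat_mul_cotensorMat hS e B (dec c) (dec c') (dec (c ⊗ c')) hB (dec c) (dec c')
        (𝟙 _) (𝟙 _) (𝟙 _) (𝟙 _) (by simp), homMat_id, homMat_id, Matrix.one_kronecker_one])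
    (by rw [cotensorMat_mul_tensorMat, Category.comp_id, homMat_id])

theorem fiberMulEquiv_tmul
    (hB : ∀ x y, ∑ t : Channel S x y, B.fus x y t.1 t.2 * B.spl x y t.1 t.2 = 1)
    (c c' : C) (s : fiberSpace n dec c) (t : fiberSpace n dec c') :
    fiberMulEquiv hS e B dec hB c c' (s ⊗ₜ t) = fiberMul e B dec s t := by
  rw [fiberMulEquiv, LinearEquiv.trans_apply, prodVecEquiv_tmul, vecMulEquiv_apply]
  rfl

theorem prodVec_eq_zero_of_fiberMul (hS : IsFusionCategory S)
    (hB : ∀ x y, ∑ t : Channel S x y, B.fus x y t.1 t.2 * B.spl x y t.1 t.2 = 1)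
    {c c' : C} {s : fiberSpace n dec c}
    {t : fiberSpace n dec c'} (h : fiberMul e B dec s t = 0) : prodVec s t = 0 := by
  rw [← fiberMulEquiv_tmul hS e B dec hB, LinearEquiv.map_eq_zero_iff] at h
  rw [← prodVecEquiv_tmul, h, map_zero]

/-- The tensorator and the unitor give `N * N = N`, and `N ≠ 0` because the unit object has a
summand, its identity being nonzero, and each summand contributes a space of positive dimension. -/
theorem card_index_unit (hS : IsFusionCategory S) (e : FusionBasis S)
    (B : FusionTensors S F n)
    (hB : ∀ x y, ∑ t : Channel S x y, B.fus x y t.1 t.2 * B.spl x y t.1 t.2 = 1)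
    (n_pos : ∀ x, 0 < n x) : Fintype.card ((dec (𝟙_ C)).Index n) = 1 := by
  set N := Fintype.card ((dec (𝟙_ C)).Index n) with hN
  have h1 : N * N = N := by
    have e1 := (fiberMulEquiv hS e B dec hB (𝟙_ C) (𝟙_ C)).finrank_eq
    have e2 : Module.finrank ℂ (fiberSpace n dec (𝟙_ C ⊗ 𝟙_ C)) =
        Module.finrank ℂ (fiberSpace n dec (𝟙_ C)) := by
      apply le_antisymm
      · exact LinearMap.finrank_le_finrank_of_injective
          (fiberMap_injective (n := n) hS dec (λ_ (𝟙_ C)).hom)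
      · exact LinearMap.finrank_le_finrank_of_injective
          (fiberMap_injective (n := n) hS dec (λ_ (𝟙_ C)).inv)
    rw [e2, Module.finrank_tensorProduct, Module.finrank_fintype_fun_eq_card] at e1
    exact e1
  have h2 : N ≠ 0 := by
    intro h0
    have hlen : IsEmpty (Fin (dec (𝟙_ C)).len) := by
      refine ⟨fun k => ?_⟩
      rw [hN, Fintype.card_eq_zero_iff] at h0
      exact h0.elim ⟨k, ⟨0, n_pos _⟩⟩
    have hid : 𝟙 (𝟙_ C) = 0 := by
      rw [← (dec (𝟙_ C)).total, Fintype.sum_empty]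
    have h3 := hS.end_unit
    have : Subsingleton (𝟙_ C ⟶ 𝟙_ C) := ⟨fun f g => by
      rw [← Category.comp_id f, ← Category.comp_id g, hid, Limits.comp_zero, Limits.comp_zero]⟩
    rw [Module.finrank_zero_of_subsingleton] at h3
    exact zero_ne_one h3
  exact Nat.eq_of_mul_eq_mul_left (Nat.pos_of_ne_zero h2) (by rw [h1, mul_one])

/-- The one-dimensional space of the unit object contains a unit vector for the tensorator. -/
theorem exists_unit
    (hB : ∀ x y, ∑ t : Channel S x y, B.fus x y t.1 t.2 * B.spl x y t.1 t.2 = 1)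
    (hF : IsFSymbols e F) (n_pos : ∀ x, 0 < n x) :
    ∃ u : fiberSpace n dec (𝟙_ C), u ≠ 0 ∧
      (∀ (c : C) (s : fiberSpace n dec c),
        fiberMap hS dec (λ_ c).hom (fiberMul e B dec u s) = s) ∧
      ∀ (c : C) (s : fiberSpace n dec c),
        fiberMap hS dec (ρ_ c).hom (fiberMul e B dec s u) = s := by
  have hcard := card_index_unit dec hS e B hB n_pos
  obtain ⟨p₀, hp₀⟩ := Fintype.card_eq_one_iff.1 hcard
  -- In a one-dimensional space the product `w` of `v₀` with itself is a nonzero multiple of `v₀`;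
  -- rescaling by the inverse factor gives `u` with `u · u = u`.
  let v₀ : fiberSpace n dec (𝟙_ C) := fun _ => 1
  set w := fiberMap hS dec (λ_ (𝟙_ C)).hom (fiberMul e B dec v₀ v₀) with hw
  have hwv : w = w p₀ • v₀ := by
    ext p
    rw [hp₀ p]
    simp [v₀]
  have hw0 : w p₀ ≠ 0 := by
    intro h0
    rw [h0, zero_smul, hw, ← map_zero (fiberMap hS dec (λ_ (𝟙_ C)).hom)] at hwv
    have h1 := prodVec_eq_zero_of_fiberMul e B dec hS hB (fiberMap_injective hS dec _ hwv)
    simpa [prodVec, v₀] using congrFun h1 (p₀, p₀)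
  let u : fiberSpace n dec (𝟙_ C) := (w p₀)⁻¹ • v₀
  have hup : ∀ p, u p ≠ 0 := fun p => by simpa [u, v₀] using hw0
  have huu : fiberMap hS dec (λ_ (𝟙_ C)).hom (fiberMul e B dec u u) = u := by
    rw [fiberMul_smul_left, fiberMul_smul_right, map_smul, map_smul, ← hw, hwv, smul_smul,
      smul_smul]
    simp [u, show v₀ p₀ = 1 from rfl, hw0]
  have hu0 : u ≠ 0 := fun h => hup p₀ (congrFun h p₀)
  have hinjL : ∀ {c : C} (s : fiberSpace n dec c), fiberMul e B dec u s = 0 → s = 0 := by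
    intro c s hs
    have h1 := prodVec_eq_zero_of_fiberMul e B dec hS hB hs
    ext q
    exact (mul_eq_zero.1 (congrFun h1 (p₀, q))).resolve_left (hup p₀)
  have hinjR : ∀ {c : C} (s : fiberSpace n dec c), fiberMul e B dec s u = 0 → s = 0 := by
    intro c s hs
    have h1 := prodVec_eq_zero_of_fiberMul e B dec hS hB hs
    ext q
    exact (mul_eq_zero.1 (congrFun h1 (q, p₀))).resolve_right (hup p₀)
  have hsubL : ∀ {c c' : C} (s : fiberSpace n dec c) (t t' : fiberSpace n dec c'),
      fiberMul e B dec s (t - t') = fiberMul e B dec s t - fiberMul e B dec s t' := by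
    intro c c' s t t'
    rw [← fiberMulEquiv_tmul hS e B dec hB, TensorProduct.tmul_sub, map_sub, fiberMulEquiv_tmul,
      fiberMulEquiv_tmul]
  have hsubR : ∀ {c c' : C} (s s' : fiberSpace n dec c) (t : fiberSpace n dec c'),
      fiberMul e B dec (s - s') t = fiberMul e B dec s t - fiberMul e B dec s' t := by
    intro c c' s s' t
    rw [← fiberMulEquiv_tmul hS e B dec hB, TensorProduct.sub_tmul, map_sub, fiberMulEquiv_tmul,
      fiberMulEquiv_tmul]
  refine ⟨u, hu0, fun c s => ?_, fun c s => ?_⟩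
  -- For `T s = λ (u · s)`, associativity, the triangle identity and `u · u = u` give `T (T s) = T
  -- s`. Since `λ` and multiplication by `u` are injective, `T s = s`. The right-hand case is
  -- parallel.
  · have hidem : fiberMap hS dec (λ_ c).hom (fiberMul e B dec u
        (fiberMap hS dec (λ_ c).hom (fiberMul e B dec u s))) =
        fiberMap hS dec (λ_ c).hom (fiberMul e B dec u s) := by
      rw [fiberMul_whiskerLeft, ← fiberMul_assoc hS B dec hF,
        ← fiberMap_comp hS dec (α_ _ _ _).hom, triangle,
        ← unitors_equal, ← fiberMul_whiskerRight, huu]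
    have h0 := fiberMap_injective hS dec _ hidem
    rw [← sub_eq_zero, ← hsubL] at h0
    exact sub_eq_zero.1 (hinjL _ h0)
  · have hidem : fiberMap hS dec (ρ_ c).hom (fiberMul e B dec
        (fiberMap hS dec (ρ_ c).hom (fiberMul e B dec s u)) u) =
        fiberMap hS dec (ρ_ c).hom (fiberMul e B dec s u) := by
      rw [fiberMul_whiskerRight, ← triangle, fiberMap_comp, fiberMul_assoc hS B dec hF,
        ← fiberMul_whiskerLeft, huu]
    have h0 := fiberMap_injective hS dec _ hidem
    rw [← sub_eq_zero, ← hsubR] at h0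
    exact sub_eq_zero.1 (hinjR _ h0)

/-- The unit isomorphism spanned by a unit vector. -/
theorem exists_unitEquiv
    (hB : ∀ x y, ∑ t : Channel S x y, B.fus x y t.1 t.2 * B.spl x y t.1 t.2 = 1)
    (hF : IsFSymbols e F) (n_pos : ∀ x, 0 < n x) :
    ∃ ε : ℂ ≃ₗ[ℂ] fiberSpace n dec (𝟙_ C),
      (∀ (c : C) (s : fiberSpace n dec c),
        fiberMap hS dec (λ_ c).hom (fiberMul e B dec (ε 1) s) = s) ∧
      ∀ (c : C) (s : fiberSpace n dec c),
        fiberMap hS dec (ρ_ c).hom (fiberMul e B dec s (ε 1)) = s := by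
  obtain ⟨u, hu0, hl, hr⟩ := exists_unit hS e B dec hB hF n_pos
  have hf : Module.finrank ℂ (fiberSpace n dec (𝟙_ C)) = 1 := by
    rw [Module.finrank_fintype_fun_eq_card, card_index_unit dec hS e B hB n_pos]
  have hinj : Function.Injective (LinearMap.toSpanSingleton ℂ (fiberSpace n dec (𝟙_ C)) u) :=
    LinearMap.ker_eq_bot.1 (LinearMap.ker_toSpanSingleton _ hu0)
  have hε : LinearEquiv.ofInjectiveOfFinrankEq _ hinj (by rw [hf, Module.finrank_self]) 1 = u :=
    one_smul ℂ u
  refine ⟨LinearEquiv.ofInjectiveOfFinrankEq _ hinj (by rw [hf, Module.finrank_self]), ?_, ?_⟩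
  · intro c s
    rw [hε, hl]
  · intro c s
    rw [hε, hr]

/-- The monoidal structure. -/
def fiberCoreMonoidal
    (hB : ∀ x y, ∑ t : Channel S x y, B.fus x y t.1 t.2 * B.spl x y t.1 t.2 = 1)
    (hF : IsFSymbols e F) (n_pos : ∀ x, 0 < n x) :
    (fiberFun (n := n) hS dec).CoreMonoidal where
  εIso := (exists_unitEquiv hS e B dec hB hF n_pos).choose.toFGModuleCatIso
  μIso c c' := (fiberMulEquiv hS e B dec hB c c').toFGModuleCatIso
  μIso_hom_natural_left f c' := by
    apply FGModuleCat.hom_ext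
    refine TensorProduct.ext' fun (s : fiberSpace n dec _) (t : fiberSpace n dec _) => ?_
    have := fiberMul_whiskerRight hS e B dec f s t
    rw [← fiberMulEquiv_tmul hS e B dec hB, ← fiberMulEquiv_tmul hS e B dec hB] at this
    exact this
  μIso_hom_natural_right c f := by
    apply FGModuleCat.hom_ext
    refine TensorProduct.ext' fun (s : fiberSpace n dec _) (t : fiberSpace n dec _) => ?_
    have := fiberMul_whiskerLeft hS e B dec f s t
    rw [← fiberMulEquiv_tmul hS e B dec hB, ← fiberMulEquiv_tmul hS e B dec hB] at this
    exact this
  associativity c c' c'' := by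
    apply FGModuleCat.hom_ext
    refine TensorProduct.ext_threefold fun (s : fiberSpace n dec _) (t : fiberSpace n dec _)
      (r : fiberSpace n dec _) => ?_
    have := fiberMul_assoc hS B dec hF s t r
    simp only [← fiberMulEquiv_tmul hS e B dec hB] at this
    exact this
  left_unitality c := by
    apply FGModuleCat.hom_ext
    refine TensorProduct.ext' fun (r : ℂ) (s : fiberSpace n dec _) => ?_
    -- The scalar is moved to the other factor, `ε r ⊗ s = ε 1 ⊗ r • s`, so the unit law at `ε 1` is
    -- enough.
    have h := (exists_unitEquiv hS e B dec hB hF n_pos).choose_spec.1 c (r • s)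
    rw [← fiberMulEquiv_tmul hS e B dec hB, ← TensorProduct.smul_tmul, ← map_smul,
      smul_eq_mul, mul_one] at h
    exact h.symm
  right_unitality c := by
    apply FGModuleCat.hom_ext
    refine TensorProduct.ext' fun (s : fiberSpace n dec _) (r : ℂ) => ?_
    have h := (exists_unitEquiv hS e B dec hB hF n_pos).choose_spec.2 c (r • s)
    rw [← fiberMulEquiv_tmul hS e B dec hB, TensorProduct.smul_tmul, ← map_smul, smul_eq_mul,
      mul_one] at h
    exact h.symm

/-- The fiber functor. -/
def fiberFunctor
    (hB : ∀ x y, ∑ t : Channel S x y, B.fus x y t.1 t.2 * B.spl x y t.1 t.2 = 1)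
    (hF : IsFSymbols e F) (n_pos : ∀ x, 0 < n x) : FiberFunctor C where
  F := fiberFun (n := n) hS dec
  additive := ⟨fun {c c'} {f g} => FGModuleCat.hom_ext <| LinearMap.ext
    fun (s : fiberSpace n dec c) => by
    change fiberMap hS dec (f + g) s = fiberMap hS dec f s + fiberMap hS dec g s
    simp only [fiberMap_apply, homMat_add, Matrix.vecMul_add]⟩
  linear := ⟨fun {c c'} f r => FGModuleCat.hom_ext <| LinearMap.ext
    fun (s : fiberSpace n dec c) => by
    change fiberMap hS dec (r • f) s = r • fiberMap hS dec f s
    simp only [fiberMap_apply, homMat_smul, Matrix.vecMul_smul]⟩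
  monoidal := (fiberCoreMonoidal hS e B dec hB hF n_pos).toMonoidal

theorem fiberFunctor_tensorator
    (hB : ∀ x y, ∑ t : Channel S x y, B.fus x y t.1 t.2 * B.spl x y t.1 t.2 = 1)
    (hF : IsFSymbols e F) (n_pos : ∀ x, 0 < n x) (c c' : C)
    (s : fiberSpace n dec c) (t : fiberSpace n dec c') :
    (fiberFunctor hS e B dec hB hF n_pos).tensorator c c' s t = fiberMul e B dec s t :=
  fiberMulEquiv_tmul hS e B dec hB c c' s t

end FiberFunctor

/-! ### Fixed points as combinations of rows of action tensors -/

section Combination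

variable {D : ℕ} {K K' M N : Type} [Fintype K]

/-- Linear combinations of the rows of an action tensor. -/
def leftComb (φ : Matrix (K × Fin D) (M × Fin D) ℂ) (w : K → ℂ) : (Fin D × M) × Fin D → ℂ :=
  ∑ k, w k • leftVec φ k

theorem leftComb_apply (φ : Matrix (K × Fin D) (M × Fin D) ℂ) (w : K → ℂ)
    (s : (Fin D × M) × Fin D) : leftComb φ w s = ∑ k, w k * φ (k, s.1.1) (s.1.2, s.2) := by
  simp [leftComb, leftVec, Finset.sum_apply]

theorem glue_leftComb [Fintype K'] (φ : Matrix (K × Fin D) (M × Fin D) ℂ)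
    (ψ : Matrix (K' × Fin D) (N × Fin D) ℂ) (w : K → ℂ) (w' : K' → ℂ) :
    glue (leftComb φ w) (leftComb ψ w') = leftComb (mulAction φ ψ) (prodVec w w') := by
  simp only [leftComb, Fintype.sum_prod_type, prodVec, ← glue_leftVec, ← glueMap_apply, map_sum,
    map_smul, LinearMap.sum_apply, LinearMap.smul_apply, Finset.smul_sum, smul_smul]
  rw [Finset.sum_comm]
  simp only [mul_comm]

theorem actOnBond_leftComb [Fintype M] (φ : Matrix (K × Fin D) (M × Fin D) ℂ) (X : Matrix M N ℂ)
    (w : K → ℂ) : actOnBond (leftComb φ w) X = leftComb (φ * onBond D X) w := by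
  ext s
  simp only [actOnBond, leftComb_apply, mul_onBond_apply, Finset.sum_mul, Finset.mul_sum]
  rw [Finset.sum_comm]
  simp only [mul_assoc]

theorem leftComb_onBond_mul [Fintype K'] (X : Matrix K' K ℂ)
    (φ : Matrix (K × Fin D) (M × Fin D) ℂ) (w : K' → ℂ) :
    leftComb (onBond D X * φ) w = leftComb φ (w ᵥ* X) := by
  ext s
  simp only [leftComb_apply, onBond_mul_apply, Matrix.vecMul, dotProduct, Finset.sum_mul,
    Finset.mul_sum]
  rw [Finset.sum_comm]
  simp only [mul_assoc]

end Combination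

/-! ### Coordinates of the functor on simple objects and their products -/

noncomputable section Coordinates

variable {C : Type u} [Category.{v} C] [Preadditive C] [Linear ℂ C] [MonoidalCategory C]
  [MonoidalPreadditive C] [MonoidalLinear ℂ C] [RigidCategory C]
  [Limits.HasFiniteBiproducts C] {ι : Type} [Fintype ι] {S : ι → C} (hS : IsFusionCategory S)
  {n : ι → ℕ} {F : FFamily S} (e : FusionBasis S) (B : FusionTensors S F n)
  (dec : ∀ c : C, Decomposition S c)

variable (S) in
/-- The decomposition of a simple object. -/
def Decomposition.simple (x : ι) : Decomposition S (S x) where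
  len := 1
  idx _ := x
  incl _ := 𝟙 _
  proj _ := 𝟙 _
  incl_proj_self _ := Category.comp_id _
  incl_proj_of_ne k l h := (h (Subsingleton.elim k l)).elim
  total := by simp

variable (S n) in
/-- The index set of a simple object. -/
def Decomposition.simpleIndex (x : ι) : Fin (n x) ≃ (Decomposition.simple S x).Index n :=
  (Equiv.uniqueSigma fun _ : Fin 1 => Fin (n x)).symm

theorem tensorMat_simple (x y z : ι) (μ : Fin (mult S x y z)) (i : Fin (n x)) (j : Fin (n y))
    (k : Fin (n z)) :
    tensorMat e B (.simple S x) (.simple S y) (.simple S z) (e x y z μ)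
      (Decomposition.simpleIndex S n x i, Decomposition.simpleIndex S n y j)
      (Decomposition.simpleIndex S n z k) = B.fus x y z μ (i, j) k := by
  rw [← fusMat_basis e B]
  change fusMat e B x y z ((𝟙 (S x) ⊗ₘ 𝟙 (S y)) ≫ e x y z μ ≫ 𝟙 (S z)) (i, j) k = _
  rw [id_tensorHom_id, Category.id_comp, Category.comp_id]

/-- The vector space of a simple object `x` is `ℂ ^ n x`. -/
def simpleCoord (x : ι) : fiberSpace n dec (S x) ≃ₗ[ℂ] (Fin (n x) → ℂ) :=
  -- The decomposition chosen for `S x` need not be the trivial one; the matrices of the identity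
  -- between the two translate.
  (vecMulEquiv (homMat hS n (dec (S x)) (.simple S x) (𝟙 _))
    (homMat hS n (.simple S x) (dec (S x)) (𝟙 _))
    (by rw [← homMat_comp, Category.comp_id, homMat_id])
    (by rw [← homMat_comp, Category.comp_id, homMat_id])).trans
  (LinearEquiv.funCongrLeft ℂ ℂ (Decomposition.simpleIndex S n x))

theorem simpleCoord_apply (x : ι) (s : fiberSpace n dec (S x)) (i : Fin (n x)) :
    simpleCoord hS dec x s i = (s ᵥ* homMat hS n (dec (S x)) (.simple S x) (𝟙 _))
      (Decomposition.simpleIndex S n x i) :=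
  rfl

/-- The vector space of a product of simple objects. -/
def simpleCoord₂
    (hB : ∀ x y, ∑ t : Channel S x y, B.fus x y t.1 t.2 * B.spl x y t.1 t.2 = 1) (x y : ι) :
    fiberSpace n dec (S x ⊗ S y) ≃ₗ[ℂ] (Fin (n x) × Fin (n y) → ℂ) :=
  (vecMulEquiv (cotensorMat hS e B (.simple S x) (.simple S y) (dec (S x ⊗ S y)) (𝟙 _))
    (tensorMat e B (.simple S x) (.simple S y) (dec (S x ⊗ S y)) (𝟙 _))
    (by rw [cotensorMat_mul_tensorMat, Category.comp_id, homMat_id])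
    (by
      rw [tensorMat_mul_cotensorMat hS e B _ _ _ hB _ _ _ _ (𝟙 _) (𝟙 _) (by simp), homMat_id,
        homMat_id, Matrix.one_kronecker_one])).trans
  (LinearEquiv.funCongrLeft ℂ ℂ
    ((Decomposition.simpleIndex S n x).prodCongr (Decomposition.simpleIndex S n y)))

theorem simpleCoord₂_apply
    (hB : ∀ x y, ∑ t : Channel S x y, B.fus x y t.1 t.2 * B.spl x y t.1 t.2 = 1) (x y : ι)
    (r : fiberSpace n dec (S x ⊗ S y)) (p : Fin (n x) × Fin (n y)) :
    simpleCoord₂ hS e B dec hB x y r p =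
      (r ᵥ* cotensorMat hS e B (.simple S x) (.simple S y) (dec (S x ⊗ S y)) (𝟙 _))
        (Decomposition.simpleIndex S n x p.1, Decomposition.simpleIndex S n y p.2) :=
  rfl

/-- The coordinates on `S x ⊗ S y` are defined through the inverse of the tensorator, which makes
the tensorator the plain product of coordinate vectors. -/
theorem simpleCoord₂_fiberMul
    (hB : ∀ x y, ∑ t : Channel S x y, B.fus x y t.1 t.2 * B.spl x y t.1 t.2 = 1) (x y : ι)
    (s : fiberSpace n dec (S x)) (t : fiberSpace n dec (S y)) :
    simpleCoord₂ hS e B dec hB x y (fiberMul e B dec s t) =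
      prodVec (simpleCoord hS dec x s) (simpleCoord hS dec y t) := by
  ext p
  rw [simpleCoord₂_apply, fiberMul, Matrix.vecMul_vecMul,
    tensorMat_mul_cotensorMat hS e B _ _ _ hB _ _ _ _ (𝟙 _) (𝟙 _) (by simp),
    prodVec_vecMul_kronecker]
  rfl

/-- In the same coordinates the basis morphisms act by the fusion tensors, so the data of `B` are
all carried by the functor on morphisms. -/
theorem simpleCoord_fiberMap
    (hB : ∀ x y, ∑ t : Channel S x y, B.fus x y t.1 t.2 * B.spl x y t.1 t.2 = 1) (x y z : ι)
    (μ : Fin (mult S x y z)) (r : fiberSpace n dec (S x ⊗ S y)) :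
    simpleCoord hS dec z (fiberMap hS dec (e x y z μ) r) =
      simpleCoord₂ hS e B dec hB x y r ᵥ* B.fus x y z μ := by
  ext k
  have h : homMat hS n (dec (S x ⊗ S y)) (dec (S z)) (e x y z μ) *
      homMat hS n (dec (S z)) (.simple S z) (𝟙 _) =
      cotensorMat hS e B (.simple S x) (.simple S y) (dec (S x ⊗ S y)) (𝟙 _) *
        tensorMat e B (.simple S x) (.simple S y) (.simple S z) (e x y z μ) := by
    rw [cotensorMat_mul_tensorMat, ← homMat_comp, Category.comp_id, Category.id_comp]
  rw [simpleCoord_apply, fiberMap_apply, Matrix.vecMul_vecMul, h, ← Matrix.vecMul_vecMul]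
  simp only [Matrix.vecMul, dotProduct]
  rw [← Equiv.sum_comp
    ((Decomposition.simpleIndex S n x).prodCongr (Decomposition.simpleIndex S n y))]
  refine Finset.sum_congr rfl fun p _ => ?_
  rw [← tensorMat_simple e B]
  rfl

end Coordinates

namespace Symmetry

/-! ### The non-abelian factor system and the values of closed diagrams -/

section Cocycle

variable {C : Type u} [Category.{v} C] [Preadditive C] [Linear ℂ C] [MonoidalCategory C]
variable {ι : Type} [Fintype ι] {S : ι → C} {F : FFamily S}
variable {P : Type} [Fintype P] {D : ℕ}
variable {R : MPORep S F P} {A : P → Matrix (Fin D) (Fin D) ℂ} {Φ : Symmetry R A}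
  {Λ : Fin D × Fin D → ℂ} {B : FusionTensors S F Φ.n}

/-- `mulAction` and `act₂` are action tensors of the same MPO tensor; existence is their comparison,
uniqueness is cancellation. The threefold versions follow the same pattern. -/
theorem existsUnique_isOmega (B : FusionTensors S F Φ.n) (hA : IsInjective A)
    (hcan : IsLeftCanonical A) (hΛ : IsNormalizedRightFixed A Λ) : ∃! Ω, Φ.IsOmega B Ω := by
  choose Ω hΩ using fun x y => (Φ.isAction_mulAction x y).exists_eq_onBond_mul
    (Φ.isAction₂ B hA hcan hΛ x y) hA hcan hΛ
  refine ⟨Ω, hΩ, fun Ω' hΩ' => ?_⟩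
  funext x y
  exact (Φ.isAction₂ B hA hcan hΛ x y).eq_of_onBond_mul_eq hΛ.pos
    ((hΩ' x y).symm.trans (hΩ x y))

theorem existsUnique_isOmegaLeft (B : FusionTensors S F Φ.n) (hA : IsInjective A)
    (hcan : IsLeftCanonical A) (hΛ : IsNormalizedRightFixed A Λ) :
    ∃! Ω, Φ.IsOmegaLeft B Ω := by
  choose i hi using fun x y z => Φ.exists_isActionLeft B hA hcan hΛ x y z
  choose Ω hΩ using fun x y z => ((Φ.isAction₂ B hA hcan hΛ x y).mulAction
    (Φ.isAction z)).exists_eq_onBond_mul (hi x y z) hA hcan hΛ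
  refine ⟨Ω, hΩ, fun Ω' hΩ' => ?_⟩
  funext x y z
  exact (hi x y z).eq_of_onBond_mul_eq hΛ.pos ((hΩ' x y z).symm.trans (hΩ x y z))

theorem existsUnique_isOmegaRight (B : FusionTensors S F Φ.n) (hA : IsInjective A)
    (hcan : IsLeftCanonical A) (hΛ : IsNormalizedRightFixed A Λ) :
    ∃! Ω, Φ.IsOmegaRight B Ω := by
  choose i hi using fun x y z => Φ.exists_isActionRight B hA hcan hΛ x y z
  choose Ω hΩ using fun x y z => ((Φ.isAction x).mulAction
    (Φ.isAction₂ B hA hcan hΛ y z)).exists_eq_onBond_mul (hi x y z) hA hcan hΛ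
  refine ⟨Ω, hΩ, fun Ω' hΩ' => ?_⟩
  funext x y z
  exact (hi x y z).eq_of_onBond_mul_eq hΛ.pos ((hΩ' x y z).symm.trans (hΩ x y z))

theorem IsOmega.isUnit {Ω} (h : Φ.IsOmega B Ω) (hA : IsInjective A)
    (hcan : IsLeftCanonical A) (hΛ : IsNormalizedRightFixed A Λ) (x y : ι) : IsUnit (Ω x y) :=
  (Φ.isAction_mulAction x y).isUnit (Φ.isAction₂ B hA hcan hΛ x y) hA hcan hΛ (h x y)

theorem IsOmegaLeft.isUnit {Ω} (h : Φ.IsOmegaLeft B Ω) (hA : IsInjective A)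
    (hcan : IsLeftCanonical A) (hΛ : IsNormalizedRightFixed A Λ) (x y z : ι) :
    IsUnit (Ω x y z) := by
  obtain ⟨i, hi⟩ := Φ.exists_isActionLeft B hA hcan hΛ x y z
  exact ((Φ.isAction₂ B hA hcan hΛ x y).mulAction (Φ.isAction z)).isUnit hi hA hcan hΛ (h x y z)

theorem IsOmegaRight.isUnit {Ω} (h : Φ.IsOmegaRight B Ω) (hA : IsInjective A)
    (hcan : IsLeftCanonical A) (hΛ : IsNormalizedRightFixed A Λ) (x y z : ι) :
    IsUnit (Ω x y z) := by
  obtain ⟨i, hi⟩ := Φ.exists_isActionRight B hA hcan hΛ x y z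
  exact ((Φ.isAction x).mulAction (Φ.isAction₂ B hA hcan hΛ y z)).isUnit hi hA hcan hΛ (h x y z)

/-- The non-abelian cocycle condition. -/
theorem IsOmega.cocycle {Ω Ωl Ωr} (h : Φ.IsOmega B Ω) (hl : Φ.IsOmegaLeft B Ωl)
    (hr : Φ.IsOmegaRight B Ωr) (hA : IsInjective A)
    (hcan : IsLeftCanonical A) (hΛ : IsNormalizedRightFixed A Λ) (x y z : ι) :
    (Ω x y ⊗ₖ (1 : Matrix (Fin (Φ.n z)) (Fin (Φ.n z)) ℂ)) * Ωl x y z =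
      (((1 : Matrix (Fin (Φ.n x)) (Fin (Φ.n x)) ℂ) ⊗ₖ Ω y z) * Ωr x y z).submatrix
        (Equiv.prodAssoc _ _ _) (Equiv.prodAssoc _ _ _) := by
  obtain ⟨i, hi⟩ := Φ.exists_isActionLeft B hA hcan hΛ x y z
  -- Multiplied by `φ̂_{(x ⊗ y) ⊗ z}`, both sides become `φ̂_x φ̂_y φ̂_z`: the left side directly,
  -- the right side because `mulAction` is associative and the two threefold action tensors agree.
  refine hi.eq_of_onBond_mul_eq hΛ.pos ?_
  rw [onBond_mul, Matrix.mul_assoc, ← hl x y z, ← mulAction_onBond_mul, ← h x y,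
    mulAction_assoc, h y z, mulAction_onBond_mul_right, hr x y z, ← Matrix.mul_assoc,
    ← onBond_mul, onBond_submatrix, Φ.actLeft_eq_actRight, submatrix_prodAssoc_mul]

theorem IsOmega.mulAction_mul_inv₂ {Ω} (h : Φ.IsOmega B Ω) (hA : IsInjective A)
    (hcan : IsLeftCanonical A) (hΛ : IsNormalizedRightFixed A Λ) (x y : ι) :
    mulAction (Φ.act x) (Φ.act y) * Φ.inv₂ B x y = onBond D (Ω x y) := by
  rw [h x y, Matrix.mul_assoc, (Φ.isAction₂ B hA hcan hΛ x y).orth, Matrix.mul_one]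

theorem IsOmega.tripleDiagram_eq {Ω} (h : Φ.IsOmega B Ω) (hA : IsInjective A)
    (hcan : IsLeftCanonical A) (hΛ : IsNormalizedRightFixed A Λ) (x y : ι) (i : Fin (Φ.n x))
    (j : Fin (Φ.n y)) (k : Fin (Φ.n x) × Fin (Φ.n y)) (L₁ L₂ L₃ : ℕ) :
    tripleDiagram A (R.O x) (R.O y) (R.O₂ x y) 1 L₁ L₂ L₃
      (leftVec (Φ.act x) i) (leftVec (Φ.act y) j) (rightVec (Φ.inv₂ B x y) Λ k) =
      Ω x y (i, j) k := by
  rw [MPSFiber.tripleDiagram_eq _ _ _ _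
    (leftVec_mem (Φ.isAction x) hcan.sum_conjTranspose_mul i)
    (leftVec_mem (Φ.isAction y) hcan.sum_conjTranspose_mul j)
    (rightVec_mem (Φ.isAction₂ B hA hcan hΛ x y) hΛ k), actOnBond_one, glue_leftVec]
  exact leftVec_dotProduct_rightVec_of_eq hΛ.2 _ _ (h.mulAction_mul_inv₂ hA hcan hΛ x y) _ _

theorem IsOmega.tripleInnerProduct {Ω} (h : Φ.IsOmega B Ω) (hA : IsInjective A)
    (hcan : IsLeftCanonical A) (hΛ : IsNormalizedRightFixed A Λ) {J : JFamily R A}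
    (hJ : IsTripleInnerProduct R A J) (x y : ι) (i : Fin (Φ.n x)) (j : Fin (Φ.n y))
    (s : leftFixed A (R.O x)) (t : leftFixed A (R.O y))
    (hs : s.1 = leftVec (Φ.act x) i) (ht : t.1 = leftVec (Φ.act y) j) :
    (J x y (s ⊗ₜ[ℂ] t)).1 = ∑ k, Ω x y (i, j) k • leftVec (Φ.act₂ B x y) k ∧
      ∀ k, (J x y (s ⊗ₜ[ℂ] t)).1 ⬝ᵥ rightVec (Φ.inv₂ B x y) Λ k = Ω x y (i, j) k := by
  rw [(Φ.isTripleInnerProduct_iff hA hcan hΛ J).1 hJ, hs, ht, glue_leftVec]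
  refine ⟨by rw [h x y, leftVec_onBond_mul], fun k => ?_⟩
  exact leftVec_dotProduct_rightVec_of_eq hΛ.2 _ _ (h.mulAction_mul_inv₂ hA hcan hΛ x y) _ _

/-- Expanding `φ̂_{x ⊗ y}` into channels in `φ̂_x φ̂_y = Ω φ̂_{x ⊗ y}` displays `Ω * B.fus` as the
coefficients. -/
theorem IsOmega.isLSymbols {Ω} (h : Φ.IsOmega B Ω) :
    Φ.IsLSymbols fun x y i j z k μ => (Ω x y * B.fus x y z μ) (i, j) k := by
  rw [isLSymbols_iff]
  intro x y
  rw [h x y, Φ.act₂_eq, Matrix.mul_sum]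
  refine Finset.sum_congr rfl fun t _ => ?_
  rw [Matrix.mul_assoc (onBond D _), ← Matrix.mul_assoc, ← onBond_mul]
  rfl

/-- The open diagram is the L-symbol times the identity on the MPS bond, whose trace is `D`. -/
theorem IsLSymbols.eq_trace {L : Φ.LFamily} (h : Φ.IsLSymbols L) (hD : 0 < D) (x y : ι)
    (i : Fin (Φ.n x)) (j : Fin (Φ.n y)) (z : ι) (k : Fin (Φ.n z)) (μ : Fin (mult S x y z)) :
    L x y i j z k μ = (D : ℂ)⁻¹ * ∑ a, (mulAction (Φ.act x) (Φ.act y) *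
      onBond D (R.T.fus x y z μ) * Φ.inv z) ((i, j), a) (k, a) := by
  have hD' : (D : ℂ) ≠ 0 := Nat.cast_ne_zero.2 hD.ne'
  rw [h.mulAction_mul_fus_mul_inv]
  simp only [onBond, Matrix.kroneckerMap_apply, Matrix.one_apply_eq, mul_one, Finset.sum_const,
    Finset.card_univ, Fintype.card_fin, nsmul_eq_mul]
  rw [inv_mul_cancel_left₀ hD']
  rfl

/-- Here the MPS loop is closed with `Λ`, so `tr Λ = 1` replaces the factor `1 / D`. -/
theorem IsLSymbols.eq_tripleDiagram {L : Φ.LFamily} (h : Φ.IsLSymbols L)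
    (hcan : IsLeftCanonical A) (hΛ : IsNormalizedRightFixed A Λ) (x y : ι)
    (i : Fin (Φ.n x)) (j : Fin (Φ.n y)) (z : ι) (k : Fin (Φ.n z)) (μ : Fin (mult S x y z))
    (L₁ L₂ L₃ : ℕ) :
    L x y i j z k μ =
      tripleDiagram A (R.O x) (R.O y) (R.O z) (R.T.fus x y z μ) L₁ L₂ L₃
        (leftVec (Φ.act x) i) (leftVec (Φ.act y) j) (rightVec (Φ.inv z) Λ k) := by
  rw [MPSFiber.tripleDiagram_eq _ _ _ _
    (leftVec_mem (Φ.isAction x) hcan.sum_conjTranspose_mul i)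
    (leftVec_mem (Φ.isAction y) hcan.sum_conjTranspose_mul j)
    (rightVec_mem (Φ.isAction z) hΛ k), glue_leftVec, actOnBond_leftVec]
  exact (leftVec_dotProduct_rightVec_of_eq hΛ.2 _ _
    (h.mulAction_mul_fus_mul_inv x y z μ) (i, j) k).symm

end Cocycle

/-! ### The triple inner product as a fiber functor -/

section FiberFunctor

variable {C : Type u} [Category.{v} C] [Preadditive C] [Linear ℂ C]
    [MonoidalCategory C] [MonoidalPreadditive C] [MonoidalLinear ℂ C] [RigidCategory C]
    [Limits.HasFiniteBiproducts C] {ι : Type} [Fintype ι] {S : ι → C}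
    {F : FFamily S} {P : Type} [Fintype P] {R : MPORep S F P}
    {D : ℕ} {A : P → Matrix (Fin D) (Fin D) ℂ} {Λ : Fin D × Fin D → ℂ}

theorem exists_fiberFunctor (hS : IsFusionCategory S) (e : FusionBasis S) (hF : IsFSymbols e F)
    (hA : IsInjective A) (hcan : IsLeftCanonical A) (hΛ : IsNormalizedRightFixed A Λ)
    (Φ : Symmetry R A) {J : JFamily R A} {L : Φ.LFamily} (hJ : IsTripleInnerProduct R A J)
    (hL : Φ.IsLSymbols L) :
    ∃ (G : FiberFunctor C) (θ : ∀ x, G.F.obj (S x) ≃ₗ[ℂ] leftFixed A (R.O x))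
      (θ₂ : ∀ x y, G.F.obj (S x ⊗ S y) ≃ₗ[ℂ] leftFixed A (R.O₂ x y)),
      (∀ x y s t, θ₂ x y (G.tensorator (S x) (S y) s t) = J x y (θ x s ⊗ₜ[ℂ] θ y t)) ∧
      (∀ x y z μ r, (θ z (G.mapVec (e x y z μ) r)).1 =
        actOnBond (θ₂ x y r).1 (R.T.fus x y z μ)) ∧
      ∀ x y i j s t, (θ x s).1 = leftVec (Φ.act x) i → (θ y t).1 = leftVec (Φ.act y) j →
        ∀ z μ, (θ z (G.mapVec (e x y z μ) (G.tensorator (S x) (S y) s t))).1 =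
          ∑ k, L x y i j z k μ • leftVec (Φ.act z) k := by
  -- The functor is built with the L-symbols as fusion tensors. For this choice `φ̂_{x ⊗ y}` is the
  -- product `φ̂_x φ̂_y` itself, so no factor `Ω` intervenes between the tensorator and gluing.
  obtain ⟨L', B, hL', hBL⟩ := Φ.exists_isLSymbols hA hcan hΛ
  obtain rfl := hL'.unique hΛ.pos hL
  have hB : ∀ x y, ∑ t : Channel S x y, B.fus x y t.1 t.2 * B.spl x y t.1 t.2 = 1 :=
    fun x y => B.sum_fus_mul_spl (Φ.n_mul_n hA hcan hΛ x y)
  have hglue := (Φ.isTripleInnerProduct_iff hA hcan hΛ J).1 hJ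
  choose b hb using fun x => (Φ.isAction x).exists_leftBasis hA hcan hΛ
  choose b₂ hb₂ using fun x y => (Φ.isAction_mulAction x y).exists_leftBasis hA hcan hΛ
  let dec : ∀ c : C, Decomposition S c := fun c => (hS.nonempty_decomposition c).some
  let θ : ∀ x, fiberSpace Φ.n dec (S x) ≃ₗ[ℂ] leftFixed A (R.O x) :=
    fun x => (simpleCoord hS dec x).trans (b x).equivFun.symm
  -- The basis of `F^MPS(x ⊗ y)` consists of the rows of the product action tensor, so products of
  -- coordinates correspond to glued fixed points.
  let θ₂ : ∀ x y, fiberSpace Φ.n dec (S x ⊗ S y) ≃ₗ[ℂ] leftFixed A (R.O₂ x y) :=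
    fun x y => (simpleCoord₂ hS e B dec hB x y).trans (b₂ x y).equivFun.symm
  have hθ : ∀ x s, (θ x s).1 = leftComb (Φ.act x) (simpleCoord hS dec x s) := by
    intro x s
    simp only [θ, LinearEquiv.trans_apply, Module.Basis.equivFun_symm_apply,
      Submodule.coe_sum, Submodule.coe_smul, hb, leftComb]
  have hθ₂ : ∀ x y r, (θ₂ x y r).1 = leftComb (mulAction (Φ.act x) (Φ.act y))
      (simpleCoord₂ hS e B dec hB x y r) := by
    intro x y r
    simp only [θ₂, LinearEquiv.trans_apply, Module.Basis.equivFun_symm_apply,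
      Submodule.coe_sum, Submodule.coe_smul, hb₂, leftComb]
  have h1 : ∀ x y (s : fiberSpace Φ.n dec (S x)) (t : fiberSpace Φ.n dec (S y)),
      θ₂ x y (fiberMul e B dec s t) = J x y (θ x s ⊗ₜ[ℂ] θ y t) := by
    intro x y s t
    refine Subtype.ext ?_
    rw [hglue, hθ₂, hθ, hθ, glue_leftComb, simpleCoord₂_fiberMul]
  have h2 : ∀ x y z μ (r : fiberSpace Φ.n dec (S x ⊗ S y)),
      (θ z (fiberMap hS dec (e x y z μ) r)).1 = actOnBond (θ₂ x y r).1 (R.T.fus x y z μ) := by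
    intro x y z μ r
    -- Composing the product action tensor with an MPO fusion tensor produces the L-matrix in front
    -- of `Φ.act z`; this is the matrix by which the functor represents `e x y z μ`.
    rw [hθ, hθ₂, actOnBond_leftComb, hL'.mulAction_mul_fus, leftComb_onBond_mul,
      simpleCoord_fiberMap hS e B dec hB, hBL]
  have h3 : ∀ x y i j (s : fiberSpace Φ.n dec (S x)) (t : fiberSpace Φ.n dec (S y)),
      (θ x s).1 = leftVec (Φ.act x) i → (θ y t).1 = leftVec (Φ.act y) j →
      ∀ z μ, (θ z (fiberMap hS dec (e x y z μ) (fiberMul e B dec s t))).1 =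
        ∑ k, L' x y i j z k μ • leftVec (Φ.act z) k := by
    intro x y i j s t hs ht z μ
    rw [h2, h1, hglue, hs, ht, glue_leftVec, actOnBond_leftVec, hL'.mulAction_mul_fus,
      leftVec_onBond_mul]
    rfl
  have h4 := fiberFunctor_tensorator hS e B dec hB hF Φ.n_pos
  refine ⟨fiberFunctor hS e B dec hB hF Φ.n_pos, θ, θ₂, fun x y s t => ?_, h2,
    fun x y i j s t hs ht z μ => ?_⟩
  · exact (congrArg (θ₂ x y) (h4 (S x) (S y) s t)).trans (h1 x y s t)
  · exact (congrArg (fun r => (θ z (fiberMap hS dec (e x y z μ) r)).1)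
      (h4 (S x) (S y) s t)).trans (h3 x y i j s t hs ht z μ)

end FiberFunctor

end Symmetry

end MPSFiber

/-! ### Assembly of the main theorem -/

theorem mainTheorem3 {C : Type u} [Category.{v} C] [Preadditive C] [Linear ℂ C]
    [MonoidalCategory C] [MonoidalPreadditive C] [MonoidalLinear ℂ C] [RigidCategory C]
    [Limits.HasFiniteBiproducts C] {ι : Type} [Fintype ι] {S : ι → C} (hS : IsFusionCategory S)
    (e : FusionBasis S) {F : FFamily S} (hF : IsFSymbols e F)
    {P : Type} [Fintype P] (R : MPORep S F P)
    {D : ℕ} {A : P → Matrix (Fin D) (Fin D) ℂ} (hA : IsInjective A) (hcan : IsLeftCanonical A)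
    {Λ : Fin D × Fin D → ℂ} (hΛ : IsNormalizedRightFixed A Λ) (Φ : Symmetry R A) :
    -- `F^MPS(x)` has the basis `Λ_x^{L(i)}`, with dual basis `Λ_x^{R(i)}`
    (∀ x, ∃ (bL : Module.Basis (Fin (Φ.n x)) ℂ (leftFixed A (R.O x)))
        (bR : Module.Basis (Fin (Φ.n x)) ℂ (rightFixed A (R.O x))),
      (∀ i, (bL i).1 = leftVec (Φ.act x) i) ∧ (∀ i, (bR i).1 = rightVec (Φ.inv x) Λ i) ∧
      ∀ i j, (bL i).1 ⬝ᵥ (bR j).1 = if i = j then 1 else 0) ∧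
    -- the numbers `n x` are the quantum dimensions
    (∀ x y, Φ.n x * Φ.n y = ∑ z, mult S x y z * Φ.n z) ∧
    -- the triple inner product, the L-symbols and the auxiliary fusion tensors exist
    (∃! J, IsTripleInnerProduct R A J) ∧ (∃! L, Φ.IsLSymbols L) ∧
    Nonempty (FusionTensors S F Φ.n) ∧
    -- the non-abelian factor system and the triple inner product
    (∀ B : FusionTensors S F Φ.n,
      (∀ x y, IsAction A (R.O₂ x y) (Φ.act₂ B x y) (Φ.inv₂ B x y)) ∧
      (∀ x y z, Φ.actLeft B x y z = (Φ.actRight B x y z).submatrix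
        (Prod.map (Equiv.prodAssoc _ _ _) id) (Prod.map (Equiv.prodAssoc _ _ _) id)) ∧
      (∃! Ω, Φ.IsOmega B Ω) ∧ (∃! Ωl, Φ.IsOmegaLeft B Ωl) ∧ (∃! Ωr, Φ.IsOmegaRight B Ωr) ∧
      (∀ x y, ∃ (bL : Module.Basis (Fin (Φ.n x) × Fin (Φ.n y)) ℂ (leftFixed A (R.O₂ x y)))
          (bR : Module.Basis (Fin (Φ.n x) × Fin (Φ.n y)) ℂ (rightFixed A (R.O₂ x y))),
        (∀ k, (bL k).1 = leftVec (Φ.act₂ B x y) k) ∧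
        (∀ k, (bR k).1 = rightVec (Φ.inv₂ B x y) Λ k) ∧
        ∀ k l, (bL k).1 ⬝ᵥ (bR l).1 = if k = l then 1 else 0) ∧
      ∀ Ω Ωl Ωr, Φ.IsOmega B Ω → Φ.IsOmegaLeft B Ωl → Φ.IsOmegaRight B Ωr →
        (∀ x y, IsUnit (Ω x y)) ∧ (∀ x y z, IsUnit (Ωl x y z)) ∧ (∀ x y z, IsUnit (Ωr x y z)) ∧
        -- the cocycle condition, read from left to right
        (∀ x y z, (Ω x y ⊗ₖ (1 : Matrix (Fin (Φ.n z)) (Fin (Φ.n z)) ℂ)) * Ωl x y z =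
          (((1 : Matrix (Fin (Φ.n x)) (Fin (Φ.n x)) ℂ) ⊗ₖ Ω y z) * Ωr x y z).submatrix
            (Equiv.prodAssoc _ _ _) (Equiv.prodAssoc _ _ _)) ∧
        -- the triple diagram with fixed points at its ends, for wings of any length
        (∀ x y i j k L₁ L₂ L₃,
          tripleDiagram A (R.O x) (R.O y) (R.O₂ x y) 1 L₁ L₂ L₃
            (leftVec (Φ.act x) i) (leftVec (Φ.act y) j) (rightVec (Φ.inv₂ B x y) Λ k) =
            Ω x y (i, j) k) ∧
        -- the matrix of the linear map `J` is `Ω`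
        (∀ J, IsTripleInnerProduct R A J → ∀ x y i j
          (s : leftFixed A (R.O x)) (t : leftFixed A (R.O y)),
          s.1 = leftVec (Φ.act x) i → t.1 = leftVec (Φ.act y) j →
          (J x y (s ⊗ₜ[ℂ] t)).1 = ∑ k, Ω x y (i, j) k • leftVec (Φ.act₂ B x y) k ∧
          ∀ k, (J x y (s ⊗ₜ[ℂ] t)).1 ⬝ᵥ rightVec (Φ.inv₂ B x y) Λ k = Ω x y (i, j) k) ∧
        -- the L-symbols from `Ω`
        (∀ L, Φ.IsLSymbols L → ∀ x y i j z k μ,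
          L x y i j z k μ = (Ω x y * B.fus x y z μ) (i, j) k)) ∧
    -- the L-symbols as closed diagrams
    (∀ L, Φ.IsLSymbols L → ∀ x y i j z k μ,
      L x y i j z k μ = (D : ℂ)⁻¹ * ∑ a, (mulAction (Φ.act x) (Φ.act y) *
        onBond D (R.T.fus x y z μ) * Φ.inv z) ((i, j), a) (k, a) ∧
      ∀ L₁ L₂ L₃, L x y i j z k μ =
        tripleDiagram A (R.O x) (R.O y) (R.O z) (R.T.fus x y z μ) L₁ L₂ L₃
          (leftVec (Φ.act x) i) (leftVec (Φ.act y) j) (rightVec (Φ.inv z) Λ k)) ∧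
    -- `(F^MPS, J^MPS)` is a fiber functor, with the L-symbols as matrix elements
    (∀ J L, IsTripleInnerProduct R A J → Φ.IsLSymbols L →
      ∃ (G : FiberFunctor C) (θ : ∀ x, G.F.obj (S x) ≃ₗ[ℂ] leftFixed A (R.O x))
        (θ₂ : ∀ x y, G.F.obj (S x ⊗ S y) ≃ₗ[ℂ] leftFixed A (R.O₂ x y)),
        (∀ x y s t, θ₂ x y (G.tensorator (S x) (S y) s t) = J x y (θ x s ⊗ₜ[ℂ] θ y t)) ∧
        (∀ x y z μ r, (θ z (G.mapVec (e x y z μ) r)).1 =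
          actOnBond (θ₂ x y r).1 (R.T.fus x y z μ)) ∧
        ∀ x y i j s t, (θ x s).1 = leftVec (Φ.act x) i → (θ y t).1 = leftVec (Φ.act y) j →
          ∀ z μ, (θ z (G.mapVec (e x y z μ) (G.tensorator (S x) (S y) s t))).1 =
            ∑ k, L x y i j z k μ • leftVec (Φ.act z) k) := by
  refine ⟨fun x => (Φ.isAction x).exists_dual_bases hA hcan hΛ, Φ.n_mul_n hA hcan hΛ,
    Φ.existsUnique_tripleInnerProduct hA hcan hΛ, ?_, ?_, fun B => ?_, fun L hL => ?_,
    fun J L hJ hL => Φ.exists_fiberFunctor hS e hF hA hcan hΛ hJ hL⟩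
  · obtain ⟨L, -, hL, -⟩ := Φ.exists_isLSymbols hA hcan hΛ
    exact ⟨L, hL, fun L' hL' => hL'.unique hΛ.pos hL⟩
  · obtain ⟨-, B, -, -⟩ := Φ.exists_isLSymbols hA hcan hΛ
    exact ⟨B⟩
  · refine ⟨Φ.isAction₂ B hA hcan hΛ, Φ.actLeft_eq_actRight B,
      Symmetry.existsUnique_isOmega B hA hcan hΛ, Symmetry.existsUnique_isOmegaLeft B hA hcan hΛ,
      Symmetry.existsUnique_isOmegaRight B hA hcan hΛ,
      fun x y => (Φ.isAction₂ B hA hcan hΛ x y).exists_dual_bases hA hcan hΛ,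
      fun Ω Ωl Ωr h hl hr => ⟨h.isUnit hA hcan hΛ, hl.isUnit hA hcan hΛ, hr.isUnit hA hcan hΛ,
        h.cocycle hl hr hA hcan hΛ, h.tripleDiagram_eq hA hcan hΛ,
        fun J hJ => h.tripleInnerProduct hA hcan hΛ hJ, fun L hL x y i j z k μ => ?_⟩⟩
    -- The numbers `Ω * B.fus` satisfy the defining relation of the L-symbols, which has only one
    -- solution.
    rw [hL.unique hΛ.pos h.isLSymbols]
  · exact fun x y i j z k μ => ⟨hL.eq_trace hΛ.pos x y i j z k μ,
      hL.eq_tripleDiagram hcan hΛ x y i j z k μ⟩
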